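/- Let $\Gamma$ be a finite oriented graph (loops and multiple links allowed) with set of links $L$, all of whose nodes have valence greater than $2$. Let the nodes be divided into those in a region $A$ and those in the complementary region $\bar A$. A link is inside $A$ (inside $\bar A$) if both its ends are nodes in $A$ (in $\bar A$), and is cut if it joins a node in $A$ with a node in $\bar A$; assume that at least one link is cut. Let $\mathcal H^{\rm aux}=L^2(SU(2)^{L})$ with respect to the product of the normalized Haar measures. For a family $g=(g_{(n,l)})$ of elements of $SU(2)$ indexed by the ends of the links, let $(T_g\psi)(h)=\psi\big((g_{(s(l),l)}^{-1}h_l\,g_{(t(l),l)})_l\big)$, where $s(l),t(l)$ are the source and the target of $l$. Let $\mathcal H\subset\mathcal H^{\rm aux}$ be the closed subspace of gauge-invariant states, that is of those fixed by $T_g$ for all $g$ for which $g_{(n,l)}$ depends only on the node $n$, and let $p$ be the orthogonal projection of $\mathcal H^{\rm aux}$ onto $\mathcal H$. Let $\mathcal M_0\subset\mathcal B(\mathcal H^{\rm aux})$ be the closure, in the weak operator topology, of the unital $*$-algebra generated by (i) the multiplication operators by the continuous complex functions of the holonomies $(h_l)$ of the links $l$ inside $A$, and (ii) the Weyl operators of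 fluxes $\exp\big(i\sum_{(n,l)}\vec t_{(n,l)}\cdot\vec J_{(n,l)}\big)$, $\vec t_{(n,l)}\in\mathbb R^3$, the sum being over all link-ends at nodes $n\in A$ (of links inside $A$ and of cut links); this operator is $T_g$ with $g_{(n,l)}=\exp(\tfrac i2\,\vec t_{(n,l)}\cdot\vec\sigma)$ for $n\in A$ and $g_{(n,l)}=1$ for $n\in\bar A$, where $\vec\sigma$ are the Pauli matrices. Let $\mathcal M=p\,\mathcal M_0\,p$, as a set of operators on $\mathcal H$. For spins $j=(j_l)_l$, $j_l\in\{0,\tfrac12,1,\dots\}$, let $\mathcal H_n(j)=\mathrm{Inv}_{SU(2)}\big(\bigotimes_{s(l)=n}V_{j_l}\otimes\bigotimes_{t(l)=n}V_{j_l}^*\big)$ be the space of intertwiners at $n$, where $V_j$ is the irreducible unitary representation of $SU(2)$ of spin $j$. For an assignment $\alpha$ of spins to the cut links, let $\mathcal H_{A,\alpha}=\bigoplus_{(j_l)_{l\subset A}}\bigotimes_{n\in A}\mathcal H_n(j)$ be the Hilbert space direct sum over the spins of the links inside $A$, the spins of the cut links being given by $\alpha$, and define $\mathcal H_{\bar A,\alpha}$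 likewise. Then $\mathcal M$ is a von Neumann algebra on $\mathcal H$; it is of type I, that is every nonzero central projection dominates a nonzero abelian projection of $\mathcal M$; and it is not a factor. Moreover, the Peter–Weyl isomorphism $\bigoplus_j V_j\otimes V_j^*\simeq L^2(SU(2))$, $u\otimes\xi\mapsto\big(h\mapsto\sqrt{2j+1}\,\xi(h^{-1}u)\big)$, on every link, gives a unitary map $U:\mathcal H\to\bigoplus_\alpha\mathcal H_{A,\alpha}\otimes\mathcal H_{\bar A,\alpha}$ (Hilbert space direct sum over all $\alpha$), and $$U\mathcal M U^{-1}=\bigoplus_\alpha\mathcal B(\mathcal H_{A,\alpha})\otimes I_{\bar A,\alpha},$$ that is, a bounded operator $T$ on $\mathcal H$ is in $\mathcal M$ if and only if there are bounded operators $O_\alpha$ on $\mathcal H_{A,\alpha}$ with $UTU^{-1}=\bigoplus_\alpha O_\alpha\otimes I_{\bar A,\alpha}$. The centre of $\mathcal M$ is labelled by the boundary spins: it consists of the bounded operators $T$ on $\mathcal H$ for which $UTU^{-1}$ acts as a scalar $c_\alpha$ on $\mathcal H_{A,\alpha}\otimes\mathcal H_{\bar A,\alpha}$ for every $\alpha$.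 -/

import Mathlib

open MeasureTheory ComplexConjugate
open scoped TensorProduct ENNReal

noncomputable section

namespace LQG

/-! ### The group `SU(2)`, its Haar measure, its exponential map, its irreducible representations -/

/-- The group `SU(2)`. -/
abbrev SU2 : Type := Matrix.specialUnitaryGroup (Fin 2) ℂ

instance : MeasurableSpace SU2 := borel SU2

instance : BorelSpace SU2 := ⟨rfl⟩

instance : SecondCountableTopology SU2 :=
  inferInstanceAs (SecondCountableTopology
    {M : Fin 2 → Fin 2 → ℂ // M ∈ Matrix.specialUnitaryGroup (Fin 2) ℂ})

instance : T2Space SU2 :=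
  inferInstanceAs (T2Space {M : Fin 2 → Fin 2 → ℂ // M ∈ Matrix.specialUnitaryGroup (Fin 2) ℂ})

instance : IsTopologicalGroup SU2 where
  continuous_mul := by fun_prop
  continuous_inv := by
    refine Continuous.subtype_mk ?_ _
    exact (continuous_subtype_val (p := fun M => M ∈ Matrix.specialUnitaryGroup (Fin 2) ℂ)).star

instance : CompactSpace SU2 := by
  refine (isCompact_iff_compactSpace (X := Matrix (Fin 2) (Fin 2) ℂ)
    (s := (Matrix.specialUnitaryGroup (Fin 2) ℂ : Set _))).1 ?_
  have hK : IsCompact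
      (Set.univ.pi fun _ : Fin 2 => Set.univ.pi fun _ : Fin 2 => Metric.closedBall (0 : ℂ) 1) :=
    isCompact_univ_pi fun _ => isCompact_univ_pi fun _ => isCompact_closedBall _ _
  refine IsCompact.of_isClosed_subset (X := Matrix (Fin 2) (Fin 2) ℂ) hK ?_ ?_
  · have h1 : IsClosed {M : Matrix (Fin 2) (Fin 2) ℂ | M * star M = 1 ∧ M.det = 1} := by
      refine IsClosed.inter ?_ ?_
      · exact isClosed_eq (continuous_id.mul continuous_id.star) continuous_const
      · exact isClosed_eq continuous_id.matrix_det continuous_const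
    convert h1 using 1
    ext M
    simp [Matrix.mem_specialUnitaryGroup_iff, Matrix.mem_unitaryGroup_iff]
  · intro M hM i _ j _
    have := entry_norm_bound_of_unitary (Matrix.mem_specialUnitaryGroup_iff.1 hM).1 i j
    simpa using this

/-- The Haar measure of `SU(2)` of total mass one. -/
def haarSU2 : Measure SU2 := Measure.haarMeasure ⊤

instance : haarSU2.IsHaarMeasure := by unfold haarSU2; infer_instance

instance : IsProbabilityMeasure haarSU2 :=
  ⟨by simpa [haarSU2] using Measure.haarMeasure_self (K₀ := (⊤ : TopologicalSpace.PositiveCompacts SU2))⟩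

instance : haarSU2.IsMulRightInvariant where
  map_mul_right_eq_self g := by
    have : IsProbabilityMeasure (Measure.map (fun x => x * g) haarSU2) :=
      Measure.isProbabilityMeasure_map (by fun_prop)
    exact Measure.isHaarMeasure_eq_of_isProbabilityMeasure _ _

/-- The Pauli matrices. -/
def pauli : Fin 3 → Matrix (Fin 2) (Fin 2) ℂ :=
  ![!![0, 1; 1, 0], !![0, -Complex.I; Complex.I, 0], !![1, 0; 0, -1]]

/-- The element `(i / 2) ∑ t_k σ_k` of the Lie algebra of `SU(2)`. -/
def su2Lie (t : Fin 3 → ℝ) : Matrix (Fin 2) (Fin 2) ℂ :=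
  (Complex.I / 2) • ∑ k, (t k : ℂ) • pauli k

theorem star_su2Lie (t : Fin 3 → ℝ) : star (su2Lie t) = -su2Lie t := by
  ext i j
  fin_cases i <;> fin_cases j <;>
    simp [su2Lie, pauli, Fin.sum_univ_three, Matrix.star_apply] <;> ring

theorem pauli_conj_su2Lie (t : Fin 3 → ℝ) :
    pauli 1 * (su2Lie t).transpose * (pauli 1)⁻¹ = -su2Lie t := by
  have h : (pauli 1)⁻¹ = pauli 1 := by
    refine Matrix.inv_eq_left_inv ?_
    ext i j
    fin_cases i <;> fin_cases j <;> simp [pauli, Matrix.mul_apply]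
  rw [h]
  ext i j
  fin_cases i <;> fin_cases j <;>
    simp [su2Lie, pauli, Fin.sum_univ_three, Matrix.mul_apply, Fin.sum_univ_two, Matrix.vecMul, dotProduct] <;>
    ring_nf <;> try (simp only [Complex.I_sq, Complex.I_pow_three, Complex.I_pow_four]; ring_nf)

theorem det_exp_su2Lie_sq (t : Fin 3 → ℝ) : (NormedSpace.exp (su2Lie t)).det ^ 2 = 1 := by
  have hu : IsUnit (pauli 1) := by
    rw [Matrix.isUnit_iff_isUnit_det]
    simp [pauli, Matrix.det_fin_two]
  have h1 := congrArg NormedSpace.exp (pauli_conj_su2Lie t)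
  rw [Matrix.exp_conj _ _ hu, Matrix.exp_transpose, Matrix.exp_neg] at h1
  have h2 := congrArg Matrix.det h1
  rw [Matrix.det_conj hu, Matrix.det_transpose] at h2
  have h3 : IsUnit (NormedSpace.exp (su2Lie t)).det :=
    (Matrix.isUnit_iff_isUnit_det _).1 (Matrix.isUnit_exp _)
  rw [sq]
  nth_rewrite 2 [h2]
  rw [← Matrix.det_mul, Matrix.mul_nonsing_inv _ h3, Matrix.det_one]

theorem exp_su2Lie_mem (t : Fin 3 → ℝ) :
    NormedSpace.exp (su2Lie t) ∈ Matrix.specialUnitaryGroup (Fin 2) ℂ := by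
  rw [Matrix.mem_specialUnitaryGroup_iff, Matrix.mem_unitaryGroup_iff]
  constructor
  · rw [Matrix.star_eq_conjTranspose, ← Matrix.exp_conjTranspose, ← Matrix.star_eq_conjTranspose,
      star_su2Lie, Matrix.exp_neg]
    exact Matrix.mul_nonsing_inv _ ((Matrix.isUnit_iff_isUnit_det _).1 (Matrix.isUnit_exp _))
  · have h : su2Lie t = 2 • su2Lie fun k => t k / 2 := by
      simp only [su2Lie, Finset.smul_sum, ← Nat.cast_smul_eq_nsmul ℂ, smul_smul]
      refine Finset.sum_congr rfl fun k _ => ?_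
      congr 1
      push_cast
      ring
    rw [h, Matrix.exp_nsmul, Matrix.det_pow, det_exp_su2Lie_sq]

/-- The exponential map `ℝ³ ≃ su(2) → SU(2)`, `t ↦ exp((i / 2) ∑ t_k σ_k)`. -/
def su2Exp (t : Fin 3 → ℝ) : SU2 := ⟨NormedSpace.exp (su2Lie t), exp_su2Lie_mem t⟩

/-- The matrix entry `D_{mn}(g)`, `m, n ∈ {0, …, k}`, of the irreducible unitary representation
`V_j` of `SU(2)` of spin `j = k / 2`, in the orthonormal basis of vectors of definite third
component of the angular momentum.

`V_j` is the space of homogeneous polynomials of degree `k` in `x, y`, on which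
`g = !![a, b; c, d]` acts by `x ↦ a x + c y`, `y ↦ b x + d y`, with orthonormal basis
`(k.choose n)^{1/2} x^{k-n} y^n`.  The polynomials are written below with `x = 1`, `y = X`. -/
def wignerD (k m n : ℕ) (g : SU2) : ℂ :=
  (Real.sqrt ((k.choose n : ℝ) / (k.choose m : ℝ)) : ℂ) *
    ((Polynomial.C (g.1 0 0) + Polynomial.C (g.1 1 0) * Polynomial.X) ^ (k - n) *
      (Polynomial.C (g.1 0 1) + Polynomial.C (g.1 1 1) * Polynomial.X) ^ n).coeff m

/-! ### Graphs -/

/-- An oriented graph with set of nodes `N` and set of links `L`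
(loops and multiple links are allowed). -/
structure OrientedGraph (N L : Type*) where
  /-- The source of a link. -/
  src : L → N
  /-- The target of a link. -/
  tgt : L → N

/-- The two ends of the links: `(l, false)` is the end of `l` at its source and `(l, true)` is the
end of `l` at its target. -/
abbrev HalfLink (L : Type*) : Type _ := L × Bool

variable {N L : Type*} [Fintype N] [DecidableEq N] [Fintype L] [DecidableEq L]

/-- The node at which a half-link is attached. -/
def OrientedGraph.node (G : OrientedGraph N L) (x : HalfLink L) : N :=
  if x.2 then G.tgt x.1 else G.src x.1

/-- The valence of a node: the number of half-links attached to it. -/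
def OrientedGraph.valence (G : OrientedGraph N L) (n : N) : ℕ :=
  Fintype.card {x : HalfLink L // G.node x = n}

/-- The link `l` lies inside the region with set of nodes `R`. -/
abbrev OrientedGraph.IsInner (G : OrientedGraph N L) (R : Finset N) (l : L) : Prop :=
  G.src l ∈ R ∧ G.tgt l ∈ R

/-- The link `l` is cut by the surface that separates the region with set of nodes `A` from its
complement. -/
abbrev OrientedGraph.IsCut (G : OrientedGraph N L) (A : Finset N) (l : L) : Prop :=
  (G.src l ∈ A ∧ G.tgt l ∉ A) ∨ (G.src l ∉ A ∧ G.tgt l ∈ A)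

/-! ### The auxiliary Hilbert space, gauge invariance, holonomies and fluxes -/

/-- The product of the Haar measures on `SU(2)^L`. -/
def haarPi (L : Type*) [Fintype L] : Measure (L → SU2) := Measure.pi fun _ => haarSU2

instance (L : Type*) [Fintype L] : IsProbabilityMeasure (haarPi L) := by
  unfold haarPi; infer_instance

/-- The Hilbert space `L²(SU(2)^L)` of not necessarily gauge invariant states. -/
abbrev HAux (L : Type*) [Fintype L] : Type _ := Lp ℂ 2 (haarPi L)

/-- The map `h_l ↦ g_{(l, source)}⁻¹ h_l g_{(l, target)}` of `SU(2)^L`. -/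
def translationMap (g : HalfLink L → SU2) (h : L → SU2) : L → SU2 :=
  fun l => (g (l, false))⁻¹ * h l * g (l, true)

theorem measurePreserving_translationMap {L : Type*} [Fintype L] (g : HalfLink L → SU2) :
    MeasurePreserving (translationMap g) (haarPi L) (haarPi L) :=
  measurePreserving_pi (fun _ : L => haarSU2) (fun _ : L => haarSU2)
    (f := fun l x => (g (l, false))⁻¹ * x * g (l, true)) fun l =>
      (measurePreserving_mul_right haarSU2 (g (l, true))).comp
        (measurePreserving_mul_left haarSU2 (g (l, false))⁻¹)

/-- The operator `(T_g ψ)(h) = ψ(g_{(l, source)}⁻¹ h_l g_{(l, target)})` on `L²(SU(2)^L)`.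
Under `L²(SU(2)) ≃ ⨁ V_j ⊗ V_j^*` the element `g_{(l, source)}` acts on `V_{j_l}` and the element
`g_{(l, target)}` acts on `V_{j_l}^*`. -/
def translation (g : HalfLink L → SU2) : HAux L →L[ℂ] HAux L :=
  (Lp.compMeasurePreservingₗᵢ ℂ (translationMap g)
    (measurePreserving_translationMap g)).toContinuousLinearMap

/-- The closed subspace of the gauge invariant states: those which are invariant under
`h_l ↦ g_{s(l)}⁻¹ h_l g_{t(l)}` for all assignments of elements of `SU(2)` to the nodes. -/
def HInv (G : OrientedGraph N L) : Submodule ℂ (HAux L) :=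
  ⨅ g : N → SU2, LinearMap.ker
    (translation (g ∘ G.node) - ContinuousLinearMap.id ℂ (HAux L)).toLinearMap

theorem isClosed_HInv {N L : Type*} [Fintype L] (G : OrientedGraph N L) : IsClosed (HInv G : Set (HAux L)) := by
  rw [HInv, Submodule.coe_iInf]
  exact isClosed_iInter fun g => ContinuousLinearMap.isClosed_ker _

instance (G : OrientedGraph N L) : CompleteSpace (HInv G) :=
  (isClosed_HInv G).completeSpace_coe

/-- The function `f(h_l)` of the holonomies along the links `l` inside `A`, as a multiplication
operator on `L²(SU(2)^L)`. -/
def holonomyOp (G : OrientedGraph N L) (A : Finset N) (f : C({l // G.IsInner A l} → SU2, ℂ)) :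
    HAux L →L[ℂ] HAux L :=
  (ContinuousLinearMap.mul ℂ ℂ).holderL (haarPi L) ∞ 2 2
    (ContinuousMap.toLp ∞ (haarPi L) ℂ
      (f.comp ⟨fun h l => h l.1, by fun_prop⟩))

/-- The Weyl operator of the fluxes `exp(i ∑_x t_x · J_x)`, the sum being over the half-links `x`
which are attached to nodes in `A`, of links inside `A` and of cut links.

The flux `J_x` is the vector of infinitesimal generators of the translations `translation` along
the half-link `x`, so that `s ↦ weylOp G A (s • t)` is the strongly continuous one-parameter
unitary group with generator `∑_x t_x · J_x`.  It acts by `exp(i s t_x · J)` on the factor `V_j` or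
`V_j^*` which sits at the half-link `x`. -/
def weylOp (G : OrientedGraph N L) (A : Finset N)
    (t : {x : HalfLink L // G.node x ∈ A} → Fin 3 → ℝ) : HAux L →L[ℂ] HAux L :=
  translation fun x => if hx : G.node x ∈ A then su2Exp (t ⟨x, hx⟩) else 1

/-- The closure in the weak operator topology of the unital `*`-algebra which is generated by the
continuous functions of holonomies in `A` and the Weyl operators of fluxes in `A`. -/
def algHolFlux (G : OrientedGraph N L) (A : Finset N) : Set (HAux L →L[ℂ] HAux L) :=
  {T | ContinuousLinearMapWOT.ofCLM T ∈ closure ((ContinuousLinearMapWOT.ofCLM :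
      (HAux L →L[ℂ] HAux L) → (HAux L →WOT[ℂ] HAux L)) ''
    (StarAlgebra.adjoin ℂ (Set.range (holonomyOp G A) ∪ Set.range (weylOp G A)) :
      Set (HAux L →L[ℂ] HAux L)))}

/-- The set `p M₀ p` of operators on the space of gauge invariant states, where `M₀` is the weak
closure of the algebra of holonomies and fluxes in `A` and `p` is the orthogonal projection to the
gauge invariant states. -/
def gaugeInvAlg (G : OrientedGraph N L) (A : Finset N) : Set (HInv G →L[ℂ] HInv G) :=
  {S | ∃ T ∈ algHolFlux G A,
    S = (HInv G).orthogonalProjectionOnto ∘L T ∘L (HInv G).subtypeL}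

/-! ### Von Neumann algebras -/

/-- The centre of a von Neumann algebra. -/
def centre {H : Type*} [NormedAddCommGroup H] [InnerProductSpace ℂ H] [CompleteSpace H]
    (M : VonNeumannAlgebra H) : Set (H →L[ℂ] H) :=
  {T | T ∈ M ∧ T ∈ M.commutant}

/-- A von Neumann algebra is a factor if its centre consists of the multiples of the identity. -/
def IsFactor {H : Type*} [NormedAddCommGroup H] [InnerProductSpace ℂ H] [CompleteSpace H]
    (M : VonNeumannAlgebra H) : Prop :=
  ∀ T ∈ centre M, ∃ c : ℂ, T = c • (1 : H →L[ℂ] H)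

/-- A von Neumann algebra `M` is of type I if every nonzero central projection dominates a nonzero
abelian projection, that is a projection `p ∈ M` for which `p M p` is commutative.
For factors, this is the existence of a nonzero minimal projection. -/
def IsTypeI {H : Type*} [NormedAddCommGroup H] [InnerProductSpace ℂ H] [CompleteSpace H]
    (M : VonNeumannAlgebra H) : Prop :=
  ∀ z ∈ centre M, IsStarProjection z → z ≠ 0 →
    ∃ p ∈ M, IsStarProjection p ∧ p ≠ 0 ∧ z * p = p ∧
      ∀ S ∈ M, ∀ T ∈ M, (p * S * p) * (p * T * p) = (p * T * p) * (p * S * p)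

/-! ### The spaces of intertwiners and the decomposition into sectors

A spin `j ∈ {0, 1/2, 1, …}` is given by the natural number `2 j`. -/

/-- The boundary spins `α`: an assignment of spins to the cut links. -/
abbrev BoundarySpins (G : OrientedGraph N L) (A : Finset N) : Type _ :=
  {l // G.IsCut A l} → ℕ

/-- An assignment of spins to the links inside the region `R`. -/
abbrev InnerSpins (G : OrientedGraph N L) (R : Finset N) : Type _ :=
  {l // G.IsInner R l} → ℕ

/-- For `R = A` or `R` the complement of `A`: the spins on the links which touch `R`, given the
spins `α` on the cut links and the spins `j` on the links inside `R`
(the value on the remaining links is irrelevant). -/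
def regionSpins (G : OrientedGraph N L) (A R : Finset N) (α : BoundarySpins G A)
    (j : InnerSpins G R) (l : L) : ℕ :=
  if h : G.IsInner R l then j ⟨l, h⟩ else if h : G.IsCut A l then α ⟨l, h⟩ else 0

/-- The space `⨂_{s(l) = n} V_{j_l} ⊗ ⨂_{t(l) = n} V_{j_l}^*` at the node `n`, in the coordinates
of the orthonormal basis of tensor products of the basis vectors. -/
abbrev NodeSpace (G : OrientedGraph N L) (k : L → ℕ) (n : N) : Type _ :=
  EuclideanSpace ℂ (∀ x : {x : HalfLink L // G.node x = n}, Fin (k x.1.1 + 1))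

/-- The matrix entries of the representation of `SU(2)` at a half-link: `V_j` at the source of a
link and the dual representation `V_j^*`, `g ↦ D(g⁻¹)ᵀ`, at its target. -/
def halfLinkRep (k : L → ℕ) (x : HalfLink L) (g : SU2) (m m' : ℕ) : ℂ :=
  if x.2 then wignerD (k x.1) m' m g⁻¹ else wignerD (k x.1) m m' g

/-- The action of `g ∈ SU(2)` on the space at a node. -/
def nodeAction (G : OrientedGraph N L) (k : L → ℕ) (n : N) (g : SU2) :
    NodeSpace G k n →ₗ[ℂ] NodeSpace G k n :=
  Matrix.toLpLin 2 2 (Matrix.of fun m m' => ∏ x, halfLinkRep k x.1 g (m x) (m' x))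

/-- The space of intertwiners: the `SU(2)`-invariant vectors at a node. -/
def intertwiners (G : OrientedGraph N L) (k : L → ℕ) (n : N) : Submodule ℂ (NodeSpace G k n) :=
  ⨅ g : SU2, LinearMap.ker (nodeAction G k n g - LinearMap.id)

/-- The tensor product over the nodes `n ∈ R` of the spaces at the nodes, in the coordinates of the
orthonormal basis of tensor products of the basis vectors. -/
abbrev RegionSpace (G : OrientedGraph N L) (R : Finset N) (k : L → ℕ) : Type _ :=
  EuclideanSpace ℂ (∀ x : {x : HalfLink L // G.node x ∈ R}, Fin (k x.1.1 + 1))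

/-- The vector `⨂_{n ∈ R} w_n`. -/
def productVector (G : OrientedGraph N L) (R : Finset N) (k : L → ℕ)
    (w : ∀ n : R, NodeSpace G k n) : RegionSpace G R k :=
  WithLp.toLp 2 fun m => ∏ n : R, w n fun x => m ⟨x.1, x.2.symm ▸ n.2⟩

/-- The tensor product over the nodes `n ∈ R` of the spaces of intertwiners. -/
def regionIntertwiners (G : OrientedGraph N L) (R : Finset N) (k : L → ℕ) :
    Submodule ℂ (RegionSpace G R k) :=
  Submodule.span ℂ {v | ∃ w : ∀ n : R, NodeSpace G k n,
    (∀ n : R, w n ∈ intertwiners G k n.1) ∧ v = productVector G R k w}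

/-- The Hilbert space `H_{R, α}`, `R = A` or `R` the complement of `A`: the Hilbert space direct sum
over the spins on the links inside `R` of the tensor products of intertwiner spaces. -/
abbrev HRegion (G : OrientedGraph N L) (A R : Finset N) (α : BoundarySpins G A) : Type _ :=
  lp (fun j : InnerSpins G R => regionIntertwiners G R (regionSpins G A R α j)) 2

/-- The tensor product of Hilbert spaces. -/
abbrev HilbertTensor (E F : Type*) [NormedAddCommGroup E] [InnerProductSpace ℂ E]
    [NormedAddCommGroup F] [InnerProductSpace ℂ F] : Type _ :=
  UniformSpace.Completion (E ⊗[ℂ] F)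

/-- The pure tensors in the tensor product of Hilbert spaces. -/
def pureTensor {E F : Type*} [NormedAddCommGroup E] [InnerProductSpace ℂ E]
    [NormedAddCommGroup F] [InnerProductSpace ℂ F] (v : E) (w : F) : HilbertTensor E F :=
  ((v ⊗ₜ[ℂ] w : E ⊗[ℂ] F) : UniformSpace.Completion (E ⊗[ℂ] F))

/-- The Hilbert space direct sum over the boundary spins of `H_{A, α} ⊗ H_{Ā, α}`, where `Ā` is the
complement of `A`. -/
abbrev HSectors (G : OrientedGraph N L) (A : Finset N) : Type _ :=
  lp (fun α : BoundarySpins G A => HilbertTensor (HRegion G A A α) (HRegion G A Aᶜ α)) 2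

/-- The vector of the direct sum over the boundary spins with component `v ⊗ w` at `α`. -/
def sectorTensor (G : OrientedGraph N L) (A : Finset N) (α : BoundarySpins G A)
    (v : HRegion G A A α) (w : HRegion G A Aᶜ α) : HSectors G A :=
  lp.single 2 α (pureTensor v w)

/-- All the spins: `jA` on the links inside `A`, `jB` on the links inside the complement of `A`,
`α` on the cut links. -/
def allSpins (G : OrientedGraph N L) (A : Finset N) (α : BoundarySpins G A) (jA : InnerSpins G A)
    (jB : InnerSpins G Aᶜ) (l : L) : ℕ :=
  if G.IsInner A l then regionSpins G A A α jA l else regionSpins G A Aᶜ α jB l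

/-- All the magnetic indices: those of the half-links at nodes in `A` and those of the half-links
at nodes in the complement of `A`. -/
def allIndices (G : OrientedGraph N L) (A : Finset N) {kA kB : L → ℕ}
    (mA : ∀ x : {x : HalfLink L // G.node x ∈ A}, Fin (kA x.1.1 + 1))
    (mB : ∀ x : {x : HalfLink L // G.node x ∈ Aᶜ}, Fin (kB x.1.1 + 1)) (x : HalfLink L) : ℕ :=
  if hx : G.node x ∈ A then mA ⟨x, hx⟩ else mB ⟨x, Finset.mem_compl.2 hx⟩

/-- The function on `SU(2)^L` which the Peter-Weyl isomorphism `⨁ V_j ⊗ V_j^* ≃ L²(SU(2))`,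
`u ⊗ ξ ↦ (h ↦ (2 j + 1)^{1/2} ξ(h⁻¹ u))`, on every link, associates to `v ⊗ w`, where `v` and `w`
are tensors at the nodes in `A` and in the complement of `A`; note that
`D_{nm}(h⁻¹)` is the complex conjugate of `D_{mn}(h)`. -/
def spinNetworkFun (G : OrientedGraph N L) (A : Finset N) (α : BoundarySpins G A)
    (jA : InnerSpins G A) (jB : InnerSpins G Aᶜ)
    (v : RegionSpace G A (regionSpins G A A α jA))
    (w : RegionSpace G Aᶜ (regionSpins G A Aᶜ α jB)) (h : L → SU2) : ℂ :=
  ∑ mA, ∑ mB, v mA * w mB *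
    ∏ l, (Real.sqrt (allSpins G A α jA jB l + 1) : ℂ) *
      wignerD (allSpins G A α jA jB l) (allIndices G A mA mB (l, true))
        (allIndices G A mA mB (l, false)) (h l)⁻¹

/-- The unitary map `U` from the space of gauge invariant states to the direct sum of the
`H_{A, α} ⊗ H_{Ā, α}` is the one given by the Peter-Weyl theorem. -/
def IsPeterWeyl (G : OrientedGraph N L) (A : Finset N) (U : HInv G ≃ₗᵢ[ℂ] HSectors G A) : Prop :=
  ∀ (α : BoundarySpins G A) (jA : InnerSpins G A) (jB : InnerSpins G Aᶜ)
    (v : regionIntertwiners G A (regionSpins G A A α jA))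
    (w : regionIntertwiners G Aᶜ (regionSpins G A Aᶜ α jB)),
    ((U.symm (sectorTensor G A α (lp.single 2 jA v) (lp.single 2 jB w)) : HAux L) : (L → SU2) → ℂ)
      =ᵐ[haarPi L] spinNetworkFun G A α jA jB v.1 w.1

/-- The operator `X` on the direct sum of the `H_{A, α} ⊗ H_{Ā, α}` is of the form
`⨁_α (O_α ⊗ I)` with bounded operators `O_α` on `H_{A, α}`. -/
def IsBlockOperator (G : OrientedGraph N L) (A : Finset N)
    (X : HSectors G A →L[ℂ] HSectors G A) : Prop :=
  ∃ O : ∀ α : BoundarySpins G A, HRegion G A A α →L[ℂ] HRegion G A A α,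
    ∀ α v w, X (sectorTensor G A α v w) = sectorTensor G A α (O α v) w

/-- The operator `X` on the direct sum of the `H_{A, α} ⊗ H_{Ā, α}` acts as a scalar `c_α` on each
summand. -/
def IsSectorScalar (G : OrientedGraph N L) (A : Finset N)
    (X : HSectors G A →L[ℂ] HSectors G A) : Prop :=
  ∃ c : BoundarySpins G A → ℂ, ∀ ψ α, X ψ α = c α • ψ α

/-- The operator `U T U⁻¹`. -/
def conjBy (G : OrientedGraph N L) (A : Finset N) (U : HInv G ≃ₗᵢ[ℂ] HSectors G A)
    (T : HInv G →L[ℂ] HInv G) : HSectors G A →L[ℂ] HSectors G A :=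
  (U.toContinuousLinearEquiv : HInv G →L[ℂ] HSectors G A) ∘L T ∘L
    (U.symm.toContinuousLinearEquiv : HSectors G A →L[ℂ] HInv G)

end LQG

end

noncomputable section

namespace LQG

/-! ### Total families in Hilbert spaces -/

section Total

variable {H H' : Type*} [NormedAddCommGroup H] [InnerProductSpace ℂ H]
  [NormedAddCommGroup H'] [InnerProductSpace ℂ H']

/-! Everything rests on one orthonormal basis of `HAux L`. By Peter–Weyl, the spin network functions
`netVec k m`, with a spin on each link and a magnetic index at each half-link, are orthonormal
(Schur's relations, `integral_wignerD_mul_conj`) and total (Stone–Weierstrass, `isTotal_netVec`).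
Every half-link sits at a node of `A` or of its complement, so the labels split into two groups that
share only the spins `α` of the cut links. Hence `HAux L` is the direct sum over `α` of tensor
products `K_α ⊗ J_α`, with `K_α` carrying the labels of `A` and `J_α` those of the complement.

In this presentation the weakly closed algebra of holonomies and fluxes in `A` is exactly `⨁ B(K_α)
⊗ 1` (`mem_algHolFlux_iff`). One inclusion is locality: the generators of `A` commute with those of
the complement, and an operator commuting with the latter must be a block operator. Indeed,
averaging its matrix entries over all translations at the half-links of the complement shows that it
preserves the labels there and that its entries ignore the magnetic indices there
(`inner_netVec_eq_average`). Commutation with the holonomies shows that the entries ignore the spins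
inside the complement as well (`inner_netVec_eq_glue`). The other inclusion is von Neumann's
bicommutant theorem (`mem_closure_of_bicommutant`): by the same argument with the regions exchanged,
the commutant of the generators of `A` consists of operators `⨁ 1 ⊗ P_α`, and these commute with
every `⨁ O_α ⊗ 1`.

Gauge invariance acts node by node, so the invariant states are spanned by spin networks with
intertwiners at all nodes, and `HInv G` is the direct sum of the tensor products of subspaces of
`K_α` and `J_α` (`isTotal_spinNetworkVec_intertwiners`). Compressing `⨁ O_α ⊗ 1` to such a subspace
gives again a block operator, and every bounded block operator arises so
(`TensorDecomp.isBlock_iff_exists_compression`).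

The abstract algebra `⨁ B(K_α) ⊗ 1` has the scalars on the summands as centre and is of type I
because of rank-one projections. It is not a factor as soon as two summands are nonzero. Spin 0 on
all links and spin 1 on all links give two such summands: a tensor product of spin-1 representations
over the half-links of a node contains a nonzero invariant vector (`exists_intertwiner_two`). -/

/-- A family of vectors is total if only the zero vector is orthogonal to it. -/
def IsTotal {P : Type*} (a : P → H) : Prop := ∀ x, (∀ p, inner ℂ (a p) x = 0) → x = 0

theorem IsTotal.dense_span [CompleteSpace H] {P : Type*} {a : P → H} (ha : IsTotal a) :
    Dense (Submodule.span ℂ (Set.range a) : Set H) := by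
  rw [Submodule.dense_iff_topologicalClosure_eq_top, Submodule.topologicalClosure_eq_top_iff,
    Submodule.eq_bot_iff]
  intro x hx
  refine ha x fun p => ?_
  exact (Submodule.mem_orthogonal _ _).1 hx _ (Submodule.subset_span ⟨p, rfl⟩)

theorem isTotal_of_dense {P : Type*} {a : P → H}
    (ha : Dense (Submodule.span ℂ (Set.range a) : Set H)) : IsTotal a := by
  intro x hx
  have h : ∀ y ∈ Submodule.span ℂ (Set.range a), inner ℂ y x = 0 := by
    intro y hy
    induction hy using Submodule.span_induction with
    | mem y hy => obtain ⟨p, rfl⟩ := hy; exact hx p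
    | zero => simp
    | add y z _ _ hy hz => rw [inner_add_left, hy, hz, add_zero]
    | smul c y _ hy => rw [inner_smul_left, hy, mul_zero]
  have h2 : ∀ y, inner ℂ y x = 0 := fun y =>
    ha.induction (P := fun y => inner ℂ y x = 0) h (isClosed_eq (by fun_prop) (by fun_prop)) y
  exact inner_self_eq_zero.1 (h2 x)

theorem IsTotal.clm_ext [CompleteSpace H] {P : Type*} {a : P → H} (ha : IsTotal a)
    {S T : H →L[ℂ] H'} (h : ∀ p, S (a p) = T (a p)) : S = T := by
  refine ContinuousLinearMap.ext_on ha.dense_span ?_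
  rintro _ ⟨p, rfl⟩
  exact h p

theorem IsTotal.eq_of_inner {P : Type*} {a : P → H} (ha : IsTotal a) {x y : H}
    (h : ∀ p, inner ℂ (a p) x = inner ℂ (a p) y) : x = y :=
  sub_eq_zero.1 (ha _ fun p => by rw [inner_sub_right, h, sub_self])

theorem inner_linearCombination {P : Type*} (x : P → H) (c : P →₀ ℂ) :
    inner ℂ (Finsupp.linearCombination ℂ x c) (Finsupp.linearCombination ℂ x c) =
      c.sum fun p r => c.sum fun q s => conj r * (s * inner ℂ (x p) (x q)) := by
  simp only [Finsupp.linearCombination_apply, Finsupp.sum, sum_inner, inner_sum, inner_smul_left,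
    inner_smul_right, Finset.mul_sum]
  rw [Finset.sum_comm]
  refine Finset.sum_congr rfl fun p _ => Finset.sum_congr rfl fun q _ => ?_
  ring

/-- A relation between Gram matrices gives a bounded operator. -/
theorem IsTotal.exists_clm_of_gram [CompleteSpace H] [CompleteSpace H'] {H'' : Type*}
    [NormedAddCommGroup H''] [InnerProductSpace ℂ H''] {P : Type*} {x : P → H} (hx : IsTotal x)
    (y : P → H') (z : P → H'') (C : ℝ) (hC : 0 ≤ C)
    (h : ∀ p q, (C : ℂ) ^ 2 * inner ℂ (x p) (x q) = inner ℂ (y p) (y q) + inner ℂ (z p) (z q)) :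
    ∃ T : H →L[ℂ] H', (∀ p, T (x p) = y p) ∧ ∀ v, ‖T v‖ ≤ C * ‖v‖ := by
  have hd : DenseRange (Finsupp.linearCombination ℂ x) := by
    have := hx.dense_span
    rwa [← Finsupp.range_linearCombination, LinearMap.coe_range] at this
  -- The family `z` is slack: for every finite combination `C²‖∑ c x‖² = ‖∑ c y‖² + ‖∑ c z‖²`, which
  -- bounds the `y` term.
  have hn : ∀ c, ‖Finsupp.linearCombination ℂ y c‖ ≤ C * ‖Finsupp.linearCombination ℂ x c‖ := by
    intro c
    have key : (C : ℂ) ^ 2 * inner ℂ (Finsupp.linearCombination ℂ x c)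
        (Finsupp.linearCombination ℂ x c) =
        inner ℂ (Finsupp.linearCombination ℂ y c) (Finsupp.linearCombination ℂ y c) +
        inner ℂ (Finsupp.linearCombination ℂ z c) (Finsupp.linearCombination ℂ z c) := by
      simp only [inner_linearCombination, Finsupp.sum, Finset.mul_sum, ← Finset.sum_add_distrib]
      refine Finset.sum_congr rfl fun p _ => Finset.sum_congr rfl fun q _ => ?_
      linear_combination conj (c p) * c q * h p q
    simp only [inner_self_eq_norm_sq_to_K] at key
    have key' : C ^ 2 * ‖Finsupp.linearCombination ℂ x c‖ ^ 2 =
        ‖Finsupp.linearCombination ℂ y c‖ ^ 2 + ‖Finsupp.linearCombination ℂ z c‖ ^ 2 := by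
      simp only [Complex.coe_algebraMap] at key
      exact_mod_cast key
    refine le_of_sq_le_sq ?_ (by positivity)
    nlinarith [sq_nonneg ‖Finsupp.linearCombination ℂ z c‖]
  refine ⟨(Finsupp.linearCombination ℂ y).extendOfNorm (Finsupp.linearCombination ℂ x), ?_,
    LinearMap.norm_extendOfNorm_apply_le hd C hn⟩
  intro p
  have := LinearMap.extendOfNorm_eq hd ⟨C, hn⟩ (Finsupp.single p 1)
  simpa using this

/-- Two total families with the same Gram matrix are related by a unitary map. -/
theorem IsTotal.exists_unitary_of_gram [CompleteSpace H] [CompleteSpace H'] {P : Type*}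
    {x : P → H} (hx : IsTotal x) {y : P → H'} (hy : IsTotal y)
    (h : ∀ p q, inner ℂ (x p) (x q) = inner ℂ (y p) (y q)) :
    ∃ U : H ≃ₗᵢ[ℂ] H', ∀ p, U (x p) = y p := by
  -- Equal Gram matrices need no slack, so `C = 1` and `z = 0`. The two contractions are mutually
  -- inverse, hence isometric.
  obtain ⟨S, hS, hS'⟩ := hx.exists_clm_of_gram y (fun _ => (0 : H)) 1 zero_le_one
    (fun p q => by simp [h])
  obtain ⟨T, hT, hT'⟩ := hy.exists_clm_of_gram x (fun _ => (0 : H)) 1 zero_le_one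
    (fun p q => by simp [h])
  have hTS : T ∘L S = ContinuousLinearMap.id ℂ H := hx.clm_ext fun p => by simp [hS, hT]
  have hST : S ∘L T = ContinuousLinearMap.id ℂ H' := hy.clm_ext fun p => by simp [hS, hT]
  refine ⟨⟨LinearEquiv.ofLinearMap S.toLinearMap T.toLinearMap (LinearMap.ext fun v => ?_)
    (LinearMap.ext fun v => ?_), fun v => ?_⟩, fun p => hS p⟩
  · exact DFunLike.congr_fun hST v
  · exact DFunLike.congr_fun hTS v
  · refine le_antisymm ?_ ?_
    · simpa using hS' v
    · have h1 := hT' (S v)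
      rw [show T (S v) = v from DFunLike.congr_fun hTS v] at h1
      simpa using h1

end Total

/-! ### Direct sums of tensor products -/

/-- A presentation of the Hilbert space `H` as the direct sum of the tensor products of the Hilbert
spaces `K i` and `J i`. -/
structure TensorDecomp {ι : Type*} (K J : ι → Type*) [∀ i, NormedAddCommGroup (K i)]
    [∀ i, InnerProductSpace ℂ (K i)] [∀ i, NormedAddCommGroup (J i)]
    [∀ i, InnerProductSpace ℂ (J i)] (H : Type*) [NormedAddCommGroup H]
    [InnerProductSpace ℂ H] where
  /-- The pure tensors. -/
  tmul : ∀ i, K i →L[ℂ] J i →L[ℂ] H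
  inner_tmul_same : ∀ i v w v' w',
    inner ℂ (tmul i v w) (tmul i v' w') = inner ℂ v v' * inner ℂ w w'
  inner_tmul_ne : ∀ i i', i ≠ i' → ∀ v w v' w', inner ℂ (tmul i v w) (tmul i' v' w') = 0
  total : IsTotal fun p : Σ i, K i × J i => tmul p.1 p.2.1 p.2.2

namespace TensorDecomp

variable {ι : Type*} {K J : ι → Type*} [∀ i, NormedAddCommGroup (K i)]
    [∀ i, InnerProductSpace ℂ (K i)] [∀ i, NormedAddCommGroup (J i)]
    [∀ i, InnerProductSpace ℂ (J i)] {H H' : Type*} [NormedAddCommGroup H]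
    [InnerProductSpace ℂ H] [NormedAddCommGroup H'] [InnerProductSpace ℂ H']
    (τ : TensorDecomp K J H)

/-- The presentation with the two tensor factors exchanged. -/
def flip : TensorDecomp J K H where
  tmul i := (τ.tmul i).flip
  inner_tmul_same i v w v' w' := by simp [τ.inner_tmul_same, mul_comm]
  inner_tmul_ne i i' h v w v' w' := by simp [τ.inner_tmul_ne i i' h]
  total x hx := τ.total x fun p => hx ⟨p.1, p.2.2, p.2.1⟩

@[simp] theorem flip_tmul (i : ι) (v : K i) (w : J i) : τ.flip.tmul i w v = τ.tmul i v w := rfl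

/-- The transport of a presentation along a unitary map. -/
def map (U : H ≃ₗᵢ[ℂ] H') : TensorDecomp K J H' where
  tmul i := (ContinuousLinearMap.compL ℂ (J i) H H'
    (U.toContinuousLinearEquiv : H →L[ℂ] H')) ∘L τ.tmul i
  inner_tmul_same i v w v' w' := by simp [τ.inner_tmul_same]
  inner_tmul_ne i i' h v w v' w' := by simp [τ.inner_tmul_ne i i' h]
  total x hx := by
    have := τ.total (U.symm x) fun p => by
      have := hx p
      rw [← U.inner_map_map, U.apply_symm_apply]
      exact this
    simpa using this

@[simp] theorem map_tmul (U : H ≃ₗᵢ[ℂ] H') (i : ι) (v : K i) (w : J i) :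
    (τ.map U).tmul i v w = U (τ.tmul i v w) := rfl

theorem norm_tmul (i : ι) (v : K i) (w : J i) : ‖τ.tmul i v w‖ = ‖v‖ * ‖w‖ := by
  have h := τ.inner_tmul_same i v w v w
  simp only [inner_self_eq_norm_sq_to_K] at h
  have h' : ‖τ.tmul i v w‖ ^ 2 = (‖v‖ * ‖w‖) ^ 2 := by
    rw [mul_pow]
    exact_mod_cast h
  exact (pow_left_inj₀ (norm_nonneg _) (by positivity) two_ne_zero).1 h'

/-- The operator `T` is of the form `⨁ O_i ⊗ 1`. -/
def IsBlock (T : H →L[ℂ] H) : Prop :=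
  ∃ O : ∀ i, K i →L[ℂ] K i, ∀ i v w, T (τ.tmul i v w) = τ.tmul i (O i v) w

/-- The operator `C² - O_i* O_i` is positive, hence of the form `R_i* R_i`. The vectors `R_i v ⊗ w`
then serve as the slack family of `exists_clm_of_gram`, so that boundedness on the whole direct sum
comes from one Gram identity. -/
theorem exists_block [CompleteSpace H] [∀ i, CompleteSpace (K i)] (O : ∀ i, K i →L[ℂ] K i)
    (C : ℝ) (hO : ∀ i, ‖O i‖ ≤ C) (hC : 0 ≤ C) :
    ∃ T : H →L[ℂ] H, ∀ i v w, T (τ.tmul i v w) = τ.tmul i (O i v) w := by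
  have hR : ∀ i, ∃ R : K i →L[ℂ] K i, ∀ v v',
      (C : ℂ) ^ 2 * inner ℂ v v' = inner ℂ (O i v) (O i v') + inner ℂ (R v) (R v') := by
    intro i
    have h1 : star (O i) * O i ≤ algebraMap ℝ _ (C ^ 2) :=
      (CStarAlgebra.star_mul_le_algebraMap_norm_sq).trans
        (algebraMap_mono _ (pow_le_pow_left₀ (norm_nonneg _) (hO i) 2))
    obtain ⟨R, hR⟩ := CStarAlgebra.nonneg_iff_eq_star_mul_self.1 (sub_nonneg.2 h1)
    refine ⟨R, fun v v' => ?_⟩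
    have h2 : inner ℂ v ((algebraMap ℝ (K i →L[ℂ] K i) (C ^ 2) - star (O i) * O i) v') =
        inner ℂ v ((star R * R) v') := by rw [hR]
    simp only [sub_apply, mul_apply_eq_comp, inner_sub_right,
      ContinuousLinearMap.star_eq_adjoint, ContinuousLinearMap.adjoint_inner_right,
      Algebra.algebraMap_eq_smul_one, smul_apply,
      one_apply_eq_self] at h2
    rw [← h2, ← Complex.coe_smul, inner_smul_right]
    push_cast
    ring
  choose R hR using hR
  obtain ⟨T, hT, -⟩ := τ.total.exists_clm_of_gram (fun p => τ.tmul p.1 (O p.1 p.2.1) p.2.2)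
    (fun p => τ.tmul p.1 (R p.1 p.2.1) p.2.2) C hC (by
      rintro ⟨i, v, w⟩ ⟨i', v', w'⟩
      by_cases h : i = i'
      · subst h
        simp only [τ.inner_tmul_same]
        linear_combination inner ℂ w w' * hR i v v'
      · simp [τ.inner_tmul_ne i i' h])
  exact ⟨T, fun i v w => hT ⟨i, v, w⟩⟩

/-- The adjoint of `v ↦ v ⊗ u` is the slice map that contracts the second factor with `u`. Slices
recover `O_i` from `⨁ O_i ⊗ 1` and build the operators `1 ⊗ |w⟩⟨u|`. -/
theorem adjoint_flip_tmul [CompleteSpace H] [∀ i, CompleteSpace (K i)] (i : ι) (u : J i)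
    (v : K i) (w : J i) :
    ContinuousLinearMap.adjoint ((τ.tmul i).flip u) (τ.tmul i v w) = (inner ℂ u w : ℂ) • v := by
  refine ext_inner_left ℂ fun x => ?_
  rw [ContinuousLinearMap.adjoint_inner_right, ContinuousLinearMap.flip_apply, τ.inner_tmul_same,
    inner_smul_right, mul_comm]

theorem adjoint_flip_tmul_ne [CompleteSpace H] [∀ i, CompleteSpace (K i)] {i i' : ι}
    (h : i ≠ i') (u : J i) (v : K i') (w : J i') :
    ContinuousLinearMap.adjoint ((τ.tmul i).flip u) (τ.tmul i' v w) = 0 := by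
  refine ext_inner_left ℂ fun x => ?_
  rw [ContinuousLinearMap.adjoint_inner_right, ContinuousLinearMap.flip_apply,
    τ.inner_tmul_ne i i' h, inner_zero_right]

theorem commute_of_isBlock [CompleteSpace H] {S T : H →L[ℂ] H} (hS : τ.IsBlock S)
    (hT : τ.flip.IsBlock T) : S * T = T * S := by
  obtain ⟨O, hO⟩ := hS
  obtain ⟨P, hP⟩ := hT
  refine τ.total.clm_ext fun p => ?_
  have hP' : ∀ i v w, T (τ.tmul i v w) = τ.tmul i v (P i w) := fun i v w => hP i w v
  simp [hO, hP']

theorem IsBlock.star [CompleteSpace H] [∀ i, CompleteSpace (K i)] {T : H →L[ℂ] H}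
    (hT : τ.IsBlock T) : τ.IsBlock (star T) := by
  obtain ⟨O, hO⟩ := hT
  refine ⟨fun i => ContinuousLinearMap.adjoint (O i), fun i v w => ?_⟩
  refine τ.total.eq_of_inner fun p => ?_
  obtain ⟨i', v', w'⟩ := p
  rw [ContinuousLinearMap.star_eq_adjoint, ContinuousLinearMap.adjoint_inner_right, hO]
  by_cases h : i' = i
  · subst h
    simp [τ.inner_tmul_same, ContinuousLinearMap.adjoint_inner_right]
  · simp [τ.inner_tmul_ne _ _ h]

-- It suffices to commute with the operators `1 ⊗ |w⟩⟨u|` on single summands. Applying this to `v ⊗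
-- u` gives `⟨u, u⟩ T(v ⊗ w) = s ⊗ w`, where `s` is the slice of `T(v ⊗ u)` along `u`. So `O_i v` is
-- `s` divided by `⟨u, u⟩`; if `J i` is zero, any `O_i` will do.
open Classical in
theorem isBlock_of_commute [CompleteSpace H] [∀ i, CompleteSpace (K i)]
    {T : H →L[ℂ] H} (hT : ∀ S, τ.flip.IsBlock S → S * T = T * S) : τ.IsBlock T := by
  have hF : ∀ i (u w : J i), τ.flip.IsBlock
      ((τ.tmul i).flip w ∘L ContinuousLinearMap.adjoint ((τ.tmul i).flip u)) := by
    intro i u w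
    refine ⟨fun i' => if h : i = i' then
      h ▸ ((ContinuousLinearMap.toSpanSingleton ℂ w) ∘L innerSL ℂ u) else 0, fun i' w' v => ?_⟩
    by_cases h : i = i'
    · subst h
      simp [adjoint_flip_tmul]
    · simp [h, adjoint_flip_tmul_ne τ h]
  have hO : ∀ i, ∃ O : K i →L[ℂ] K i, ∀ v w, T (τ.tmul i v w) = τ.tmul i (O v) w := by
    intro i
    by_cases hJ : ∃ u : J i, u ≠ 0
    · obtain ⟨u, hu⟩ := hJ
      refine ⟨(inner ℂ u u : ℂ)⁻¹ • (ContinuousLinearMap.adjoint ((τ.tmul i).flip u) ∘L T ∘L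
        (τ.tmul i).flip u), fun v w => ?_⟩
      have h1 := DFunLike.congr_fun (hT _ (hF i u w)) (τ.tmul i v u)
      simp only [mul_apply_eq_comp, ContinuousLinearMap.comp_apply, adjoint_flip_tmul,
        map_smul, ContinuousLinearMap.flip_apply] at h1
      have hne : (inner ℂ u u : ℂ) ≠ 0 := inner_self_ne_zero.2 hu
      simp only [smul_apply, map_smul, ContinuousLinearMap.comp_apply,
        ContinuousLinearMap.flip_apply]
      rw [h1, smul_smul, inv_mul_cancel₀ hne, one_smul]
    · push Not at hJ
      exact ⟨0, fun v w => by simp [hJ w]⟩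
  choose O hO using hO
  exact ⟨O, hO⟩

theorem isBlock_iff_mem_centralizer [CompleteSpace H] [∀ i, CompleteSpace (K i)]
    {T : H →L[ℂ] H} : τ.IsBlock T ↔ T ∈ Set.centralizer {S | τ.flip.IsBlock S} :=
  ⟨fun h _ hS => (τ.commute_of_isBlock h hS).symm, fun h => τ.isBlock_of_commute fun S hS => h S hS⟩

/-- The von Neumann algebra `⨁ B(K_i) ⊗ 1`. -/
def vonNeumann [CompleteSpace H] [∀ i, CompleteSpace (K i)] [∀ i, CompleteSpace (J i)] :
    VonNeumannAlgebra H where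
  toStarSubalgebra := StarSubalgebra.centralizer ℂ {S | τ.flip.IsBlock S}
  centralizer_centralizer' := by
    have h : (StarSubalgebra.centralizer ℂ {S | τ.flip.IsBlock S}).carrier =
        Set.centralizer {S | τ.flip.IsBlock S} := by
      have h1 : star {S | τ.flip.IsBlock S} ⊆ {S | τ.flip.IsBlock S} := fun S hS => by
        have := IsBlock.star τ.flip (T := star S) hS
        simpa using this
      have h2 : (StarSubalgebra.centralizer ℂ {S | τ.flip.IsBlock S}).carrier =
        Set.centralizer ({S | τ.flip.IsBlock S} ∪ star {S | τ.flip.IsBlock S}) := rfl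
      rw [h2, Set.union_eq_self_of_subset_right h1]
    rw [h, Set.centralizer_centralizer_centralizer]

theorem mem_vonNeumann [CompleteSpace H] [∀ i, CompleteSpace (K i)] [∀ i, CompleteSpace (J i)]
    {T : H →L[ℂ] H} : T ∈ τ.vonNeumann ↔ τ.IsBlock T := by
  have h1 : star {S | τ.flip.IsBlock S} ⊆ {S | τ.flip.IsBlock S} := fun S hS => by
    have := IsBlock.star τ.flip (T := star S) hS
    simpa using this
  have h2 : T ∈ τ.vonNeumann ↔ T ∈
    Set.centralizer ({S | τ.flip.IsBlock S} ∪ star {S | τ.flip.IsBlock S}) := Iff.rfl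
  rw [h2, Set.union_eq_self_of_subset_right h1, isBlock_iff_mem_centralizer]

theorem mem_commutant_vonNeumann [CompleteSpace H] [∀ i, CompleteSpace (K i)]
    [∀ i, CompleteSpace (J i)] {T : H →L[ℂ] H} :
    T ∈ τ.vonNeumann.commutant ↔ τ.flip.IsBlock T := by
  rw [VonNeumannAlgebra.mem_commutant_iff]
  constructor
  · intro h
    exact τ.flip.isBlock_of_commute fun S hS => h S (τ.mem_vonNeumann.2 hS)
  · intro h S hS
    exact τ.commute_of_isBlock (τ.mem_vonNeumann.1 hS) h

/-- The elements of the centre of `⨁ B(K_i) ⊗ 1` act as scalars on the summands. -/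
theorem mem_centre_vonNeumann [CompleteSpace H] [∀ i, CompleteSpace (K i)]
    [∀ i, CompleteSpace (J i)] {T : H →L[ℂ] H} :
    T ∈ centre τ.vonNeumann ↔ ∃ c : ι → ℂ, ∀ i v w, T (τ.tmul i v w) = c i • τ.tmul i v w := by
  constructor
  · rintro ⟨h1, h2⟩
    obtain ⟨O, hO⟩ := τ.mem_vonNeumann.1 h1
    obtain ⟨P, hP⟩ := τ.mem_commutant_vonNeumann.1 h2
    have hc : ∀ i, ∃ c : ℂ, ∀ v w, T (τ.tmul i v w) = c • τ.tmul i v w := by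
      intro i
      by_cases hJ : ∃ u : J i, u ≠ 0
      swap
      · push Not at hJ
        exact ⟨0, fun v w => by simp [hJ w]⟩
      by_cases hK : ∃ x : K i, x ≠ 0
      swap
      · push Not at hK
        exact ⟨0, fun v w => by simp [hK v]⟩
      obtain ⟨u, hu⟩ := hJ
      obtain ⟨x, hx⟩ := hK
      have hu' : (inner ℂ u u : ℂ) ≠ 0 := inner_self_ne_zero.2 hu
      have hx' : (inner ℂ x x : ℂ) ≠ 0 := inner_self_ne_zero.2 hx
      have h3 : ∀ v w, τ.tmul i (O i v) w = τ.tmul i v (P i w) := fun v w => by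
        rw [← hO]; exact hP i w v
      -- Pairing `O x ⊗ w = x ⊗ P w` with `x ⊗ y` forces `P` to be the scalar `⟨x, O x⟩ / ⟨x, x⟩`.
      have h4 : ∀ w, P i w = ((inner ℂ x x : ℂ)⁻¹ * inner ℂ x (O i x)) • w := by
        intro w
        refine ext_inner_left ℂ fun y => ?_
        have := congrArg (inner ℂ (τ.tmul i x y)) (h3 x w)
        rw [τ.inner_tmul_same, τ.inner_tmul_same] at this
        rw [inner_smul_right, mul_assoc, this, ← mul_assoc, inv_mul_cancel₀ hx', one_mul]
      exact ⟨_, fun v w => by rw [hO, h3, h4, map_smul]⟩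
    choose c hc using hc
    exact ⟨c, hc⟩
  · rintro ⟨c, hc⟩
    have hbd : ∀ i, ∃ d : ℂ, ∀ v w, T (τ.tmul i v w) = d • τ.tmul i v w := fun i => ⟨c i, hc i⟩
    refine ⟨τ.mem_vonNeumann.2 ⟨fun i => c i • ContinuousLinearMap.id ℂ _, fun i v w => ?_⟩,
      τ.mem_commutant_vonNeumann.2 ⟨fun i => c i • ContinuousLinearMap.id ℂ _, fun i v w => ?_⟩⟩
    · simp [hc]
    · simp [hc]

/-- The algebra `⨁ B(K_i) ⊗ 1` is of type I. -/
theorem isTypeI_vonNeumann [CompleteSpace H] [∀ i, CompleteSpace (K i)]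
    [∀ i, CompleteSpace (J i)] : IsTypeI τ.vonNeumann := by
  classical
  intro z hz hzp hz0
  obtain ⟨c, hc⟩ := τ.mem_centre_vonNeumann.1 hz
  have hex : ∃ i, ∃ v : K i, ∃ w : J i, c i • τ.tmul i v w ≠ 0 := by
    by_contra! hcon
    exact hz0 (τ.total.clm_ext fun p => by simp [hc, hcon])
  obtain ⟨i, v, w, hne⟩ := hex
  have hci : c i ≠ 0 := fun h => hne (by simp [h])
  have hvw : τ.tmul i v w ≠ 0 := fun h => hne (by simp [h])
  have hv : v ≠ 0 := fun h => hvw (by simp [h])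
  have hw : w ≠ 0 := fun h => hvw (by simp [h])
  -- `z` is idempotent, so `c i` is a nonzero root of `c² = c`.
  have hc1 : c i = 1 := by
    have h1 := DFunLike.congr_fun hzp.isIdempotentElem.eq (τ.tmul i v w)
    simp only [mul_apply_eq_comp, hc, map_smul, smul_smul] at h1
    have h2 := smul_left_injective ℂ hvw h1
    exact mul_left_cancel₀ hci (by simpa using h2)
  set x : K i := ((‖v‖⁻¹ : ℝ) : ℂ) • v with hx
  have hxx : inner ℂ x x = (1 : ℂ) := by
    have : ‖x‖ = 1 := by
      rw [hx, norm_smul, Complex.norm_real, norm_inv, norm_norm, inv_mul_cancel₀]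
      exact norm_ne_zero_iff.2 hv
    rw [inner_self_eq_norm_sq_to_K, this]
    simp
  have hx0 : x ≠ 0 := fun h => by simp [h] at hxx
  -- The abelian projection is `|x⟩⟨x| ⊗ 1` on a summand where `z` acts as the identity, and zero
  -- elsewhere. It compresses `⨁ O ⊗ 1` to the multiple `⟨x, O x⟩` of itself.
  let P : ∀ i', K i' →L[ℂ] K i' := Function.update (fun _ => 0) i
    (ContinuousLinearMap.toSpanSingleton ℂ x ∘L innerSL ℂ x)
  have hPi : ∀ y, P i y = (inner ℂ x y : ℂ) • x := fun y => by simp [P]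
  have hPn : ∀ i', i' ≠ i → P i' = 0 := fun i' h => by simp [P, h]
  obtain ⟨p, hp⟩ := τ.exists_block P (‖P i‖) (fun i' => by
    by_cases h : i' = i
    · subst h; exact le_rfl
    · rw [hPn i' h]; simp) (norm_nonneg _)
  have hpM : p ∈ τ.vonNeumann := τ.mem_vonNeumann.2 ⟨P, hp⟩
  refine ⟨p, hpM, ⟨?_, ?_⟩, ?_, ?_, ?_⟩
  · refine τ.total.clm_ext fun q => ?_
    obtain ⟨i', v', w'⟩ := q
    by_cases h : i' = i
    · subst h
      simp only [mul_apply_eq_comp, hp, hPi, map_smul, smul_apply, smul_smul]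
      rw [hxx, mul_one]
    · simp [hp, hPn i' h]
  · refine τ.total.clm_ext fun q => τ.total.eq_of_inner fun r => ?_
    obtain ⟨i', v', w'⟩ := q
    obtain ⟨i'', v'', w''⟩ := r
    rw [ContinuousLinearMap.star_eq_adjoint, ContinuousLinearMap.adjoint_inner_right, hp, hp]
    by_cases h : i'' = i'
    · subst h
      by_cases h' : i'' = i
      · subst h'
        simp only [hPi, τ.inner_tmul_same, inner_smul_left, inner_smul_right, inner_conj_symm]
        ring
      · simp [hPn _ h']
    · simp [τ.inner_tmul_ne _ _ h]
  · intro h0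
    have h1 := hp i x w
    rw [h0, hPi, hxx, one_smul] at h1
    have h2 := τ.inner_tmul_same i x w x w
    rw [← h1] at h2
    rw [hxx] at h2
    exact hw (by simpa using h2.symm)
  · refine τ.total.clm_ext fun q => ?_
    obtain ⟨i', v', w'⟩ := q
    by_cases h : i' = i
    · subst h
      simp [hp, hc, hc1]
    · simp [hp, hPn i' h]
  · intro S hS T hT
    have key : ∀ R ∈ τ.vonNeumann, ∃ r : ℂ, p * R * p = r • p := by
      intro R hR
      obtain ⟨O, hO⟩ := τ.mem_vonNeumann.1 hR
      refine ⟨inner ℂ x (O i x), τ.total.clm_ext fun q => ?_⟩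
      obtain ⟨i', v', w'⟩ := q
      by_cases h : i' = i
      · subst h
        simp [hp, hO, hPi, smul_smul, mul_comm]
      · simp [hp, hPn i' h]
    obtain ⟨r, hr⟩ := key S hS
    obtain ⟨s, hs⟩ := key T hT
    rw [hr, hs]
    simp [smul_smul, mul_comm]

/-- If two summands are nonzero, then `⨁ B(K_i) ⊗ 1` is not a factor. -/
theorem not_isFactor_vonNeumann [CompleteSpace H] [∀ i, CompleteSpace (K i)]
    [∀ i, CompleteSpace (J i)] {i i' : ι} (hi : i ≠ i') {v : K i} {w : J i} {v' : K i'}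
    {w' : J i'} (hv : v ≠ 0) (hw : w ≠ 0) (hv' : v' ≠ 0) (hw' : w' ≠ 0) :
    ¬ IsFactor τ.vonNeumann := by
  classical
  intro hF
  -- The projection to the `i`-th summand is central, and a scalar cannot be `1` on one nonzero
  -- summand and `0` on another.
  obtain ⟨T, hT⟩ := τ.exists_block
    (fun l => if l = i then ContinuousLinearMap.id ℂ (K l) else 0) 1
    (fun l => by
      split_ifs
      · exact ContinuousLinearMap.norm_id_le
      · simp) zero_le_one
  have hTc : T ∈ centre τ.vonNeumann := by
    refine τ.mem_centre_vonNeumann.2 ⟨fun l => if l = i then 1 else 0, fun l v w => ?_⟩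
    rw [hT]
    by_cases h : l = i <;> simp [h]
  obtain ⟨c, hc⟩ := hF T hTc
  have h1 : τ.tmul i v w = c • τ.tmul i v w := by
    have := hT i v w
    rw [hc] at this
    simpa using this.symm
  have h2 : c • τ.tmul i' v' w' = 0 := by
    have := hT i' v' w'
    rw [hc] at this
    simpa [hi.symm] using this
  have hne : ∀ (l) (a : K l) (b : J l), a ≠ 0 → b ≠ 0 → τ.tmul l a b ≠ 0 := fun l a b ha hb => by
    rw [← norm_ne_zero_iff, τ.norm_tmul]
    exact mul_ne_zero (norm_ne_zero_iff.2 ha) (norm_ne_zero_iff.2 hb)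
  rcases smul_eq_zero.1 h2 with h | h
  · exact hne i v w hv hw (by rw [h1, h, zero_smul])
  · exact hne i' v' w' hv' hw' h

/-- A criterion in terms of matrix elements in total families. -/
theorem isBlock_of_entries [CompleteSpace H] [∀ i, CompleteSpace (K i)]
    [∀ i, CompleteSpace (J i)] {P Q : ι → Type*} (a : ∀ i, P i → K i) (ha : ∀ i, IsTotal (a i))
    (b : ∀ i, Q i → J i) (hb : ∀ i, IsTotal (b i)) (hb' : ∀ i, Orthonormal ℂ (b i))
    (hab : IsTotal fun p : Σ i, P i × Q i => τ.tmul p.1 (a p.1 p.2.1) (b p.1 p.2.2))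
    {T : H →L[ℂ] H}
    (h0 : ∀ i i' p p' q q', i ≠ i' →
      inner ℂ (τ.tmul i (a i p) (b i q)) (T (τ.tmul i' (a i' p') (b i' q'))) = 0)
    (h1 : ∀ i p p' q q', q ≠ q' →
      inner ℂ (τ.tmul i (a i p) (b i q)) (T (τ.tmul i (a i p') (b i q'))) = 0)
    (h2 : ∀ i p p' q q',
      inner ℂ (τ.tmul i (a i p) (b i q)) (T (τ.tmul i (a i p') (b i q))) =
      inner ℂ (τ.tmul i (a i p) (b i q')) (T (τ.tmul i (a i p') (b i q')))) :
    τ.IsBlock T := by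
  have hO : ∀ i, ∃ O : K i →L[ℂ] K i, ∀ v w, T (τ.tmul i v w) = τ.tmul i (O v) w := by
    intro i
    rcases isEmpty_or_nonempty (Q i) with hQ | ⟨⟨r⟩⟩
    · exact ⟨0, fun v w => by rw [hb i w fun q => (hQ.false q).elim]; simp⟩
    -- `O` is the slice of `T` at one fixed basis vector `b i r`. By `h2` any other basis vector
    -- gives the same entries, while `h0` and `h1` remove the remaining ones.
    · set O := ContinuousLinearMap.adjoint ((τ.tmul i).flip (b i r)) ∘L T ∘L
        (τ.tmul i).flip (b i r) with hO
      have hE : ∀ p q, T (τ.tmul i (a i p) (b i q)) = τ.tmul i (O (a i p)) (b i q) := by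
        intro p q
        refine hab.eq_of_inner fun s => ?_
        obtain ⟨i', p', q'⟩ := s
        by_cases h : i' = i
        · subst h
          rw [τ.inner_tmul_same, hO]
          simp only [ContinuousLinearMap.comp_apply, ContinuousLinearMap.adjoint_inner_right,
            ContinuousLinearMap.flip_apply]
          by_cases hq : q' = q
          · subst hq
            rw [h2 i' p' p q' r, inner_self_eq_norm_sq_to_K, (hb' i').1]
            simp
          · rw [h1 _ _ _ _ _ hq, (hb' i').2 hq, mul_zero]
        · rw [h0 _ _ _ _ _ _ h, τ.inner_tmul_ne _ _ h]
      refine ⟨O, fun v w => ?_⟩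
      have hv : ∀ q, T ∘L (τ.tmul i).flip (b i q) = (τ.tmul i).flip (b i q) ∘L O :=
        fun q => (ha i).clm_ext fun p => hE p q
      have hw : T ∘L τ.tmul i v = τ.tmul i (O v) :=
        (hb i).clm_ext fun q => DFunLike.congr_fun (hv q) v
      exact DFunLike.congr_fun hw w
  choose O hO using hO
  exact ⟨O, hO⟩

end TensorDecomp

end LQG

end

noncomputable section

namespace LQG

/-! ### The Hilbert space direct sum of Hilbert space tensor products -/

section Sectors

theorem isTotal_lp_single {ι : Type*} [DecidableEq ι] {E : ι → Type*}
    [∀ i, NormedAddCommGroup (E i)] [∀ i, InnerProductSpace ℂ (E i)] {P : ι → Type*}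
    {a : ∀ i, P i → E i} (ha : ∀ i, IsTotal (a i)) :
    IsTotal fun p : Σ i, P i => (lp.single 2 p.1 (a p.1 p.2) : lp E 2) := by
  intro x hx
  ext1
  funext i
  refine ha i _ fun p => ?_
  rw [← lp.inner_single_left]
  exact hx ⟨i, p⟩

theorem inner_pureTensor {E F : Type*} [NormedAddCommGroup E] [InnerProductSpace ℂ E]
    [NormedAddCommGroup F] [InnerProductSpace ℂ F] (v v' : E) (w w' : F) :
    inner ℂ (pureTensor v w) (pureTensor v' w') = inner ℂ v v' * inner ℂ w w' := by
  rw [pureTensor, pureTensor, UniformSpace.Completion.inner_coe, TensorProduct.inner_tmul]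

theorem isTotal_pureTensor {E F : Type*} [NormedAddCommGroup E] [InnerProductSpace ℂ E]
    [NormedAddCommGroup F] [InnerProductSpace ℂ F] :
    IsTotal fun p : E × F => pureTensor p.1 p.2 := by
  intro x hx
  have h1 : ∀ t : E ⊗[ℂ] F, inner ℂ (t : HilbertTensor E F) x = 0 := by
    intro t
    induction t using TensorProduct.induction_on with
    | zero => rw [UniformSpace.Completion.coe_zero, inner_zero_left]
    | tmul v w => exact hx (v, w)
    | add s t hs ht => rw [UniformSpace.Completion.coe_add, inner_add_left, hs, ht, add_zero]
  have h2 : ∀ y : HilbertTensor E F, inner ℂ y x = 0 := fun y =>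
    UniformSpace.Completion.induction_on y (isClosed_eq (by fun_prop) (by fun_prop)) h1
  exact inner_self_eq_zero.1 (h2 x)

variable {ι : Type*} [DecidableEq ι] (K J : ι → Type*) [∀ i, NormedAddCommGroup (K i)]
    [∀ i, InnerProductSpace ℂ (K i)] [∀ i, NormedAddCommGroup (J i)]
    [∀ i, InnerProductSpace ℂ (J i)]

/-- The pure tensors in the Hilbert space direct sum of tensor products. -/
def sectorTmul (i : ι) :
    K i →L[ℂ] J i →L[ℂ] lp (fun i => HilbertTensor (K i) (J i)) 2 :=
  LinearMap.mkContinuous₂ (LinearMap.mk₂ ℂ (fun v w => lp.single 2 i (pureTensor v w))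
    (fun v v' w => by
      rw [pureTensor, TensorProduct.add_tmul, UniformSpace.Completion.coe_add, lp.single_add]; rfl)
    (fun c v w => by
      rw [pureTensor, ← TensorProduct.smul_tmul', UniformSpace.Completion.coe_smul,
        lp.single_smul]; rfl)
    (fun v w w' => by
      rw [pureTensor, TensorProduct.tmul_add, UniformSpace.Completion.coe_add, lp.single_add]; rfl)
    (fun c v w => by
      rw [pureTensor, TensorProduct.tmul_smul, UniformSpace.Completion.coe_smul,
        lp.single_smul]; rfl)) 1 fun v w => by
    rw [LinearMap.mk₂_apply, lp.norm_single (by norm_num), pureTensor,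
      UniformSpace.Completion.norm_coe, TensorProduct.norm_tmul, one_mul]

theorem sectorTmul_apply (i : ι) (v : K i) (w : J i) :
    sectorTmul K J i v w = lp.single 2 i (pureTensor v w) := rfl

/-- The Hilbert space direct sum of the tensor products of the Hilbert spaces `K i` and `J i`. -/
def sectorDecomp : TensorDecomp K J (lp (fun i => HilbertTensor (K i) (J i)) 2) where
  tmul := sectorTmul K J
  inner_tmul_same i v w v' w' := by
    rw [sectorTmul_apply, sectorTmul_apply, lp.inner_single_left, lp.single_apply_self, inner_pureTensor]
  inner_tmul_ne i i' h v w v' w' := by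
    rw [sectorTmul_apply, sectorTmul_apply, lp.inner_single_left, lp.single_apply_ne _ _ _ h, inner_zero_right]
  total := by
    have h := isTotal_lp_single (E := fun i => HilbertTensor (K i) (J i))
      (P := fun i => K i × J i) (a := fun _ p => pureTensor p.1 p.2) fun _ => isTotal_pureTensor
    exact fun x hx => h x hx

theorem sectorDecomp_tmul (i : ι) (v : K i) (w : J i) :
    (sectorDecomp K J).tmul i v w = lp.single 2 i (pureTensor v w) := rfl

end Sectors

/-- If `a` and `b` are total, then so are the pure tensors of their members. -/
theorem TensorDecomp.isTotal_tmul {ι : Type*} {K J : ι → Type*} [∀ i, NormedAddCommGroup (K i)]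
    [∀ i, InnerProductSpace ℂ (K i)] [∀ i, NormedAddCommGroup (J i)]
    [∀ i, InnerProductSpace ℂ (J i)] [∀ i, CompleteSpace (K i)] [∀ i, CompleteSpace (J i)]
    {H : Type*} [NormedAddCommGroup H]
    [InnerProductSpace ℂ H] (τ : TensorDecomp K J H) {A B : ι → Type*} {a : ∀ i, A i → K i}
    (ha : ∀ i, IsTotal (a i)) {b : ∀ i, B i → J i} (hb : ∀ i, IsTotal (b i)) :
    IsTotal fun p : Σ i, A i × B i => τ.tmul p.1 (a p.1 p.2.1) (b p.1 p.2.2) := by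
  intro x hx
  refine τ.total x fun ⟨i, v, w⟩ => ?_
  have h1 : ∀ p, innerSL ℂ x ∘L τ.tmul i (a i p) = 0 := fun p => (hb i).clm_ext fun q => by
    simpa using inner_eq_zero_symm.1 (hx ⟨i, p, q⟩)
  have h2 : innerSL ℂ x ∘L (τ.tmul i).flip w = 0 := (ha i).clm_ext fun p =>
    DFunLike.congr_fun (h1 p) w
  exact inner_eq_zero_symm.1 (DFunLike.congr_fun h2 v)

/-! ### Unitary maps onto sums of tensor products from a Gram matrix -/

section Assembly

variable {ι : Type*} [DecidableEq ι] {P Q : ι → Type*} [∀ i, DecidableEq (P i)]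
  [∀ i, DecidableEq (Q i)] {E : ∀ i, P i → Type*} {F : ∀ i, Q i → Type*}
  [∀ i p, NormedAddCommGroup (E i p)] [∀ i p, InnerProductSpace ℂ (E i p)]
  [∀ i q, NormedAddCommGroup (F i q)] [∀ i q, InnerProductSpace ℂ (F i q)]

/-- A total family of bilinear maps with the Gram matrix of pure tensors gives a unitary map to the
direct sum of tensor products of direct sums. -/
theorem exists_unitary_sectors {H : Type*} [NormedAddCommGroup H] [InnerProductSpace ℂ H]
    [CompleteSpace H] [∀ i p, CompleteSpace (E i p)] [∀ i q, CompleteSpace (F i q)]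
    (y : ∀ i p q, E i p → F i q → H)
    (h_same : ∀ i p q v w v' w', inner ℂ (y i p q v w) (y i p q v' w') =
      inner ℂ v v' * inner ℂ w w')
    (h_ne : ∀ i p q i' p' q' v w v' w',
      (⟨i, p, q⟩ : Σ i, P i × Q i) ≠ ⟨i', p', q'⟩ →
      inner ℂ (y i p q v w) (y i' p' q' v' w') = 0)
    (h_total : IsTotal fun s : Σ t : (Σ i, P i × Q i), E t.1 t.2.1 × F t.1 t.2.2 =>
      y s.1.1 s.1.2.1 s.1.2.2 s.2.1 s.2.2) :
    ∃ U : H ≃ₗᵢ[ℂ] lp (fun i => HilbertTensor (lp (E i) 2) (lp (F i) 2)) 2,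
      ∀ i p q v w, U (y i p q v w) =
        lp.single 2 i (pureTensor (lp.single 2 p v) (lp.single 2 q w)) := by
  set σ := sectorDecomp (fun i => lp (E i) 2) (fun i => lp (F i) 2) with hσ
  have htot : IsTotal fun s : Σ t : (Σ i, P i × Q i), E t.1 t.2.1 × F t.1 t.2.2 =>
      σ.tmul s.1.1 (lp.single 2 s.1.2.1 s.2.1) (lp.single 2 s.1.2.2 s.2.2) := by
    have h1 : ∀ i, IsTotal fun p : Σ p, E i p => (lp.single 2 p.1 p.2 : lp (E i) 2) := fun i =>
      isTotal_lp_single (a := fun p (v : E i p) => v) fun p x hx => inner_self_eq_zero.1 (hx x)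
    have h2 : ∀ i, IsTotal fun q : Σ q, F i q => (lp.single 2 q.1 q.2 : lp (F i) 2) := fun i =>
      isTotal_lp_single (a := fun p (v : F i p) => v) fun p x hx => inner_self_eq_zero.1 (hx x)
    intro x hx
    refine σ.isTotal_tmul h1 h2 x fun ⟨i, ⟨p, v⟩, ⟨q, w⟩⟩ => hx ⟨⟨i, p, q⟩, v, w⟩
  obtain ⟨U, hU⟩ := h_total.exists_unitary_of_gram htot (by
    rintro ⟨⟨i, p, q⟩, v, w⟩ ⟨⟨i', p', q'⟩, v', w'⟩
    dsimp only
    by_cases h : i = i'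
    · subst h
      rw [σ.inner_tmul_same, lp.inner_single_left, lp.inner_single_left]
      by_cases hp : p = p'
      · subst hp
        by_cases hq : q = q'
        · subst hq
          rw [h_same, lp.single_apply_self, lp.single_apply_self]
        · rw [lp.single_apply_ne _ _ _ hq, inner_zero_right, mul_zero]
          exact h_ne _ _ _ _ _ _ _ _ _ _ (by simpa using hq)
      · rw [lp.single_apply_ne _ _ _ hp, inner_zero_right, zero_mul]
        exact h_ne _ _ _ _ _ _ _ _ _ _ (by simp [hp])
    · rw [σ.inner_tmul_ne _ _ h]
      exact h_ne _ _ _ _ _ _ _ _ _ _ fun h' => h (Sigma.mk.inj_iff.1 h').1)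
  exact ⟨U, fun i p q v w => hU ⟨⟨i, p, q⟩, v, w⟩⟩

end Assembly

/-! ### The bicommutant theorem -/

section Bicommutant

variable {H : Type*} [NormedAddCommGroup H] [InnerProductSpace ℂ H]

/-- The operator `T ⊕ ⋯ ⊕ T`. -/
def amplify (ι : Type*) [Fintype ι] (T : H →L[ℂ] H) :
    PiLp 2 (fun _ : ι => H) →L[ℂ] PiLp 2 (fun _ : ι => H) :=
  ((PiLp.continuousLinearEquiv 2 ℂ (fun _ : ι => H)).symm : (ι → H) →L[ℂ] _) ∘L
    (ContinuousLinearMap.pi fun i => T ∘L ContinuousLinearMap.proj i) ∘L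
    ((PiLp.continuousLinearEquiv 2 ℂ (fun _ : ι => H)) : _ →L[ℂ] (ι → H))

@[simp] theorem amplify_apply {ι : Type*} [Fintype ι] (T : H →L[ℂ] H)
    (v : PiLp 2 (fun _ : ι => H)) (i : ι) : amplify ι T v i = T (v i) := rfl

/-- An operator which commutes with a `*`-algebra commutes with its closure in the weak operator
topology. -/
theorem commute_of_mem_closure {A : Set (H →L[ℂ] H)} {S T : H →L[ℂ] H}
    (hS : ∀ a ∈ A, a * S = S * a)
    (hT : ContinuousLinearMapWOT.ofCLM T ∈ closure ((ContinuousLinearMapWOT.ofCLM :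
      (H →L[ℂ] H) → (H →WOT[ℂ] H)) '' A)) : T * S = S * T := by
  -- Multiplication by a fixed operator on either side is continuous in the weak operator topology,
  -- so a commutant is weakly closed.
  have h : IsClosed {B : H →WOT[ℂ] H | B * ContinuousLinearMapWOT.ofCLM S =
      ContinuousLinearMapWOT.ofCLM S * B} := by
    refine isClosed_eq ?_ ?_
    · exact continuous_mul_const _
    · exact continuous_const_mul _
  have h2 := closure_minimal (t := {B : H →WOT[ℂ] H | B * ContinuousLinearMapWOT.ofCLM S =
      ContinuousLinearMapWOT.ofCLM S * B}) ?_ h hT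
  · exact congrArg ContinuousLinearMapWOT.toCLM h2
  · rintro _ ⟨a, ha, rfl⟩
    exact congrArg ContinuousLinearMapWOT.ofCLM (hS a ha)

variable [CompleteSpace H]

theorem inner_amplify_left {ι : Type*} [Fintype ι] (T : H →L[ℂ] H)
    (v w : PiLp 2 (fun _ : ι => H)) :
    inner ℂ (amplify ι T v) w = inner ℂ v (amplify ι (star T) w) := by
  simp [PiLp.inner_apply, ContinuousLinearMap.star_eq_adjoint,
    ContinuousLinearMap.adjoint_inner_right]

/-- An operator in the bicommutant of a unital `*`-algebra can be approximated on finitely many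
vectors. -/
theorem exists_norm_sub_lt_of_bicommutant (A : StarSubalgebra ℂ (H →L[ℂ] H)) {T : H →L[ℂ] H}
    (hT : ∀ S, (∀ a ∈ A, a * S = S * a) → T * S = S * T) {ι : Type*} [Fintype ι] (x : ι → H)
    {ε : ℝ} (hε : 0 < ε) : ∃ a ∈ A, ∀ i, ‖a (x i) - T (x i)‖ < ε := by
  classical
  let X : PiLp 2 (fun _ : ι => H) := WithLp.toLp 2 x
  -- `K₀` is the orbit of `X = (x_i)` under the amplified algebra. The aim is to show that `(T x_i)`
  -- lies in its closure `K`, which holds once the projection to `K` commutes with the amplification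
  -- of `T`.
  let K₀ : Submodule ℂ (PiLp 2 (fun _ : ι => H)) :=
    { carrier := {v : PiLp 2 (fun _ : ι => H) | ∃ a ∈ A, v = amplify ι a X}
      add_mem' := by
        rintro _ _ ⟨a, ha, rfl⟩ ⟨b, hb, rfl⟩
        exact ⟨a + b, add_mem ha hb, by ext i; simp⟩
      zero_mem' := ⟨0, zero_mem _, by ext i; simp⟩
      smul_mem' := by
        rintro c _ ⟨a, ha, rfl⟩
        exact ⟨c • a, A.smul_mem ha c, by ext i; simp⟩ }
  let K := K₀.topologicalClosure
  have : CompleteSpace K := K₀.isClosed_topologicalClosure.completeSpace_coe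
  have hinv : ∀ a ∈ A, ∀ v ∈ K, amplify ι a v ∈ K := by
    intro a ha v hv
    refine map_mem_closure (amplify ι a).continuous hv ?_
    rintro _ ⟨b, hb, rfl⟩
    exact ⟨a * b, mul_mem ha hb, by ext i; simp⟩
  have hcomm : ∀ a ∈ A, ∀ v, K.starProjection (amplify ι a v) = amplify ι a (K.starProjection v) := by
    intro a ha v
    refine Submodule.eq_starProjection_of_mem_of_inner_eq_zero
      (hinv a ha _ (K.starProjection_apply_mem v)) fun w hw => ?_
    rw [← map_sub, inner_amplify_left]
    exact K.starProjection_inner_eq_zero v _ (hinv _ (star_mem ha) w hw)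
  let sgl : ι → H →L[ℂ] PiLp 2 (fun _ : ι => H) := fun j =>
    ((PiLp.continuousLinearEquiv 2 ℂ (fun _ : ι => H)).symm : (ι → H) →L[ℂ] _) ∘L
      ContinuousLinearMap.single ℂ (fun _ : ι => H) j
  have hsgl : ∀ (B : H →L[ℂ] H) j v, amplify ι B (sgl j v) = sgl j (B v) := by
    intro B j v
    ext i
    by_cases h : i = j
    · subst h; simp [sgl]
    · simp [sgl, h]
  have hsum : ∀ v : PiLp 2 (fun _ : ι => H), v = ∑ j, sgl j (v j) := by
    intro v
    ext i
    simp [sgl, Finset.sum_apply, Pi.single_apply]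
  -- The projection to `K` commutes with the amplified algebra, so each of its matrix entries `p i
  -- j` lies in the commutant of `A`, and therefore commutes with `T`.
  let p : ι → ι → H →L[ℂ] H := fun i j => PiLp.proj 2 (fun _ : ι => H) i ∘L K.starProjection ∘L sgl j
  have hp : ∀ i j, ∀ a ∈ A, a * p i j = p i j * a := by
    intro i j a ha
    ext v
    have := congrArg (fun z : PiLp 2 (fun _ : ι => H) => z i) (hcomm a ha (sgl j v))
    rw [hsgl] at this
    exact this.symm
  have hTK : ∀ v, K.starProjection (amplify ι T v) = amplify ι T (K.starProjection v) := by
    intro v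
    have h1 : ∀ j, K.starProjection (sgl j (T (v j))) =
        amplify ι T (K.starProjection (sgl j (v j))) := by
      intro j
      ext i
      exact (DFunLike.congr_fun (hT _ (hp i j)) (v j)).symm
    conv_lhs => rw [hsum v]
    conv_rhs => rw [hsum v]
    simp only [map_sum, hsgl, h1]
  have hXK : X ∈ K := K₀.le_topologicalClosure ⟨1, one_mem _, by ext i; simp⟩
  have hTX : amplify ι T X ∈ K := by
    rw [← Submodule.starProjection_eq_self_iff, hTK, Submodule.starProjection_eq_self_iff.2 hXK]
  obtain ⟨_, ⟨a, ha, rfl⟩, hlt⟩ := Metric.mem_closure_iff.1 hTX ε hε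
  refine ⟨a, ha, fun i => ?_⟩
  rw [dist_eq_norm, norm_sub_rev] at hlt
  exact (PiLp.norm_apply_le (amplify ι a X - amplify ι T X) i).trans_lt hlt

/-- The bicommutant theorem: an operator in the bicommutant of a unital `*`-algebra is in its
closure in the weak operator topology. -/
theorem mem_closure_of_bicommutant (A : StarSubalgebra ℂ (H →L[ℂ] H)) {T : H →L[ℂ] H}
    (hT : ∀ S, (∀ a ∈ A, a * S = S * a) → T * S = S * T) :
    ContinuousLinearMapWOT.ofCLM T ∈ closure ((ContinuousLinearMapWOT.ofCLM :
      (H →L[ℂ] H) → (H →WOT[ℂ] H)) '' (A : Set (H →L[ℂ] H))) := by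
  rw [mem_closure_iff_nhds]
  intro U hU
  obtain ⟨s, r, hr, hsU⟩ := (ContinuousLinearMapWOT.withSeminorms.mem_nhds_iff _ _).1 hU
  -- The summand `1` keeps the denominator of `ε = r / (∑ ‖z.2‖ + 1)` positive when all the
  -- functionals vanish or `s` is empty.
  have hc : 0 < ∑ z ∈ s, ‖z.2‖ + 1 := by positivity
  obtain ⟨a, ha, hlt⟩ := exists_norm_sub_lt_of_bicommutant A hT (fun z : s => z.1.1)
    (div_pos hr hc)
  refine ⟨ContinuousLinearMapWOT.ofCLM a, hsU ?_, ⟨a, ha, rfl⟩⟩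
  rw [Seminorm.mem_ball]
  refine Seminorm.finset_sup_apply_lt hr fun z hz => ?_
  have h1 := hlt ⟨z, hz⟩
  change ‖z.2 (a z.1 - T z.1)‖ < r
  have h2 : ‖z.2‖ ≤ ∑ z ∈ s, ‖z.2‖ :=
    Finset.single_le_sum (f := fun z : H × (StrongDual ℂ H) => ‖z.2‖) (fun _ _ => norm_nonneg _) hz
  have h3 : ‖a z.1 - T z.1‖ * (∑ z ∈ s, ‖z.2‖ + 1) < r := (lt_div_iff₀ hc).1 h1
  calc ‖z.2 (a z.1 - T z.1)‖ ≤ ‖z.2‖ * ‖a z.1 - T z.1‖ := z.2.le_opNorm _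
    _ ≤ (∑ z ∈ s, ‖z.2‖ + 1) * ‖a z.1 - T z.1‖ := by gcongr; linarith
    _ < r := by rwa [mul_comm]

end Bicommutant

end LQG

end

noncomputable section

namespace LQG

/-! ### The irreducible representations of `SU(2)` -/

section Wigner

open Polynomial

/-- The image of the `n`-th monomial of degree `k` under the action of a matrix. -/
def matPoly (k n : ℕ) (M : Matrix (Fin 2) (Fin 2) ℂ) : ℂ[X] :=
  (C (M 0 0) + C (M 1 0) * X) ^ (k - n) * (C (M 0 1) + C (M 1 1) * X) ^ n

theorem wignerD_eq (k m n : ℕ) (g : SU2) :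
    wignerD k m n g = (Real.sqrt ((k.choose n : ℝ) / (k.choose m : ℝ)) : ℂ) *
      (matPoly k n g.1).coeff m := rfl

theorem natDegree_linear_pow_le (a c : ℂ) (N : ℕ) : ((C a + C c * X) ^ N).natDegree ≤ N := by
  refine natDegree_pow_le.trans ?_
  have h : (C a + C c * X).natDegree ≤ 1 := by compute_degree
  nlinarith

theorem coeff_linear_pow (a c : ℂ) (N i : ℕ) :
    ((C a + C c * X) ^ N).coeff i = (N.choose i : ℂ) * (a ^ (N - i) * c ^ i) := by
  rw [add_comm, add_pow, finsetSum_coeff]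
  have h : ∀ j, ((C c * X) ^ j * C a ^ (N - j) * (N.choose j : ℂ[X])).coeff i =
      if j = i then (N.choose j : ℂ) * (a ^ (N - j) * c ^ j) else 0 := by
    intro j
    rw [mul_pow, ← C_pow, ← C_pow, ← C_eq_natCast, show C (c ^ j) * X ^ j * C (a ^ (N - j)) *
      C (N.choose j : ℂ) = C ((N.choose j : ℂ) * (a ^ (N - j) * c ^ j)) * X ^ j by
        simp only [C_mul]; ring, coeff_C_mul, coeff_X_pow]
    by_cases h : i = j
    · simp [h]
    · simp [h, Ne.symm h]
  simp only [h]
  rw [Finset.sum_ite_eq']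
  split_ifs with hi
  · rfl
  · rw [Nat.choose_eq_zero_of_lt (by simpa using hi)]
    simp

theorem natDegree_matPoly_le {k n : ℕ} (hn : n ≤ k) (M : Matrix (Fin 2) (Fin 2) ℂ) :
    (matPoly k n M).natDegree ≤ k := by
  refine natDegree_mul_le.trans ?_
  have h1 := natDegree_linear_pow_le (M 0 0) (M 1 0) (k - n)
  have h2 := natDegree_linear_pow_le (M 0 1) (M 1 1) n
  omega

/-- The homogenization of degree `k` of a polynomial. -/
def homogenize (k : ℕ) (u v p : ℂ[X]) : ℂ[X] :=
  ∑ m ∈ Finset.range (k + 1), C (p.coeff m) * (u ^ (k - m) * v ^ m)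

theorem homogenize_linear_mul (k : ℕ) (u v p : ℂ[X]) (hp : p.natDegree ≤ k) (a c : ℂ) :
    homogenize (k + 1) u v ((C a + C c * X) * p) = (C a * u + C c * v) * homogenize k u v p := by
  have h0 : p.coeff (k + 1) = 0 := coeff_eq_zero_of_natDegree_lt (by omega)
  have h1 : ∑ m ∈ Finset.range (k + 1 + 1), C (a * p.coeff m) * (u ^ (k + 1 - m) * v ^ m) =
      C a * u * homogenize k u v p := by
    rw [Finset.sum_range_succ, h0, mul_zero, C_0, zero_mul, add_zero, homogenize, Finset.mul_sum]
    refine Finset.sum_congr rfl fun m hm => ?_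
    have hm' : m ≤ k := by simpa [Nat.lt_succ_iff] using hm
    rw [Nat.sub_add_comm hm', pow_succ, C_mul]
    ring
  have h2 : ∑ m ∈ Finset.range (k + 1 + 1),
      C (c * (X * p).coeff m) * (u ^ (k + 1 - m) * v ^ m) = C c * v * homogenize k u v p := by
    rw [Finset.sum_range_succ', coeff_X_mul_zero, mul_zero, C_0, zero_mul, add_zero, homogenize,
      Finset.mul_sum]
    refine Finset.sum_congr rfl fun m hm => ?_
    rw [coeff_X_mul, Nat.add_sub_add_right, pow_succ, C_mul]
    ring
  rw [add_mul (C a * u), ← h1, ← h2, homogenize, ← Finset.sum_add_distrib]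
  refine Finset.sum_congr rfl fun m _ => ?_
  rw [add_mul, coeff_add, coeff_C_mul, mul_assoc, coeff_C_mul, C_add, add_mul]

theorem homogenize_linear_pow_mul (k j : ℕ) (u v p : ℂ[X]) (hp : p.natDegree ≤ k) (a c : ℂ) :
    homogenize (k + j) u v ((C a + C c * X) ^ j * p) =
      (C a * u + C c * v) ^ j * homogenize k u v p := by
  induction j with
  | zero => simp
  | succ j ih =>
    have h : ((C a + C c * X) ^ j * p).natDegree ≤ k + j := by
      refine natDegree_mul_le.trans ?_
      have := natDegree_linear_pow_le a c j
      omega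
    rw [pow_succ', mul_assoc, ← add_assoc, homogenize_linear_mul _ _ _ _ h, ih, pow_succ', mul_assoc]

theorem homogenize_matPoly {k n : ℕ} (hn : n ≤ k) (u v : ℂ[X]) (M : Matrix (Fin 2) (Fin 2) ℂ) :
    homogenize k u v (matPoly k n M) =
      (C (M 0 0) * u + C (M 1 0) * v) ^ (k - n) * (C (M 0 1) * u + C (M 1 1) * v) ^ n := by
  have h1 := homogenize_linear_pow_mul 0 n u v 1 (by simp) (M 0 1) (M 1 1)
  have h2 := homogenize_linear_pow_mul n (k - n) u v _
    (natDegree_linear_pow_le (M 0 1) (M 1 1) n) (M 0 0) (M 1 0)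
  rw [Nat.add_sub_cancel' hn] at h2
  rw [matPoly, h2]
  congr 1
  rw [mul_one, zero_add] at h1
  rw [h1]
  simp [homogenize]

/-- The action of `M' * M` is that of `M` with the two variables replaced by the linear forms in the
columns of `M'`. Homogenization is exactly this substitution, and it is linear in the coefficients.
-/
theorem coeff_matPoly_mul {k n : ℕ} (hn : n ≤ k) (p : ℕ) (M' M : Matrix (Fin 2) (Fin 2) ℂ) :
    (matPoly k n (M' * M)).coeff p =
      ∑ m ∈ Finset.range (k + 1), (matPoly k m M').coeff p * (matPoly k n M).coeff m := by
  have h := homogenize_matPoly hn (C (M' 0 0) + C (M' 1 0) * X) (C (M' 0 1) + C (M' 1 1) * X) M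
  have h' : matPoly k n (M' * M) =
      homogenize k (C (M' 0 0) + C (M' 1 0) * X) (C (M' 0 1) + C (M' 1 1) * X) (matPoly k n M) := by
    rw [h, matPoly]
    congr 2 <;> simp only [Matrix.mul_apply, Fin.sum_univ_two, C_add, C_mul] <;> ring
  rw [h', homogenize, finsetSum_coeff]
  refine Finset.sum_congr rfl fun m _ => ?_
  rw [coeff_C_mul, mul_comm]
  rfl

theorem choose_cast_pos {k n : ℕ} (hn : n ≤ k) : (0 : ℝ) < k.choose n := by
  exact_mod_cast Nat.choose_pos hn

theorem wignerD_mul {k m n : ℕ} (hm : m ≤ k) (hn : n ≤ k) (g h : SU2) :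
    wignerD k m n (g * h) = ∑ p : Fin (k + 1), wignerD k m p g * wignerD k p n h := by
  rw [Fin.sum_univ_eq_sum_range (fun p => wignerD k m p g * wignerD k p n h), wignerD_eq,
    Submonoid.coe_mul, coeff_matPoly_mul hn, Finset.mul_sum]
  refine Finset.sum_congr rfl fun p hp => ?_
  have hp' : p ≤ k := by simpa [Nat.lt_succ_iff] using hp
  have h1 : Real.sqrt ((k.choose n : ℝ) / k.choose m) =
      Real.sqrt ((k.choose p : ℝ) / k.choose m) * Real.sqrt ((k.choose n : ℝ) / k.choose p) := by
    rw [← Real.sqrt_mul (by positivity)]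
    congr 1
    have := (choose_cast_pos hp').ne'
    have := (choose_cast_pos hm).ne'
    field_simp
  rw [wignerD_eq, wignerD_eq, h1]
  push_cast
  ring

theorem wignerD_one {k m n : ℕ} (hn : n ≤ k) :
    wignerD k m n 1 = if m = n then 1 else 0 := by
  have h : matPoly k n 1 = X ^ n := by simp [matPoly]
  rw [wignerD_eq]
  rw [show ((1 : SU2).1 : Matrix (Fin 2) (Fin 2) ℂ) = 1 from rfl, h, coeff_X_pow]
  split_ifs with hmn
  · subst hmn
    rw [div_self (choose_cast_pos hn).ne']
    simp
  · simp

theorem coeff_eq_of_eval_eq {k : ℕ} {A B : ℕ → ℕ → ℂ}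
    (h : ∀ x y : ℂ, ∑ m ∈ Finset.range (k + 1), ∑ n ∈ Finset.range (k + 1), A m n * x ^ m * y ^ n =
      ∑ m ∈ Finset.range (k + 1), ∑ n ∈ Finset.range (k + 1), B m n * x ^ m * y ^ n)
    {m n : ℕ} (hm : m ≤ k) (hn : n ≤ k) : A m n = B m n := by
  have key : ∀ {a b : ℕ → ℂ}, (∀ x : ℂ, ∑ m ∈ Finset.range (k + 1), a m * x ^ m =
      ∑ m ∈ Finset.range (k + 1), b m * x ^ m) → ∀ {m}, m ≤ k → a m = b m := by
    intro a b hab m hm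
    have hp : ∑ m ∈ Finset.range (k + 1), C (a m) * X ^ m =
        ∑ m ∈ Finset.range (k + 1), C (b m) * X ^ m :=
      Polynomial.funext fun x => by simpa [eval_finsetSum] using hab x
    have := congrArg (fun p => coeff p m) hp
    simpa [finsetSum_coeff, coeff_X_pow, Nat.lt_succ_iff, hm] using this
  refine key (a := fun n => A m n) (b := fun n => B m n) (fun y => ?_) hn
  refine key (a := fun m => ∑ n ∈ Finset.range (k + 1), A m n * y ^ n)
    (b := fun m => ∑ n ∈ Finset.range (k + 1), B m n * y ^ n) (fun x => ?_) hm
  have := h x y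
  simp only [Finset.sum_mul]
  simpa only [mul_right_comm] using this

/-- This generating function is the `k`-th power of the bilinear form `(1, x) M (1, y)ᵀ`. Its
symmetry under exchanging `x` with `y` and `M` with its transpose yields
`choose_mul_coeff_matPoly_transpose`. -/
theorem sum_choose_mul_eval_matPoly (k : ℕ) (M : Matrix (Fin 2) (Fin 2) ℂ) (x y : ℂ) :
    ∑ n ∈ Finset.range (k + 1), ∑ m ∈ Finset.range (k + 1),
      ((k.choose n : ℂ) * (matPoly k n M).coeff m) * x ^ m * y ^ n =
      ((M 0 1 + M 1 1 * x) * y + (M 0 0 + M 1 0 * x)) ^ k := by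
  rw [add_pow]
  refine Finset.sum_congr rfl fun n hn => ?_
  have hn' : n ≤ k := by simpa [Nat.lt_succ_iff] using hn
  have h : (matPoly k n M).eval x = (M 0 0 + M 1 0 * x) ^ (k - n) * (M 0 1 + M 1 1 * x) ^ n := by
    simp [matPoly]
  rw [eval_eq_sum_range' (Nat.lt_succ_of_le (natDegree_matPoly_le hn' M))] at h
  rw [mul_pow, show (M 0 1 + M 1 1 * x) ^ n * y ^ n * (M 0 0 + M 1 0 * x) ^ (k - n) *
    (k.choose n : ℂ) = (k.choose n : ℂ) * ((M 0 0 + M 1 0 * x) ^ (k - n) *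
      (M 0 1 + M 1 1 * x) ^ n) * y ^ n by ring, ← h, Finset.mul_sum, Finset.sum_mul]
  refine Finset.sum_congr rfl fun m _ => ?_
  ring

theorem choose_mul_coeff_matPoly_transpose {k m n : ℕ} (hm : m ≤ k) (hn : n ≤ k)
    (M : Matrix (Fin 2) (Fin 2) ℂ) :
    (k.choose n : ℂ) * (matPoly k n M.transpose).coeff m =
      (k.choose m : ℂ) * (matPoly k m M).coeff n := by
  refine coeff_eq_of_eval_eq (k := k)
    (A := fun m n => (k.choose n : ℂ) * (matPoly k n M.transpose).coeff m)
    (B := fun m n => (k.choose m : ℂ) * (matPoly k m M).coeff n) (fun x y => ?_) hm hn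
  have h1 := sum_choose_mul_eval_matPoly k M.transpose x y
  rw [Finset.sum_comm] at h1
  have h2 := sum_choose_mul_eval_matPoly k M y x
  rw [h1]
  simp only [Matrix.transpose_apply]
  rw [show (M 1 0 + M 1 1 * x) * y + (M 0 0 + M 0 1 * x) =
    (M 0 1 + M 1 1 * y) * x + (M 0 0 + M 1 0 * y) by ring, ← h2]
  refine Finset.sum_congr rfl fun n _ => Finset.sum_congr rfl fun m _ => ?_
  ring

theorem coe_inv_SU2 (g : SU2) : (g⁻¹).1 = g.1.conjTranspose := rfl

/-- Unitarity of the representation. Since `g⁻¹` is the conjugate transpose, the law for transposes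
applies; the square roots of binomial coefficients in `wignerD` absorb the binomial weights in that
law. -/
theorem wignerD_inv {k m n : ℕ} (hm : m ≤ k) (hn : n ≤ k) (g : SU2) :
    wignerD k m n g⁻¹ = conj (wignerD k n m g) := by
  have h1 : (matPoly k n (g⁻¹).1).coeff m = conj ((matPoly k n g.1.transpose).coeff m) := by
    have : matPoly k n (g⁻¹).1 = (matPoly k n g.1.transpose).map (starRingEnd ℂ) := by
      rw [coe_inv_SU2]
      simp [matPoly, Matrix.conjTranspose_apply]
    rw [this, coeff_map]
  have h2 := choose_mul_coeff_matPoly_transpose hm hn g.1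
  have hm0 := choose_cast_pos hm
  have hn0 := choose_cast_pos hn
  have hn0' : (k.choose n : ℂ) ≠ 0 := by exact_mod_cast hn0.ne'
  have h3 : (matPoly k n g.1.transpose).coeff m =
      ((k.choose m : ℝ) / (k.choose n : ℝ) : ℝ) * (matPoly k m g.1).coeff n := by
    push_cast
    rw [div_mul_eq_mul_div, ← h2]
    field_simp
  have h4 : Real.sqrt ((k.choose n : ℝ) / k.choose m) * ((k.choose m : ℝ) / (k.choose n : ℝ)) =
      Real.sqrt ((k.choose m : ℝ) / k.choose n) := by
    rw [← inv_div (k.choose m : ℝ), Real.sqrt_inv]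
    have hp : (0 : ℝ) < (k.choose m : ℝ) / k.choose n := div_pos hm0 hn0
    have hs := Real.sqrt_pos.2 hp
    rw [inv_mul_eq_div, div_eq_iff hs.ne', Real.mul_self_sqrt hp.le]
  rw [wignerD_eq, wignerD_eq, h1, h3, map_mul, map_mul, Complex.conj_ofReal, Complex.conj_ofReal,
    ← mul_assoc, ← Complex.ofReal_mul, h4]

theorem coeff_matPoly (k n m : ℕ) (M : Matrix (Fin 2) (Fin 2) ℂ) :
    (matPoly k n M).coeff m = ∑ x ∈ Finset.HasAntidiagonal.antidiagonal m,
      (((k - n).choose x.1 : ℂ) * (M 0 0 ^ (k - n - x.1) * M 1 0 ^ x.1)) *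
        ((n.choose x.2 : ℂ) * (M 0 1 ^ (n - x.2) * M 1 1 ^ x.2)) := by
  rw [matPoly, coeff_mul]
  simp only [coeff_linear_pow]

theorem continuous_SU2_entry (i j : Fin 2) : Continuous fun g : SU2 => g.1 i j :=
  (continuous_apply_apply i j).comp continuous_subtype_val

@[fun_prop]
theorem continuous_wignerD (k m n : ℕ) : Continuous fun g : SU2 => wignerD k m n g := by
  simp only [wignerD_eq, coeff_matPoly]
  refine continuous_const.mul (continuous_finsetSum _ fun x _ => ?_)
  exact (continuous_const.mul (((continuous_SU2_entry 0 0).pow _).mul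
    ((continuous_SU2_entry 1 0).pow _))).mul (continuous_const.mul
      (((continuous_SU2_entry 0 1).pow _).mul ((continuous_SU2_entry 1 1).pow _)))

/-! ### Schur's lemma -/

/-- The matrix of `g` in the representation of spin `k / 2`. -/
def wignerMatrix (k : ℕ) (g : SU2) : Matrix (Fin (k + 1)) (Fin (k + 1)) ℂ :=
  Matrix.of fun m n => wignerD k m n g

@[simp] theorem wignerMatrix_apply (k : ℕ) (g : SU2) (m n : Fin (k + 1)) :
    wignerMatrix k g m n = wignerD k m n g := rfl

theorem wignerMatrix_mul (k : ℕ) (g h : SU2) :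
    wignerMatrix k (g * h) = wignerMatrix k g * wignerMatrix k h := by
  ext m n
  simp only [wignerMatrix_apply, Matrix.mul_apply]
  exact wignerD_mul (Nat.lt_succ_iff.1 m.2) (Nat.lt_succ_iff.1 n.2) g h

theorem wignerMatrix_inv (k : ℕ) (g : SU2) :
    wignerMatrix k g⁻¹ = (wignerMatrix k g).conjTranspose := by
  ext m n
  simp only [wignerMatrix_apply, Matrix.conjTranspose_apply]
  exact wignerD_inv (Nat.lt_succ_iff.1 m.2) (Nat.lt_succ_iff.1 n.2) g

theorem wignerMatrix_one (k : ℕ) : wignerMatrix k 1 = 1 := by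
  ext m n
  rw [wignerMatrix_apply, wignerD_one (Nat.lt_succ_iff.1 n.2), Matrix.one_apply]
  simp [Fin.ext_iff]

/-- The element `!![a, -conj c; c, conj a]` of `SU(2)`. -/
def su2Mk (a c : ℂ) (h : a * conj a + c * conj c = 1) : SU2 :=
  ⟨!![a, -conj c; c, conj a], by
    rw [Matrix.mem_specialUnitaryGroup_iff, Matrix.mem_unitaryGroup_iff]
    constructor
    · ext i j
      fin_cases i <;> fin_cases j <;>
        simp [Matrix.mul_apply, Fin.sum_univ_two, Matrix.star_apply] <;>
        first
        | linear_combination h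
        | ring
    · simp [Matrix.det_fin_two]
      linear_combination h⟩

theorem wignerD_su2Mk_zero {k m : ℕ} (hm : m ≤ k) (a c : ℂ) (h : a * conj a + c * conj c = 1) :
    wignerD k m 0 (su2Mk a c h) = (Real.sqrt (k.choose m) : ℂ) * (a ^ (k - m) * c ^ m) := by
  have h1 : (matPoly k 0 (su2Mk a c h).1).coeff m = (k.choose m : ℂ) * (a ^ (k - m) * c ^ m) := by
    simp [matPoly, su2Mk, coeff_linear_pow]
  rw [wignerD_eq, h1, ← mul_assoc]
  congr 1
  have hm0 := choose_cast_pos hm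
  rw [Nat.choose_zero_right, Nat.cast_one, one_div, Real.sqrt_inv, ← Complex.ofReal_natCast,
    ← Complex.ofReal_mul]
  congr 1
  rw [inv_mul_eq_div, Real.div_sqrt]

/-- The orbit of the highest weight vector `x^k` spans `V_j`. On the group elements with first
column `(s, t s)` the pairing with `y` is `s ^ k` times a polynomial in `t` whose coefficients are
the `y m` up to nonzero factors, and it vanishes at every real `t`. -/
theorem eq_zero_of_highest_weight {k : ℕ} {y : Fin (k + 1) → ℂ}
    (hy : ∀ g : SU2, ∑ m, y m * wignerD k m 0 g = 0) : y = 0 := by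
  let y' : ℕ → ℂ := fun m => if hm : m < k + 1 then y ⟨m, hm⟩ else 0
  have hy' : ∀ m : Fin (k + 1), y' m = y m := fun m => dif_pos m.2
  let p : ℂ[X] := ∑ m ∈ Finset.range (k + 1), C (y' m * (Real.sqrt (k.choose m) : ℂ)) * X ^ m
  have hp : ∀ t : ℝ, p.eval (t : ℂ) = 0 := by
    intro t
    have hs : 0 < 1 + t ^ 2 := by positivity
    set s : ℝ := (Real.sqrt (1 + t ^ 2))⁻¹ with hs'
    have hs0 : s ≠ 0 := inv_ne_zero (Real.sqrt_pos.2 hs).ne'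
    have hs2 : s * s * (1 + t ^ 2) = 1 := by
      rw [hs', ← mul_inv, Real.mul_self_sqrt hs.le, inv_mul_cancel₀ hs.ne']
    have h1 : (s : ℂ) * conj (s : ℂ) + ((t * s : ℝ) : ℂ) * conj ((t * s : ℝ) : ℂ) = 1 := by
      rw [Complex.conj_ofReal, Complex.conj_ofReal]
      exact_mod_cast (by linear_combination hs2 : s * s + t * s * (t * s) = 1)
    have h2 := hy (su2Mk s (t * s : ℝ) h1)
    have h3 : ∑ m : Fin (k + 1), y m * wignerD k m 0 (su2Mk s (t * s : ℝ) h1) =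
        (s : ℂ) ^ k * p.eval (t : ℂ) := by
      simp only [p, eval_finsetSum, eval_mul, eval_C, eval_pow, eval_X]
      rw [← Fin.sum_univ_eq_sum_range (fun m => y' m * (Real.sqrt (k.choose m) : ℂ) * (t : ℂ) ^ m),
        Finset.mul_sum]
      refine Finset.sum_congr rfl fun m _ => ?_
      have hm : (m : ℕ) ≤ k := Nat.lt_succ_iff.1 m.2
      rw [wignerD_su2Mk_zero hm, hy']
      have : (s : ℂ) ^ k = (s : ℂ) ^ (k - m) * (s : ℂ) ^ (m : ℕ) := by
        rw [← pow_add, Nat.sub_add_cancel hm]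
      rw [this]
      push_cast
      ring
    rw [h3] at h2
    rcases mul_eq_zero.1 h2 with h | h
    · exact absurd (eq_zero_of_pow_eq_zero h) (by exact_mod_cast hs0)
    · exact h
  have hp0 : p = 0 := by
    refine p.eq_zero_of_infinite_isRoot (Set.Infinite.mono (s := Set.range ((↑) : ℝ → ℂ)) ?_ ?_)
    · rintro _ ⟨t, rfl⟩
      exact hp t
    · exact Set.infinite_range_of_injective Complex.ofReal_injective
  funext m
  have h1 := congrArg (fun q => coeff q m) hp0
  simp only [p, finsetSum_coeff, coeff_C_mul, coeff_X_pow, coeff_zero, mul_ite, mul_one, mul_zero,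
    Finset.sum_ite_eq, Finset.mem_range, m.2, if_true, hy'] at h1
  rcases mul_eq_zero.1 h1 with h | h
  · exact h
  · exfalso
    have := Real.sqrt_pos.2 (choose_cast_pos (Nat.lt_succ_iff.1 m.2))
    exact this.ne' (by exact_mod_cast h)

theorem wignerD_su2Mk_diag {k m n : ℕ} (hn : n ≤ k) (z : ℂ) (h : z * conj z + 0 * conj 0 = 1) :
    wignerD k m n (su2Mk z 0 h) = if m = n then z ^ (k - n) * conj z ^ n else 0 := by
  have h1 : matPoly k n (su2Mk z 0 h).1 = C (z ^ (k - n) * conj z ^ n) * X ^ n := by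
    simp [matPoly, su2Mk, mul_pow]
    ring
  rw [wignerD_eq, h1, coeff_C_mul, coeff_X_pow]
  split_ifs with hmn
  · subst hmn
    rw [div_self (choose_cast_pos hn).ne']
    simp
  · simp

/-- The weights `k - 2m` and `k'` differ by `d ≠ 0`, so `z = exp(iπ/d)` makes the quotient of the
two sides equal to `-1`. -/
theorem exists_circle_pow_ne {k m k' : ℕ} (hm : m ≤ k) (h : k ≠ k' + 2 * m) :
    ∃ z : ℂ, z * conj z = 1 ∧ z ^ (k - m) * conj z ^ m ≠ z ^ k' := by
  set d : ℝ := (k : ℝ) - k' - 2 * m with hd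
  have hd0 : d ≠ 0 := by
    intro h0
    apply h
    have : (k : ℝ) = k' + 2 * m := by linarith
    exact_mod_cast this
  set θ : ℝ := Real.pi / d
  refine ⟨Complex.exp (θ * Complex.I), ?_, ?_⟩
  · rw [← Complex.exp_conj, map_mul, Complex.conj_ofReal, Complex.conj_I, ← Complex.exp_add]
    simp
  · rw [← Complex.exp_conj, map_mul, Complex.conj_ofReal, Complex.conj_I, ← Complex.exp_nat_mul,
      ← Complex.exp_nat_mul, ← Complex.exp_nat_mul, ← Complex.exp_add]
    intro heq
    have h1 : Complex.exp (((k - m : ℕ) : ℂ) * (θ * Complex.I) + (m : ℂ) * (θ * -Complex.I) -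
        (k' : ℂ) * (θ * Complex.I)) = 1 := by
      rw [Complex.exp_sub, heq, div_self (Complex.exp_ne_zero _)]
    have h2 : ((k - m : ℕ) : ℂ) * (θ * Complex.I) + (m : ℂ) * (θ * -Complex.I) -
        (k' : ℂ) * (θ * Complex.I) = Real.pi * Complex.I := by
      have h3 : ((d * θ : ℝ) : ℂ) = Real.pi := by
        rw [mul_div_cancel₀ _ hd0]
      rw [← h3, Nat.cast_sub hm, hd]
      push_cast
      ring
    rw [h2, Complex.exp_pi_mul_I] at h1
    norm_num at h1

/-- An intertwiner respects the weights of the diagonal torus: the image of the vector of weight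
`k'` has no component along the basis vector `m`, of weight `k - 2m`, unless these weights agree. -/
theorem intertwiner_highest_weight {k k' : ℕ} {Y : Matrix (Fin (k + 1)) (Fin (k' + 1)) ℂ}
    (hY : ∀ g, wignerMatrix k g * Y = Y * wignerMatrix k' g) (m : Fin (k + 1))
    (h : k ≠ k' + 2 * m) : Y m 0 = 0 := by
  obtain ⟨z, hz, hne⟩ := exists_circle_pow_ne (Nat.lt_succ_iff.1 m.2) h
  have hz' : z * conj z + 0 * conj 0 = 1 := by simp [hz]
  have h1 := congrFun (congrFun (hY (su2Mk z 0 hz')) m) 0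
  simp only [Matrix.mul_apply, wignerMatrix_apply] at h1
  simp only [wignerD_su2Mk_diag (Nat.lt_succ_iff.1 (Fin.is_lt _)), ← Fin.ext_iff, ite_mul, zero_mul,
    mul_ite, mul_zero, Finset.sum_ite_eq, Finset.sum_ite_eq', Finset.mem_univ, if_true] at h1
  have h2 : (z ^ (k - m) * conj z ^ (m : ℕ) - z ^ k') * Y m 0 = 0 := by
    simp only [Fin.val_zero, Nat.sub_zero, pow_zero, mul_one] at h1
    rw [sub_mul, h1]
    ring
  exact (mul_eq_zero.1 h2).resolve_left (sub_ne_zero.2 hne)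

/-- The weight `k'` does not occur in the smaller representation, so the highest weight vector is
killed, and with it the span of its orbit. Passing to the adjoint then handles the case `k > k'`. -/
theorem intertwiner_eq_zero_of_lt {k k' : ℕ} {Y : Matrix (Fin (k + 1)) (Fin (k' + 1)) ℂ}
    (hY : ∀ g, wignerMatrix k g * Y = Y * wignerMatrix k' g) (hk : k < k') : Y = 0 := by
  have h0 : ∀ m, Y m 0 = 0 := fun m => intertwiner_highest_weight hY m (by omega)
  ext m n
  have : (fun n => Y m n) = 0 := eq_zero_of_highest_weight fun g => by
    have := congrFun (congrFun (hY g) m) 0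
    simp only [Matrix.mul_apply, wignerMatrix_apply, h0, mul_zero, Finset.sum_const_zero] at this
    exact this.symm
  exact congrFun this n

theorem intertwiner_eq_zero {k k' : ℕ} {Y : Matrix (Fin (k + 1)) (Fin (k' + 1)) ℂ}
    (hY : ∀ g, wignerMatrix k g * Y = Y * wignerMatrix k' g) (hk : k ≠ k') : Y = 0 := by
  rcases lt_or_gt_of_ne hk with h | h
  · exact intertwiner_eq_zero_of_lt hY h
  · have : Y.conjTranspose = 0 := intertwiner_eq_zero_of_lt (fun g => by
      have := congrArg Matrix.conjTranspose (hY g⁻¹)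
      rw [Matrix.conjTranspose_mul, Matrix.conjTranspose_mul, ← wignerMatrix_inv,
        ← wignerMatrix_inv, inv_inv] at this
      exact this.symm) h
    simpa using this

/-- The highest weight vector is the only basis vector of its weight, hence an eigenvector of `Y`;
subtracting the eigenvalue gives an intertwiner that kills the whole orbit. -/
theorem intertwiner_eq_scalar {k : ℕ} {Y : Matrix (Fin (k + 1)) (Fin (k + 1)) ℂ}
    (hY : ∀ g, wignerMatrix k g * Y = Y * wignerMatrix k g) (m n : Fin (k + 1)) :
    Y m n = if m = n then Y 0 0 else 0 := by
  have h0 : ∀ m, m ≠ 0 → Y m 0 = 0 := fun m hm => intertwiner_highest_weight hY m (by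
    have : (m : ℕ) ≠ 0 := fun h => hm (Fin.ext h)
    omega)
  have : (fun n => Y m n - if m = n then Y 0 0 else 0) = 0 := eq_zero_of_highest_weight fun g => by
    have h1 := congrFun (congrFun (hY g) m) 0
    simp only [Matrix.mul_apply, wignerMatrix_apply] at h1
    rw [Finset.sum_eq_single 0 (fun p _ hp => by rw [h0 p hp, mul_zero]) (by simp)] at h1
    simp only [sub_mul, Finset.sum_sub_distrib, ite_mul, zero_mul, Finset.sum_ite_eq,
      Finset.mem_univ, if_true]
    simp only [Fin.val_zero] at h1
    rw [← h1]
    ring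
  exact sub_eq_zero.1 (congrFun this n)

/-! ### Schur orthogonality of the matrix entries -/

theorem integrable_of_continuous {f : SU2 → ℂ} (hf : Continuous f) : Integrable f haarSU2 :=
  hf.integrable_of_hasCompactSupport (HasCompactSupport.of_compactSpace f)

theorem wignerMatrix_star_mul_self (k : ℕ) (g : SU2) :
    (wignerMatrix k g).conjTranspose * wignerMatrix k g = 1 := by
  rw [← wignerMatrix_inv, ← wignerMatrix_mul, inv_mul_cancel, wignerMatrix_one]

/-- The matrix of the integrals of products of matrix entries of two representations. -/
def schurMatrix (k k' : ℕ) (n : Fin (k + 1)) (n' : Fin (k' + 1)) :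
    Matrix (Fin (k + 1)) (Fin (k' + 1)) ℂ :=
  Matrix.of fun m m' => ∫ g, wignerD k m n g * conj (wignerD k' m' n' g) ∂haarSU2

/-- Both sides are integrals over `g` that turn into each other under the translation `g ↦ h g` of
the Haar measure. -/
theorem schurMatrix_intertwines (k k' : ℕ) (n : Fin (k + 1)) (n' : Fin (k' + 1)) (h : SU2) :
    wignerMatrix k h * schurMatrix k k' n n' = schurMatrix k k' n n' * wignerMatrix k' h := by
  ext m m'
  have hint : ∀ (p : Fin (k + 1)) (p' : Fin (k' + 1)),
      Integrable (fun g => wignerD k p n g * conj (wignerD k' p' n' g)) haarSU2 := fun p p' =>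
    integrable_of_continuous (by fun_prop)
  have h1 : (wignerMatrix k h * schurMatrix k k' n n') m m' =
      ∫ g, wignerD k m n (h * g) * conj (wignerD k' m' n' g) ∂haarSU2 := by
    simp only [Matrix.mul_apply, wignerMatrix_apply, schurMatrix, Matrix.of_apply]
    simp only [← integral_const_mul]
    rw [← integral_finsetSum _ fun p _ => (hint p m').const_mul _]
    refine integral_congr_ae (Filter.Eventually.of_forall fun g => ?_)
    simp only [wignerD_mul (Nat.lt_succ_iff.1 m.2) (Nat.lt_succ_iff.1 n.2), Finset.sum_mul]
    exact Finset.sum_congr rfl fun p _ => by ring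
  have h2 : (schurMatrix k k' n n' * wignerMatrix k' h) m m' =
      ∫ g, wignerD k m n g * conj (wignerD k' m' n' (h⁻¹ * g)) ∂haarSU2 := by
    simp only [Matrix.mul_apply, wignerMatrix_apply, schurMatrix, Matrix.of_apply]
    simp only [← integral_mul_const]
    rw [← integral_finsetSum _ fun p _ => (hint m p).mul_const _]
    refine integral_congr_ae (Filter.Eventually.of_forall fun g => ?_)
    simp only [wignerD_mul (Nat.lt_succ_iff.1 m'.2) (Nat.lt_succ_iff.1 n'.2), map_sum, map_mul,
      Finset.mul_sum]
    refine Finset.sum_congr rfl fun p _ => ?_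
    rw [wignerD_inv (Nat.lt_succ_iff.1 m'.2) (Nat.lt_succ_iff.1 p.2), Complex.conj_conj]
    ring
  rw [h1, h2, ← integral_mul_left_eq_self
    (fun g => wignerD k m n g * conj (wignerD k' m' n' (h⁻¹ * g))) h]
  simp

/-- The orthogonality relations of the matrix entries of the irreducible representations. -/
theorem integral_wignerD_mul_conj {k m n k' m' n' : ℕ} (hm : m ≤ k) (hn : n ≤ k) (hm' : m' ≤ k')
    (hn' : n' ≤ k') :
    ∫ g, wignerD k m n g * conj (wignerD k' m' n' g) ∂haarSU2 =
      if k = k' ∧ m = m' ∧ n = n' then ((k : ℂ) + 1)⁻¹ else 0 := by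
  have hY := schurMatrix_intertwines k k' ⟨n, Nat.lt_succ_iff.2 hn⟩ ⟨n', Nat.lt_succ_iff.2 hn'⟩
  by_cases hk : k = k'
  · subst hk
    set Y := schurMatrix k k ⟨n, Nat.lt_succ_iff.2 hn⟩ ⟨n', Nat.lt_succ_iff.2 hn'⟩ with hYdef
    have h1 := fun a b => intertwiner_eq_scalar hY a b
    -- The trace of the scalar matrix `Y` fixes its value: summing over the rows gives the inner
    -- product of two columns of a unitary matrix, so `(k + 1) Y 0 0` is `1` or `0`.
    have h2 : ∑ a, Y a a = if n = n' then 1 else 0 := by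
      simp only [hYdef, schurMatrix, Matrix.of_apply]
      rw [← integral_finsetSum _ fun p _ => integrable_of_continuous (by fun_prop)]
      have h3 : ∀ g, ∑ p : Fin (k + 1), wignerD k p n g * conj (wignerD k p n' g) =
          if n = n' then 1 else 0 := by
        intro g
        have h4 := congrFun (congrFun (wignerMatrix_star_mul_self k g) ⟨n', Nat.lt_succ_iff.2 hn'⟩)
          ⟨n, Nat.lt_succ_iff.2 hn⟩
        simp only [Matrix.mul_apply, Matrix.conjTranspose_apply, wignerMatrix_apply,
          Matrix.one_apply, Fin.mk.injEq] at h4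
        simp only [eq_comm (a := n)]
        rw [← h4]
        exact Finset.sum_congr rfl fun p _ => mul_comm _ _
      simp only [h3]
      simp
    have h5 : ((k : ℂ) + 1) * Y 0 0 = if n = n' then 1 else 0 := by
      rw [← h2]
      rw [Finset.sum_congr rfl fun a _ => (h1 a a).trans (if_pos rfl)]
      simp
    have h6 : ((k : ℂ) + 1) ≠ 0 := by exact_mod_cast Nat.succ_ne_zero k
    have h7 := h1 ⟨m, Nat.lt_succ_iff.2 hm⟩ ⟨m', Nat.lt_succ_iff.2 hm'⟩
    have h8 : Y ⟨m, Nat.lt_succ_iff.2 hm⟩ ⟨m', Nat.lt_succ_iff.2 hm'⟩ =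
      ∫ g, wignerD k m n g * conj (wignerD k m' n' g) ∂haarSU2 := rfl
    rw [← h8, h7]
    simp only [Fin.mk.injEq, true_and]
    by_cases hmm : m = m'
    · by_cases hnn : n = n'
      · simp only [hmm, hnn, and_self, if_true] at h5 ⊢
        field_simp
        linear_combination h5
      · simp only [hnn, if_false, mul_eq_zero, h6, false_or] at h5
        simp [h5, hnn]
    · simp [hmm]
  · rw [if_neg (fun h => hk h.1)]
    have h0 := intertwiner_eq_zero hY hk
    exact congrFun (congrFun h0 ⟨m, Nat.lt_succ_iff.2 hm⟩) ⟨m', Nat.lt_succ_iff.2 hm'⟩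

end Wigner

end LQG

end

noncomputable section

namespace LQG

/-! ### Polynomial functions on `SU(2)` -/

section Monomials

/-- A matrix entry, as a continuous function on `SU(2)`. -/
def entryC (i j : Fin 2) : C(SU2, ℂ) := ⟨fun g => g.1 i j, continuous_SU2_entry i j⟩

/-- A matrix entry of an irreducible representation, as a continuous function on `SU(2)`. -/
def wignerC (k m n : ℕ) : C(SU2, ℂ) := ⟨fun g => wignerD k m n g, continuous_wignerD k m n⟩

/-- The span of the matrix entries of the irreducible representations. -/
def wignerSpan : Submodule ℂ C(SU2, ℂ) :=
  Submodule.span ℂ {f | ∃ k m n, m ≤ k ∧ n ≤ k ∧ f = wignerC k m n}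

/-- A monomial in the matrix entries. -/
def entryMonomial (p q r s : ℕ) : C(SU2, ℂ) :=
  entryC 0 0 ^ p * entryC 0 1 ^ q * entryC 1 0 ^ r * entryC 1 1 ^ s

theorem entryC_det : entryC 0 0 * entryC 1 1 - entryC 0 1 * entryC 1 0 = 1 := by
  ext g
  have h := (Matrix.mem_specialUnitaryGroup_iff.1 g.2).2
  rw [Matrix.det_fin_two] at h
  exact h

/-- Since the determinant is `1`, replacing a factor `ad` by `bc` costs a monomial whose degree is
lower by two. -/
theorem entryMonomial_succ_sub (p q r s : ℕ) :
    entryMonomial (p + 1) q r (s + 1) - entryMonomial p (q + 1) (r + 1) s =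
      entryMonomial p q r s := by
  simp only [entryMonomial]
  linear_combination (entryC 0 0 ^ p * entryC 0 1 ^ q * entryC 1 0 ^ r * entryC 1 1 ^ s) *
    entryC_det

theorem coeffC_mem_wignerSpan {k m n : ℕ} (hm : m ≤ k) (hn : n ≤ k) :
    ∑ x ∈ Finset.HasAntidiagonal.antidiagonal m, ((((k - n).choose x.1 : ℂ) * (n.choose x.2 : ℂ)) •
      entryMonomial (k - n - x.1) (n - x.2) x.1 x.2) ∈ wignerSpan := by
  have h : (∑ x ∈ Finset.HasAntidiagonal.antidiagonal m,
      ((((k - n).choose x.1 : ℂ) * (n.choose x.2 : ℂ)) •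
      entryMonomial (k - n - x.1) (n - x.2) x.1 x.2)) =
      ((Real.sqrt ((k.choose n : ℝ) / (k.choose m : ℝ)) : ℂ))⁻¹ • wignerC k m n := by
    have hs : (Real.sqrt ((k.choose n : ℝ) / (k.choose m : ℝ)) : ℂ) ≠ 0 := by
      exact_mod_cast (Real.sqrt_pos.2 (div_pos (choose_cast_pos hn) (choose_cast_pos hm))).ne'
    ext g
    have h1 : wignerC k m n g = wignerD k m n g := rfl
    rw [ContinuousMap.smul_apply, h1, wignerD_eq, smul_eq_mul, inv_mul_cancel_left₀ hs,
      coeff_matPoly, ContinuousMap.sum_apply]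
    refine Finset.sum_congr rfl fun x _ => ?_
    simp only [ContinuousMap.smul_apply, entryMonomial, ContinuousMap.mul_apply,
      ContinuousMap.pow_apply, entryC, ContinuousMap.coe_mk, smul_eq_mul]
    ring
  rw [h]
  exact wignerSpan.smul_mem _ (Submodule.subset_span ⟨k, m, n, hm, hn, rfl⟩)

/-- Induction on the degree `K`. A matrix entry of spin `K / 2` is, up to a factor, a combination of
all monomials of degree `K` with prescribed `r + s` and `q + s`. Modulo lower degree these monomials
coincide, so each of them can be solved for, provided the sum of the weights is not zero. -/
theorem entryMonomial_mem_wignerSpan (K : ℕ) : ∀ p q r s : ℕ, p + q + r + s = K →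
    entryMonomial p q r s ∈ wignerSpan := by
  induction K using Nat.strong_induction_on with
  | _ K ih =>
    -- Telescoping over `t` replacements of `ad` by `bc`, each costing a monomial of degree `K - 2`,
    -- which is in the span by induction.
    have hdiff : ∀ t p q r s : ℕ, p + q + r + s + 2 * t = K →
        entryMonomial (p + t) q r (s + t) - entryMonomial p (q + t) (r + t) s ∈ wignerSpan := by
      intro t
      induction t with
      | zero => intro p q r s _; simp
      | succ t iht =>
        intro p q r s h
        have h1 := iht p (q + 1) (r + 1) s (by omega)
        have h2 := ih (p + t + q + r + (s + t)) (by omega) (p + t) q r (s + t) rfl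
        rw [← entryMonomial_succ_sub] at h2
        have h3 := wignerSpan.add_mem h2 h1
        rw [show q + 1 + t = q + (t + 1) by ring, show r + 1 + t = r + (t + 1) by ring] at h3
        convert h3 using 1
        rw [show p + (t + 1) = p + t + 1 by ring, show s + (t + 1) = s + t + 1 by ring]
        abel
    intro p q r s hK
    have hn : q + s ≤ K := by omega
    have hm : r + s ≤ K := by omega
    have hC := coeffC_mem_wignerSpan hm hn
    -- Vandermonde's identity: the weights add up to a nonzero binomial coefficient.
    have hV : ∑ x ∈ Finset.HasAntidiagonal.antidiagonal (r + s),
        (((K - (q + s)).choose x.1 : ℂ) * ((q + s).choose x.2 : ℂ)) = (K.choose (r + s) : ℂ) := by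
      have := Nat.add_choose_eq (K - (q + s)) (q + s) (r + s)
      rw [Nat.sub_add_cancel hn] at this
      rw [this]
      push_cast
      rfl
    have hE : ∑ x ∈ Finset.HasAntidiagonal.antidiagonal (r + s),
        ((((K - (q + s)).choose x.1 : ℂ) * ((q + s).choose x.2 : ℂ)) •
          (entryMonomial (K - (q + s) - x.1) (q + s - x.2) x.1 x.2 - entryMonomial p q r s)) ∈
        wignerSpan := by
      refine wignerSpan.sum_mem fun x hx => ?_
      have hx' : x.1 + x.2 = r + s := Finset.HasAntidiagonal.mem_antidiagonal.1 hx
      -- Where a truncated subtraction in the exponents would matter, the binomial coefficient is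
      -- zero.
      by_cases h1 : x.1 ≤ K - (q + s)
      swap
      · rw [Nat.choose_eq_zero_of_lt (not_le.1 h1)]
        simp
      by_cases h2 : x.2 ≤ q + s
      swap
      · rw [Nat.choose_eq_zero_of_lt (not_le.1 h2)]
        simp
      refine wignerSpan.smul_mem _ ?_
      rcases le_total x.2 s with h | h
      · obtain ⟨t, ht⟩ := Nat.exists_eq_add_of_le h
        have h3 := hdiff t (K - (q + s) - x.1) q r x.2 (by omega)
        rw [show K - (q + s) - x.1 + t = p by omega, show x.2 + t = s by omega,
          show q + t = q + s - x.2 by omega, show r + t = x.1 by omega] at h3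
        rw [← neg_sub]
        exact wignerSpan.neg_mem h3
      · obtain ⟨t, ht⟩ := Nat.exists_eq_add_of_le h
        have h3 := hdiff t p (q + s - x.2) x.1 s (by omega)
        rw [show p + t = K - (q + s) - x.1 by omega, show s + t = x.2 by omega,
          show q + s - x.2 + t = q by omega, show x.1 + t = r by omega] at h3
        exact h3
    have h1 := wignerSpan.sub_mem hC hE
    simp only [smul_sub, Finset.sum_sub_distrib, ← Finset.sum_smul, hV] at h1
    rw [sub_sub_cancel] at h1
    have h2 : (K.choose (r + s) : ℂ) ≠ 0 := by
      exact_mod_cast (Nat.choose_pos hm).ne'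
    have h3 := wignerSpan.smul_mem (K.choose (r + s) : ℂ)⁻¹ h1
    rwa [smul_smul, inv_mul_cancel₀ h2, one_smul] at h3

/-- The algebra of polynomial functions on `SU(2)`. -/
def polyAlg : Subalgebra ℂ C(SU2, ℂ) := Algebra.adjoin ℂ (Set.range fun x : Fin 2 × Fin 2 => entryC x.1 x.2)

theorem entryC_mem_polyAlg (i j : Fin 2) : entryC i j ∈ polyAlg :=
  Algebra.subset_adjoin ⟨(i, j), rfl⟩

theorem polyAlg_le_wignerSpan {f : C(SU2, ℂ)} (hf : f ∈ polyAlg) : f ∈ wignerSpan := by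
  have h1 : ∀ x ∈ Submonoid.closure (Set.range fun x : Fin 2 × Fin 2 => entryC x.1 x.2),
      ∃ p q r s, x = entryMonomial p q r s := by
    intro x hx
    induction hx using Submonoid.closure_induction with
    | mem x hx =>
      obtain ⟨⟨i, j⟩, rfl⟩ := hx
      fin_cases i <;> fin_cases j
      · exact ⟨1, 0, 0, 0, by simp [entryMonomial]⟩
      · exact ⟨0, 1, 0, 0, by simp [entryMonomial]⟩
      · exact ⟨0, 0, 1, 0, by simp [entryMonomial]⟩
      · exact ⟨0, 0, 0, 1, by simp [entryMonomial]⟩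
    | one => exact ⟨0, 0, 0, 0, by simp [entryMonomial]⟩
    | mul x y _ _ hx hy =>
      obtain ⟨p, q, r, s, rfl⟩ := hx
      obtain ⟨p', q', r', s', rfl⟩ := hy
      exact ⟨p + p', q + q', r + r', s + s', by simp only [entryMonomial, pow_add]; ring⟩
  have h2 : f ∈ Subalgebra.toSubmodule polyAlg := hf
  rw [polyAlg, Algebra.adjoin_eq_span] at h2
  refine Submodule.span_le.2 (fun x hx => ?_) h2
  obtain ⟨p, q, r, s, rfl⟩ := h1 x hx
  exact entryMonomial_mem_wignerSpan _ p q r s rfl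

theorem coe_inv_SU2_eq_adjugate (g : SU2) : (g⁻¹).1 = g.1.adjugate := by
  have h1 : (g⁻¹).1 * g.1 = 1 := congrArg Subtype.val (inv_mul_cancel g)
  have h2 : g.1 * g.1.adjugate = 1 := by
    rw [Matrix.mul_adjugate, (Matrix.mem_specialUnitaryGroup_iff.1 g.2).2, one_smul]
  exact left_inv_eq_right_inv h1 h2

/-- On `SU(2)` the conjugate transpose is the inverse and hence the adjugate, whose entries are
polynomial. So `polyAlg` is closed under conjugation, as Stone–Weierstrass requires. -/
theorem star_entryC_mem_polyAlg (i j : Fin 2) : star (entryC i j) ∈ polyAlg := by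
  have h : ∀ g : SU2, conj (g.1 i j) = g.1.adjugate j i := fun g => by
    rw [← coe_inv_SU2_eq_adjugate]; rfl
  have h2 : star (entryC i j) = ⟨fun g => g.1.adjugate j i, by
      simp only [← h]; exact Complex.continuous_conj.comp (continuous_SU2_entry i j)⟩ := by
    ext g; exact h g
  rw [h2]
  fin_cases i <;> fin_cases j
  · convert entryC_mem_polyAlg 1 1 using 1
    ext g; simp [Matrix.adjugate_fin_two, entryC]
  · convert polyAlg.neg_mem (entryC_mem_polyAlg 1 0) using 1
    ext g; simp [Matrix.adjugate_fin_two, entryC]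
  · convert polyAlg.neg_mem (entryC_mem_polyAlg 0 1) using 1
    ext g; simp [Matrix.adjugate_fin_two, entryC]
  · convert entryC_mem_polyAlg 0 0 using 1
    ext g; simp [Matrix.adjugate_fin_two, entryC]

end Monomials

/-! ### The Peter-Weyl basis of `L²(SU(2)^L)` -/

section Net

variable {L : Type*} [Fintype L]

/-- The spin network function with spins `k` on the links and magnetic indices `m` at the
half-links. -/
def netFun (k : L → ℕ) (m : HalfLink L → ℕ) (h : L → SU2) : ℂ :=
  ∏ l, (Real.sqrt (k l + 1) : ℂ) * wignerD (k l) (m (l, true)) (m (l, false)) (h l)⁻¹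

@[fun_prop]
theorem continuous_netFun (k : L → ℕ) (m : HalfLink L → ℕ) : Continuous (netFun k m) :=
  continuous_finsetProd _ fun l _ => continuous_const.mul
    ((continuous_wignerD _ _ _).comp (continuous_apply l).inv)

/-- The spin network function as a continuous map. -/
def netC (k : L → ℕ) (m : HalfLink L → ℕ) : C(L → SU2, ℂ) := ⟨netFun k m, continuous_netFun k m⟩

/-- The spin network function as a vector of the Hilbert space. -/
def netVec (k : L → ℕ) (m : HalfLink L → ℕ) : HAux L :=
  ContinuousMap.toLp 2 (haarPi L) ℂ (netC k m)

theorem coeFn_netVec (k : L → ℕ) (m : HalfLink L → ℕ) : netVec k m =ᵐ[haarPi L] netFun k m :=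
  ContinuousMap.coeFn_toLp (haarPi L) (netC k m)

/-- The magnetic indices `m` are admissible for the spins `k`. -/
def Admissible (k : L → ℕ) (m : HalfLink L → ℕ) : Prop := ∀ x, m x ≤ k x.1

theorem integral_wignerD_inv {k m n k' m' n' : ℕ} (hm : m ≤ k) (hn : n ≤ k) (hm' : m' ≤ k')
    (hn' : n' ≤ k') :
    ∫ g, conj ((Real.sqrt (k + 1) : ℂ) * wignerD k m n g⁻¹) *
      ((Real.sqrt (k' + 1) : ℂ) * wignerD k' m' n' g⁻¹) ∂haarSU2 =
      if k = k' ∧ m = m' ∧ n = n' then 1 else 0 := by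
  have h1 : ∀ g, conj ((Real.sqrt (k + 1) : ℂ) * wignerD k m n g⁻¹) *
      ((Real.sqrt (k' + 1) : ℂ) * wignerD k' m' n' g⁻¹) =
      ((Real.sqrt (k + 1) : ℂ) * (Real.sqrt (k' + 1) : ℂ)) *
        (wignerD k n m g * conj (wignerD k' n' m' g)) := by
    intro g
    rw [wignerD_inv hm hn, wignerD_inv hm' hn', map_mul, Complex.conj_conj, Complex.conj_ofReal]
    ring
  simp only [h1]
  rw [integral_const_mul, integral_wignerD_mul_conj hn hm hn' hm']
  by_cases h : k = k' ∧ m = m' ∧ n = n'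
  · obtain ⟨rfl, rfl, rfl⟩ := h
    have h2 : (Real.sqrt (k + 1) : ℂ) * (Real.sqrt (k + 1) : ℂ) = (k : ℂ) + 1 := by
      rw [← Complex.ofReal_mul, Real.mul_self_sqrt (by positivity)]
      push_cast
      rfl
    have h3 : (k : ℂ) + 1 ≠ 0 := by exact_mod_cast Nat.succ_ne_zero k
    simp [h2, h3]
  · rw [if_neg h, if_neg fun h' => h ⟨h'.1, h'.2.2, h'.2.1⟩, mul_zero]

-- The integrand is a product over the links, so Fubini reduces this to one copy of `SU(2)`, where
-- the factors `√(2j + 1)` normalize Schur's relations.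
open Classical in
theorem inner_netVec {k k' : L → ℕ} {m m' : HalfLink L → ℕ} (hm : Admissible k m)
    (hm' : Admissible k' m') :
    inner ℂ (netVec k m) (netVec k' m') = if k = k' ∧ m = m' then 1 else 0 := by
  have h1 : inner ℂ (netVec k m) (netVec k' m') =
      ∏ l, (if k l = k' l ∧ m (l, true) = m' (l, true) ∧ m (l, false) = m' (l, false)
        then (1 : ℂ) else 0) := by
    rw [netVec, netVec, ContinuousMap.inner_toLp]
    have h2 : ∀ h : L → SU2, netC k' m' h * conj (netC k m h) =
        ∏ l, (conj ((Real.sqrt (k l + 1) : ℂ) *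
          wignerD (k l) (m (l, true)) (m (l, false)) (h l)⁻¹) *
          ((Real.sqrt (k' l + 1) : ℂ) *
            wignerD (k' l) (m' (l, true)) (m' (l, false)) (h l)⁻¹)) := by
      intro h
      rw [Finset.prod_mul_distrib, ← map_prod, mul_comm]
      rfl
    simp only [h2]
    rw [haarPi, integral_fintype_prod_eq_prod (f := fun l g =>
      (conj ((Real.sqrt (k l + 1) : ℂ) *
          wignerD (k l) (m (l, true)) (m (l, false)) g⁻¹) *
          ((Real.sqrt (k' l + 1) : ℂ) *
            wignerD (k' l) (m' (l, true)) (m' (l, false)) g⁻¹)))]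
    exact Finset.prod_congr rfl fun l _ => integral_wignerD_inv (hm _) (hm _) (hm' _) (hm' _)
  rw [h1, Finset.prod_ite_zero]
  congr 1
  · simp only [Finset.prod_const_one, Finset.mem_univ, true_imp_iff]
    refine propext ⟨fun h => ⟨funext fun l => (h l).1, funext ?_⟩, ?_⟩
    · rintro ⟨l, _ | _⟩
      · exact (h l).2.2
      · exact (h l).2.1
    · rintro ⟨rfl, rfl⟩ l
      exact ⟨rfl, rfl, rfl⟩
  · simp

/-- The pull-back of a function on `SU(2)` by the inverse of the holonomy of the link `l`. -/
def pullC (l : L) : C(SU2, ℂ) →ₐ[ℂ] C(L → SU2, ℂ) :=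
  ContinuousMap.compRightAlgHom ℂ ℂ ⟨fun h : L → SU2 => (h l)⁻¹, (continuous_apply l).inv⟩

theorem pullC_apply (l : L) (f : C(SU2, ℂ)) (h : L → SU2) : pullC l f h = f (h l)⁻¹ := rfl

variable (L) in
/-- The span of the spin network functions. -/
def netSpan : Submodule ℂ C(L → SU2, ℂ) :=
  Submodule.span ℂ {f | ∃ k m, Admissible k m ∧ f = netC k m}

variable [DecidableEq L]

theorem prod_pullC_mem_netSpan (F : L → C(SU2, ℂ)) (hF : ∀ l, F l ∈ wignerSpan) :
    ∏ l, pullC l (F l) ∈ netSpan L := by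
  let Φ : MultilinearMap ℂ (fun _ : L => C(SU2, ℂ)) C(L → SU2, ℂ) :=
    (MultilinearMap.mkPiAlgebra ℂ L C(L → SU2, ℂ)).compLinearMap
      fun l => (pullC l).toLinearMap
  have hΦ : ∀ F, Φ F = ∏ l, pullC l (F l) := fun F => by simp [Φ]
  -- `s` is the set of links whose factor may be any element of the span; at the other links the
  -- factor is already a matrix entry. Multilinearity removes the links of `s` one at a time.
  suffices h : ∀ s : Finset L, ∀ F : L → C(SU2, ℂ), (∀ l ∈ s, F l ∈ wignerSpan) →
      (∀ l ∉ s, F l ∈ {f | ∃ k m n, m ≤ k ∧ n ≤ k ∧ f = wignerC k m n}) → Φ F ∈ netSpan L by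
    rw [← hΦ]
    exact h Finset.univ F (fun l _ => hF l) fun l hl => absurd (Finset.mem_univ l) hl
  intro s
  induction s using Finset.induction_on with
  | empty =>
    intro F _ hF
    choose k m n hm hn hFe using fun l => hF l (Finset.notMem_empty l)
    have h1 : Φ F = (∏ l, (Real.sqrt (k l + 1) : ℂ))⁻¹ •
        netC k (fun x => if x.2 then m x.1 else n x.1) := by
      have hs : ∏ l, (Real.sqrt (k l + 1) : ℂ) ≠ 0 := Finset.prod_ne_zero_iff.2 fun l _ => by
        exact_mod_cast (Real.sqrt_pos.2 (by positivity)).ne'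
      ext h
      have h2 : netC k (fun x => if x.2 then m x.1 else n x.1) h =
          (∏ l, (Real.sqrt (k l + 1) : ℂ)) * ∏ l, wignerD (k l) (m l) (n l) (h l)⁻¹ := by
        rw [← Finset.prod_mul_distrib]
        simp [netC, netFun]
      rw [ContinuousMap.smul_apply, h2, smul_eq_mul, inv_mul_cancel_left₀ hs, hΦ,
        ContinuousMap.prod_apply]
      refine Finset.prod_congr rfl fun l _ => ?_
      rw [pullC_apply, hFe]
      rfl
    rw [h1]
    refine (netSpan L).smul_mem _ (Submodule.subset_span ⟨k, _, ?_, rfl⟩)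
    rintro ⟨l, _ | _⟩
    · simpa using hn l
    · simpa using hm l
  | insert l₀ s hl₀ ih =>
    intro F hF hF'
    have h1 : ∀ f ∈ wignerSpan, Φ (Function.update F l₀ f) ∈ netSpan L := by
      intro f hf
      induction hf using Submodule.span_induction with
      | mem f hf =>
        refine ih _ (fun l hl => ?_) fun l hl => ?_
        · have hne : l ≠ l₀ := fun h => hl₀ (h ▸ hl)
          rw [Function.update_of_ne hne]
          exact hF l (Finset.mem_insert_of_mem hl)
        · by_cases hne : l = l₀
          · subst hne
            rwa [Function.update_self]
          · rw [Function.update_of_ne hne]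
            exact hF' l (by simp [hne, hl])
      | zero => rw [Φ.map_update_zero]; exact zero_mem _
      | add f g _ _ hf hg => rw [Φ.map_update_add]; exact add_mem hf hg
      | smul c f _ hf => rw [Φ.map_update_smul]; exact (netSpan L).smul_mem c hf
    have h2 := h1 (F l₀) (hF l₀ (Finset.mem_insert_self _ _))
    rwa [Function.update_eq_self] at h2

variable (L) in
/-- The `*`-algebra of polynomial functions on `SU(2)^L`. -/
def netAlg : StarSubalgebra ℂ C(L → SU2, ℂ) :=
  StarAlgebra.adjoin ℂ {f | ∃ l i j, f = pullC l (entryC i j)}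

theorem netAlg_le_netSpan {f : C(L → SU2, ℂ)} (hf : f ∈ netAlg L) : f ∈ netSpan L := by
  have h1 : ∀ x ∈ Submonoid.closure ({f : C(L → SU2, ℂ) | ∃ l i j, f = pullC l (entryC i j)} ∪
      star {f | ∃ l i j, f = pullC l (entryC i j)}),
      ∃ F : L → C(SU2, ℂ), (∀ l, F l ∈ polyAlg) ∧ x = ∏ l, pullC l (F l) := by
    intro x hx
    have hsingle : ∀ l, ∀ f ∈ polyAlg, ∃ F : L → C(SU2, ℂ), (∀ l, F l ∈ polyAlg) ∧
        pullC l f = ∏ l, pullC l (F l) := by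
      intro l f hf
      refine ⟨Function.update 1 l f, fun l' => ?_, ?_⟩
      · by_cases h : l' = l
        · subst h; simpa using hf
        · rw [Function.update_of_ne h]; exact one_mem _
      · rw [Finset.prod_eq_single l]
        · rw [Function.update_self]
        · intro l' _ h
          rw [Function.update_of_ne h, Pi.one_apply, map_one]
        · simp
    induction hx using Submonoid.closure_induction with
    | mem x hx =>
      rcases hx with ⟨l, i, j, rfl⟩ | ⟨l, i, j, hx⟩
      · exact hsingle l _ (entryC_mem_polyAlg i j)
      · rw [← star_star x, hx]
        exact hsingle l _ (star_entryC_mem_polyAlg i j)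
    | one => exact ⟨1, fun l => one_mem _, by simp⟩
    | mul x y _ _ hx hy =>
      obtain ⟨F, hF, rfl⟩ := hx
      obtain ⟨F', hF', rfl⟩ := hy
      exact ⟨F * F', fun l => mul_mem (hF l) (hF' l), by simp [Finset.prod_mul_distrib]⟩
  have h2 : f ∈ Subalgebra.toSubmodule (netAlg L).toSubalgebra := hf
  rw [netAlg, StarAlgebra.adjoin_toSubalgebra, Algebra.adjoin_eq_span] at h2
  refine Submodule.span_le.2 (fun x hx => ?_) h2
  obtain ⟨F, hF, rfl⟩ := h1 x hx
  exact prod_pullC_mem_netSpan F fun l => polyAlg_le_wignerSpan (hF l)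

/-- Stone–Weierstrass for the polynomial functions, which are contained in the span of the spin
networks; the matrix entries of the holonomies separate points. -/
theorem netSpan_topologicalClosure : (netSpan L).topologicalClosure = ⊤ := by
  have h1 : (netAlg L).topologicalClosure = ⊤ := by
    refine ContinuousMap.starSubalgebra_topologicalClosure_eq_top_of_separatesPoints _ ?_
    intro x y hxy
    obtain ⟨l, hl⟩ := Function.ne_iff.1 hxy
    have hl' : (x l)⁻¹.1 ≠ (y l)⁻¹.1 := fun h => hl (inv_injective (Subtype.ext h))
    have hex : ∃ i j, (x l)⁻¹.1 i j ≠ (y l)⁻¹.1 i j := by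
      by_contra! hcon
      exact hl' (Matrix.ext hcon)
    obtain ⟨i, j, hij⟩ := hex
    exact ⟨_, ⟨pullC l (entryC i j), StarAlgebra.subset_adjoin ℂ _ ⟨l, i, j, rfl⟩, rfl⟩, hij⟩
  rw [← Submodule.dense_iff_topologicalClosure_eq_top]
  have h2 : Dense (netAlg L : Set C(L → SU2, ℂ)) := by
    rw [dense_iff_closure_eq, ← StarSubalgebra.topologicalClosure_coe, h1]
    rfl
  exact h2.mono fun f hf => netAlg_le_netSpan hf

/-- The completeness half of the Peter–Weyl theorem: uniform density in the continuous functions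
passes to `L²`, where the continuous functions are dense. -/
theorem isTotal_netVec :
    IsTotal fun p : {p : (L → ℕ) × (HalfLink L → ℕ) // Admissible p.1 p.2} =>
      netVec p.1.1 p.1.2 := by
  have h1 := (ContinuousMap.toLp_denseRange ℂ (haarPi L) ℂ (p := 2)
    (by norm_num)).topologicalClosure_map_submodule netSpan_topologicalClosure
  refine isTotal_of_dense ?_
  rw [Submodule.dense_iff_topologicalClosure_eq_top, ← h1, netSpan, Submodule.map_span]
  congr 2
  ext v
  constructor
  · rintro ⟨⟨⟨k, m⟩, h⟩, rfl⟩
    exact ⟨netC k m, ⟨k, m, h, rfl⟩, rfl⟩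
  · rintro ⟨_, ⟨k, m, h, rfl⟩, rfl⟩
    exact ⟨⟨⟨k, m⟩, h⟩, rfl⟩

/-! ### Translations of spin network functions -/

/-- The magnetic indices which are admissible for the spins `k`. -/
def admissibleIndices (k : L → ℕ) : Finset (HalfLink L → ℕ) :=
  Fintype.piFinset fun x => Finset.range (k x.1 + 1)

@[simp] theorem mem_admissibleIndices {k : L → ℕ} {m : HalfLink L → ℕ} :
    m ∈ admissibleIndices k ↔ Admissible k m := by
  simp [admissibleIndices, Admissible, Nat.lt_succ_iff]

theorem wignerD_translate {k s t : ℕ} (hs : s ≤ k) (ht : t ≤ k) (g h g' : SU2) :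
    wignerD k t s (g⁻¹ * h * g')⁻¹ =
      ∑ p ∈ Finset.range (k + 1) ×ˢ Finset.range (k + 1),
        (wignerD k t p.1 g'⁻¹ * wignerD k p.2 s g) * wignerD k p.1 p.2 h⁻¹ := by
  rw [show (g⁻¹ * h * g')⁻¹ = g'⁻¹ * (h⁻¹ * g) by group, wignerD_mul ht hs, Finset.sum_product,
    Fin.sum_univ_eq_sum_range (fun p => wignerD k t p g'⁻¹ * wignerD k p s (h⁻¹ * g))]
  refine Finset.sum_congr rfl fun p hp => ?_
  rw [wignerD_mul (by simpa [Nat.lt_succ_iff] using hp) hs,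
    Fin.sum_univ_eq_sum_range (fun q => wignerD k p q h⁻¹ * wignerD k q s g), Finset.mul_sum]
  exact Finset.sum_congr rfl fun q _ => by ring

theorem netFun_translationMap {k : L → ℕ} {m : HalfLink L → ℕ} (hm : Admissible k m)
    (g : HalfLink L → SU2) (h : L → SU2) :
    netFun k m (translationMap g h) = ∑ m' ∈ admissibleIndices k,
      (∏ x, halfLinkRep k x (g x) (m' x) (m x)) * netFun k m' h := by
  simp only [netFun, translationMap]
  simp only [fun l => wignerD_translate (hm (l, false)) (hm (l, true)) (g (l, false)) (h l)
    (g (l, true)), Finset.mul_sum]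
  rw [Finset.prod_univ_sum]
  refine Finset.sum_bij' (fun p _ x => if x.2 then (p x.1).1 else (p x.1).2)
    (fun m' _ l => (m' (l, true), m' (l, false))) ?_ ?_ ?_ ?_ ?_
  · intro p hp
    rw [mem_admissibleIndices]
    have := fun l => Finset.mem_product.1 (Fintype.mem_piFinset.1 hp l)
    rintro ⟨l, _ | _⟩
    · simpa [Nat.lt_succ_iff] using (this l).2
    · simpa [Nat.lt_succ_iff] using (this l).1
  · intro m' hm'
    rw [mem_admissibleIndices] at hm'
    rw [Fintype.mem_piFinset]
    intro l
    simp [Nat.lt_succ_iff, hm' (l, true), hm' (l, false)]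
  · intro p _
    rfl
  · intro m' _
    funext ⟨l, b⟩
    cases b <;> rfl
  · intro p _
    rw [Fintype.prod_prod_type, ← Finset.prod_mul_distrib]
    refine Finset.prod_congr rfl fun l _ => ?_
    simp [halfLinkRep]
    ring

theorem translation_netVec {k : L → ℕ} {m : HalfLink L → ℕ} (hm : Admissible k m)
    (g : HalfLink L → SU2) :
    translation g (netVec k m) = ∑ m' ∈ admissibleIndices k,
      (∏ x, halfLinkRep k x (g x) (m' x) (m x)) • netVec k m' := by
  have h1 : (∑ m' ∈ admissibleIndices k,
      (∏ x, halfLinkRep k x (g x) (m' x) (m x)) • netVec k m') =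
      ContinuousMap.toLp 2 (haarPi L) ℂ (∑ m' ∈ admissibleIndices k,
      (∏ x, halfLinkRep k x (g x) (m' x) (m x)) • netC k m') := by
    simp [netVec]
  rw [h1]
  refine Lp.ext ?_
  have h2 := Lp.coeFn_compMeasurePreserving (netVec k m) (measurePreserving_translationMap g)
  have h3 := (measurePreserving_translationMap g).quasiMeasurePreserving.ae_eq_comp
    (coeFn_netVec k m)
  refine (h2.trans h3).trans (Filter.EventuallyEq.trans ?_
    (ContinuousMap.coeFn_toLp (𝕜 := ℂ) (p := 2) (haarPi L) (∑ m' ∈ admissibleIndices k,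
      (∏ x, halfLinkRep k x (g x) (m' x) (m x)) • netC k m')).symm)
  refine Filter.Eventually.of_forall fun h => ?_
  simp only [Function.comp_apply, netFun_translationMap hm, ContinuousMap.sum_apply,
    ContinuousMap.smul_apply, smul_eq_mul]
  rfl

end Net

end LQG

end

noncomputable section

namespace LQG

/-! ### Surjectivity of the exponential map of `SU(2)` -/

/-- Euler's formula: because `J² = -1`, the map `x + iy ↦ x + yJ` is a continuous homomorphism of
real algebras from `ℂ`, and it intertwines the exponentials. -/
theorem exp_smul_of_sq_eq_neg_one (J : Matrix (Fin 2) (Fin 2) ℂ) (hJ : J * J = -1) (θ : ℝ) :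
    NormedSpace.exp ((θ : ℂ) • J) = (Real.cos θ : ℂ) • (1 : Matrix (Fin 2) (Fin 2) ℂ) +
      (Real.sin θ : ℂ) • J := by
  let _ : NormedRing (Matrix (Fin 2) (Fin 2) ℂ) := Matrix.linftyOpNormedRing
  let _ : NormedAlgebra ℝ (Matrix (Fin 2) (Fin 2) ℂ) := Matrix.linftyOpNormedAlgebra
  have hc : Continuous (Complex.liftAux J hJ) :=
    (Complex.liftAux J hJ).toLinearMap.continuous_of_finiteDimensional
  have h1 := NormedSpace.map_exp (Complex.liftAux J hJ) hc ((θ : ℂ) * Complex.I)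
  rw [← Complex.exp_eq_exp_ℂ] at h1
  simp only [Complex.liftAux_apply, Complex.exp_ofReal_mul_I_re, Complex.exp_ofReal_mul_I_im,
    Complex.mul_I_re, Complex.mul_I_im, Complex.ofReal_re, Complex.ofReal_im, neg_zero, map_zero,
    zero_add] at h1
  have h2 : ∀ (r : ℝ) (M : Matrix (Fin 2) (Fin 2) ℂ), r • M = (r : ℂ) • M := fun r M => by
    ext i j; simp
  rw [h2, h2, Algebra.algebraMap_eq_smul_one, h2] at h1
  exact h1.symm

theorem su2Lie_smul_apply (n : Fin 3 → ℝ) (θ : ℝ) :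
    su2Lie (fun k => 2 * θ * n k) = (θ : ℂ) • (Complex.I • ∑ k, (n k : ℂ) • pauli k) := by
  simp only [su2Lie, Finset.smul_sum, smul_smul]
  refine Finset.sum_congr rfl fun k _ => ?_
  congr 1
  push_cast
  ring

theorem su2Lie_unit_mul_self (n : Fin 3 → ℝ) (hn : n 0 ^ 2 + n 1 ^ 2 + n 2 ^ 2 = 1) :
    (Complex.I • ∑ k, (n k : ℂ) • pauli k) * (Complex.I • ∑ k, (n k : ℂ) • pauli k) = -1 := by
  have hn' : (n 0 : ℂ) ^ 2 + (n 1 : ℂ) ^ 2 + (n 2 : ℂ) ^ 2 = 1 := by exact_mod_cast hn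
  have hI := Complex.I_sq
  ext i j
  fin_cases i <;> fin_cases j <;>
    simp [pauli, Fin.sum_univ_three, Matrix.mul_apply, Fin.sum_univ_two] <;> ring_nf
  · simp only [Complex.I_pow_four, hI]; linear_combination -hn'
  · simp only [Complex.I_pow_four, hI]; linear_combination -hn'

theorem coe_su2Exp_smul (n : Fin 3 → ℝ) (hn : n 0 ^ 2 + n 1 ^ 2 + n 2 ^ 2 = 1) (θ : ℝ) :
    (su2Exp fun k => 2 * θ * n k).1 = (Real.cos θ : ℂ) • (1 : Matrix (Fin 2) (Fin 2) ℂ) +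
      (Real.sin θ : ℂ) • (Complex.I • ∑ k, (n k : ℂ) • pauli k) := by
  rw [← exp_smul_of_sq_eq_neg_one _ (su2Lie_unit_mul_self n hn), ← su2Lie_smul_apply]
  rfl

/-- An element of `SU(2)` with first row `(a, b)` is `cos θ + i sin θ (n · σ)`, with `cos θ = Re a`
and `sin θ · n = (Im b, Re b, Im a)`. The parameter `2θn` undoes the factor `1/2` in `su2Lie`. -/
theorem su2Exp_surjective : Function.Surjective su2Exp := by
  intro g
  have h1 : g.1.conjTranspose = g.1.adjugate := by rw [← coe_inv_SU2, coe_inv_SU2_eq_adjugate]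
  have hd : conj (g.1 0 0) = g.1 1 1 := by
    simpa [Matrix.adjugate_fin_two] using congrFun (congrFun h1 0) 0
  have hc : conj (g.1 0 1) = -g.1 1 0 := by
    simpa [Matrix.adjugate_fin_two] using congrFun (congrFun h1 1) 0
  have hdet := (Matrix.mem_specialUnitaryGroup_iff.1 g.2).2
  rw [Matrix.det_fin_two, ← hd, show g.1 1 0 = -conj (g.1 0 1) by rw [hc, neg_neg]] at hdet
  set a := g.1 0 0 with ha
  set b := g.1 0 1 with hb
  have hs : a.re ^ 2 + a.im ^ 2 + b.re ^ 2 + b.im ^ 2 = 1 := by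
    have := congrArg Complex.re hdet
    simp at this
    linarith
  obtain ⟨θ, n, hn, hθ, h0, h1', h2⟩ : ∃ (θ : ℝ) (n : Fin 3 → ℝ),
      n 0 ^ 2 + n 1 ^ 2 + n 2 ^ 2 = 1 ∧ Real.cos θ = a.re ∧ Real.sin θ * n 0 = b.im ∧
      Real.sin θ * n 1 = b.re ∧ Real.sin θ * n 2 = a.im := by
    have hcos : Real.cos (Real.arccos a.re) = a.re := Real.cos_arccos (by nlinarith) (by nlinarith)
    have hsin := Real.sin_sq_add_cos_sq (Real.arccos a.re)
    rw [hcos] at hsin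
    set σ := Real.sin (Real.arccos a.re)
    -- If `sin θ = 0`, then `g` is `1` or `-1`, and any unit vector serves as the axis.
    by_cases hσ : σ = 0
    · rw [hσ] at hsin
      have e1 : b.im = 0 := by nlinarith
      have e2 : b.re = 0 := by nlinarith
      have e3 : a.im = 0 := by nlinarith
      exact ⟨Real.arccos a.re, ![0, 0, 1], by simp, hcos, by simp [e1], by simp [e2], by
        change σ * _ = _
        simp [e3, hσ]⟩
    · refine ⟨Real.arccos a.re, ![b.im / σ, b.re / σ, a.im / σ], ?_, hcos, ?_, ?_, ?_⟩
      · simp only [Matrix.cons_val_zero, Matrix.cons_val_one, Matrix.cons_val]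
        field_simp
        linarith
      all_goals
        change σ * _ = _
        simp
        field_simp
  refine ⟨fun k => 2 * θ * n k, Subtype.ext ?_⟩
  rw [coe_su2Exp_smul n hn]
  have h0' : (Real.sin θ : ℂ) * n 0 = b.im := by exact_mod_cast h0
  have h1'' : (Real.sin θ : ℂ) * n 1 = b.re := by exact_mod_cast h1'
  have h2' : (Real.sin θ : ℂ) * n 2 = a.im := by exact_mod_cast h2
  have hI := Complex.I_mul_I
  have hae := Complex.re_add_im a
  have hbe := Complex.re_add_im b
  have hce : conj a = a.re - a.im * Complex.I := Complex.ext (by simp) (by simp)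
  have hcb : conj b = b.re - b.im * Complex.I := Complex.ext (by simp) (by simp)
  rw [hθ]
  ext i j
  fin_cases i <;> fin_cases j <;>
    simp [pauli, Fin.sum_univ_three, -Complex.ofReal_sin, ← hd, ← ha, ← hb]
  · linear_combination Complex.I * h2' + hae
  · linear_combination Complex.I * h0' + h1'' - (Real.sin θ : ℂ) * n 1 * hI + hbe
  · rw [show g.1 1 0 = -conj b by rw [hc, neg_neg], hcb]
    linear_combination Complex.I * h0' - h1'' + (Real.sin θ : ℂ) * n 1 * hI
  · rw [hce]
    linear_combination -Complex.I * h2'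

/-! ### Translations and multiplication operators -/

section Operators

variable {L : Type*} [Fintype L]

theorem coeFn_translation (g : HalfLink L → SU2) (ψ : HAux L) :
    translation g ψ =ᵐ[haarPi L] fun h => ψ (translationMap g h) :=
  Lp.coeFn_compMeasurePreserving ψ (measurePreserving_translationMap g)

theorem inner_translation (g : HalfLink L → SU2) (ψ φ : HAux L) :
    inner ℂ (translation g ψ) (translation g φ) = inner ℂ ψ φ :=
  (Lp.compMeasurePreservingₗᵢ ℂ (translationMap g)
    (measurePreserving_translationMap g)).inner_map_map ψ φ

theorem translationMap_mul (g g' : HalfLink L → SU2) (h : L → SU2) :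
    translationMap (g * g') h = translationMap g' (translationMap g h) := by
  funext l
  simp [translationMap, mul_assoc]

theorem translationMap_one (h : L → SU2) : translationMap 1 h = h := by
  funext l
  simp [translationMap]

theorem translation_mul (g g' : HalfLink L → SU2) :
    translation (g * g') = translation g * translation g' := by
  ext1 ψ
  refine Lp.ext ((coeFn_translation _ _).trans ?_)
  refine Filter.EventuallyEq.trans ?_ (coeFn_translation g (translation g' ψ)).symm
  have h := (measurePreserving_translationMap g).quasiMeasurePreserving.ae_eq_comp
    (coeFn_translation g' ψ)
  filter_upwards [h] with x hx
  simp only [Function.comp_apply] at hx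
  rw [hx, translationMap_mul]

theorem translation_one : translation (1 : HalfLink L → SU2) = 1 := by
  ext1 ψ
  refine Lp.ext ((coeFn_translation _ _).trans ?_)
  refine Filter.Eventually.of_forall fun h => ?_
  simp [translationMap_one]

theorem star_translation (g : HalfLink L → SU2) : star (translation g) = translation g⁻¹ := by
  rw [ContinuousLinearMap.star_eq_adjoint, eq_comm, ContinuousLinearMap.eq_adjoint_iff]
  intro ψ φ
  have h : translation g (translation g⁻¹ ψ) = ψ := by
    change (translation g * translation g⁻¹) ψ = ψ
    rw [← translation_mul, mul_inv_cancel, translation_one]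
    rfl
  rw [← inner_translation g, h]

/-- The multiplication by a continuous function. -/
def mulOp (f : C(L → SU2, ℂ)) : HAux L →L[ℂ] HAux L :=
  (ContinuousLinearMap.mul ℂ ℂ).holderL (haarPi L) ∞ 2 2 (ContinuousMap.toLp ∞ (haarPi L) ℂ f)

theorem coeFn_mulOp (f : C(L → SU2, ℂ)) (ψ : HAux L) :
    mulOp f ψ =ᵐ[haarPi L] fun h => f h * ψ h := by
  have h1 := ContinuousLinearMap.coeFn_holder (r := 2) (ContinuousLinearMap.mul ℂ ℂ)
    (ContinuousMap.toLp ∞ (haarPi L) ℂ f) ψ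
  have h2 := ContinuousMap.coeFn_toLp (p := ∞) (𝕜 := ℂ) (haarPi L) f
  refine Filter.EventuallyEq.trans h1 ?_
  filter_upwards [h2] with h hh
  rw [hh]
  rfl

theorem mulOp_mul (f f' : C(L → SU2, ℂ)) : mulOp (f * f') = mulOp f * mulOp f' := by
  ext1 ψ
  refine Lp.ext ((coeFn_mulOp _ _).trans ?_)
  refine Filter.EventuallyEq.trans ?_ (coeFn_mulOp f (mulOp f' ψ)).symm
  filter_upwards [coeFn_mulOp f' ψ] with h hh
  rw [hh, ContinuousMap.mul_apply, mul_assoc]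

theorem star_mulOp (f : C(L → SU2, ℂ)) : star (mulOp f) = mulOp (star f) := by
  rw [ContinuousLinearMap.star_eq_adjoint, eq_comm, ContinuousLinearMap.eq_adjoint_iff]
  intro ψ φ
  rw [L2.inner_def, L2.inner_def]
  refine integral_congr_ae ?_
  filter_upwards [coeFn_mulOp (star f) ψ, coeFn_mulOp f φ] with h h1 h2
  rw [h1, h2]
  simp only [ContinuousMap.star_apply, RCLike.inner_apply, map_mul, RCLike.star_def,
    Complex.conj_conj]
  ring

theorem mulOp_toLp (f f' : C(L → SU2, ℂ)) :
    mulOp f (ContinuousMap.toLp 2 (haarPi L) ℂ f') = ContinuousMap.toLp 2 (haarPi L) ℂ (f * f') := by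
  refine Lp.ext ((coeFn_mulOp _ _).trans ?_)
  refine Filter.EventuallyEq.trans ?_
    (ContinuousMap.coeFn_toLp (p := 2) (𝕜 := ℂ) (haarPi L) (f * f')).symm
  filter_upwards [ContinuousMap.coeFn_toLp (p := 2) (𝕜 := ℂ) (haarPi L) f'] with h hh
  rw [hh, ContinuousMap.mul_apply]

theorem translation_comm_mulOp (g : HalfLink L → SU2) (f : C(L → SU2, ℂ))
    (hf : ∀ h, f (translationMap g h) = f h) : Commute (translation g) (mulOp f) := by
  refine ContinuousLinearMap.ext fun ψ => ?_
  refine Lp.ext ((coeFn_translation g (mulOp f ψ)).trans ?_)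
  refine Filter.EventuallyEq.trans ?_ (coeFn_mulOp f (translation g ψ)).symm
  have h := (measurePreserving_translationMap g).quasiMeasurePreserving.ae_eq_comp
    (coeFn_mulOp f ψ)
  filter_upwards [h, coeFn_translation g ψ] with x hx hx'
  simp only [Function.comp_apply] at hx
  rw [hx, hx', hf]

end Operators

/-! ### Operators which commute with the holonomies and the fluxes of a region -/

section Region

variable {N L : Type*} [DecidableEq N] [Fintype L] (G : OrientedGraph N L)

/-- The family `g` is trivial at the half-links outside `R`. -/
def SupportedOn (R : Finset N) (g : HalfLink L → SU2) : Prop := ∀ x, G.node x ∉ R → g x = 1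

/-- The operator `T` commutes with the holonomies and the fluxes in `R`. -/
def CommutesWithRegion (R : Finset N) (T : HAux L →L[ℂ] HAux L) : Prop :=
  (∀ f, Commute T (holonomyOp G R f)) ∧ ∀ g, SupportedOn G R g → Commute T (translation g)

/-- A continuous function of the holonomies inside `R` as a function on `SU(2)^L`. -/
def innerC (R : Finset N) (f : C({l // G.IsInner R l} → SU2, ℂ)) : C(L → SU2, ℂ) :=
  f.comp ⟨fun h l => h l.1, by fun_prop⟩

variable {G}

theorem holonomyOp_eq (R : Finset N) (f : C({l // G.IsInner R l} → SU2, ℂ)) :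
    holonomyOp G R f = mulOp (innerC G R f) := rfl

theorem star_holonomyOp (R : Finset N) (f : C({l // G.IsInner R l} → SU2, ℂ)) :
    star (holonomyOp G R f) = holonomyOp G R (star f) := by
  rw [holonomyOp_eq, star_mulOp]
  rfl

/-- Surjectivity of the exponential map makes the Weyl operators exactly the translations supported
on `R`. The flux condition thus becomes one on a compact group, over which it can be averaged. -/
theorem mem_range_weylOp {R : Finset N} {T : HAux L →L[ℂ] HAux L} :
    T ∈ Set.range (weylOp G R) ↔ ∃ g, SupportedOn G R g ∧ T = translation g := by
  constructor
  · rintro ⟨t, rfl⟩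
    exact ⟨_, fun x hx => by simp [hx], rfl⟩
  · rintro ⟨g, hg, rfl⟩
    choose t ht using su2Exp_surjective
    refine ⟨fun x => t (g x.1), ?_⟩
    rw [weylOp]
    congr 1
    funext x
    split_ifs with hx
    · exact ht _
    · exact (hg x hx).symm

theorem commutesWithRegion_iff {R : Finset N} {T : HAux L →L[ℂ] HAux L} :
    CommutesWithRegion G R T ↔
      ∀ S ∈ Set.range (holonomyOp G R) ∪ Set.range (weylOp G R), Commute T S := by
  constructor
  · rintro ⟨h1, h2⟩ S (⟨f, rfl⟩ | hS)
    · exact h1 f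
    · obtain ⟨g, hg, rfl⟩ := mem_range_weylOp.1 hS
      exact h2 g hg
  · intro h
    exact ⟨fun f => h _ (Or.inl ⟨f, rfl⟩),
      fun g hg => h _ (Or.inr (mem_range_weylOp.2 ⟨g, hg, rfl⟩))⟩

theorem CommutesWithRegion.star {R : Finset N} {T : HAux L →L[ℂ] HAux L}
    (hT : CommutesWithRegion G R T) : CommutesWithRegion G R (star T) := by
  refine ⟨fun f => ?_, fun g hg => ?_⟩
  · have := (hT.1 (Star.star f)).star_star
    rwa [star_holonomyOp, star_star] at this
  · have := (hT.2 g⁻¹ fun x hx => by simp [hg x hx]).star_star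
    rwa [star_translation, inv_inv] at this

theorem translationMap_apply_of_isInner {R R' : Finset N} (hR : Disjoint R R')
    {g : HalfLink L → SU2} (hg : SupportedOn G R g) {l : L} (hl : G.IsInner R' l) (h : L → SU2) :
    translationMap g h l = h l := by
  have h1 : g (l, false) = 1 := hg _ (Finset.disjoint_right.1 hR (by simpa [OrientedGraph.node] using hl.1))
  have h2 : g (l, true) = 1 := hg _ (Finset.disjoint_right.1 hR (by simpa [OrientedGraph.node] using hl.2))
  simp [translationMap, h1, h2]

theorem commute_translation_holonomyOp {R R' : Finset N} (hR : Disjoint R R')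
    {g : HalfLink L → SU2} (hg : SupportedOn G R g) (f : C({l // G.IsInner R' l} → SU2, ℂ)) :
    Commute (translation g) (holonomyOp G R' f) := by
  rw [holonomyOp_eq]
  refine translation_comm_mulOp _ _ fun h => ?_
  refine congrArg f (funext fun l => ?_)
  exact translationMap_apply_of_isInner hR hg l.2 h

theorem commute_translation {R R' : Finset N} (hR : Disjoint R R') {g g' : HalfLink L → SU2}
    (hg : SupportedOn G R g) (hg' : SupportedOn G R' g') :
    Commute (translation g) (translation g') := by
  have h : g * g' = g' * g := by
    funext x
    by_cases hx : G.node x ∈ R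
    · simp [hg' x (Finset.disjoint_left.1 hR hx)]
    · simp [hg x hx]
  rw [Commute, SemiconjBy, ← translation_mul, h, translation_mul]

/-- Locality. The two regions share no inner links, and at a cut link each of them contributes only
the translations at its own end, which act from opposite sides on the holonomy. The holonomies of
cut links belong to neither algebra. -/
theorem commutesWithRegion_of_mem {R R' : Finset N} (hR : Disjoint R R') {T : HAux L →L[ℂ] HAux L}
    (hT : T ∈ Set.range (holonomyOp G R) ∪ Set.range (weylOp G R)) :
    CommutesWithRegion G R' T := by
  rcases hT with ⟨f, rfl⟩ | hT
  · refine ⟨fun f' => ?_, fun g hg => (commute_translation_holonomyOp hR.symm hg f).symm⟩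
    rw [holonomyOp_eq, holonomyOp_eq, Commute, SemiconjBy, ← mulOp_mul, mul_comm, mulOp_mul]
  · obtain ⟨g, hg, rfl⟩ := mem_range_weylOp.1 hT
    exact ⟨fun f => commute_translation_holonomyOp hR hg f,
      fun g' hg' => commute_translation hR hg hg'⟩

theorem commutesWithRegion_of_mem_adjoin {R R' : Finset N} (hR : Disjoint R R')
    {T : HAux L →L[ℂ] HAux L}
    (hT : T ∈ StarAlgebra.adjoin ℂ (Set.range (holonomyOp G R) ∪ Set.range (weylOp G R))) :
    CommutesWithRegion G R' T := by
  induction hT using StarAlgebra.adjoin_induction with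
  | mem T hT => exact commutesWithRegion_of_mem hR hT
  | algebraMap r => exact ⟨fun f => Algebra.commutes r _, fun g _ => Algebra.commutes r _⟩
  | add S T _ _ hS hT =>
    exact ⟨fun f => (hS.1 f).add_left (hT.1 f), fun g hg => (hS.2 g hg).add_left (hT.2 g hg)⟩
  | mul S T _ _ hS hT =>
    exact ⟨fun f => (hS.1 f).mul_left (hT.1 f), fun g hg => (hS.2 g hg).mul_left (hT.2 g hg)⟩
  | star T _ hT => exact hT.star

theorem commutesWithRegion_of_mem_algHolFlux {R R' : Finset N} (hR : Disjoint R R')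
    {T : HAux L →L[ℂ] HAux L} (hT : T ∈ algHolFlux G R) : CommutesWithRegion G R' T :=
  commutesWithRegion_iff.2 fun S hS => commute_of_mem_closure
    (fun _ ha => commutesWithRegion_iff.1 (commutesWithRegion_of_mem_adjoin hR ha) S hS) hT

/-- The bicommutant theorem, with the commutant of the generated algebra described through the
generators alone. -/
theorem mem_algHolFlux_of_commute {R : Finset N} {T : HAux L →L[ℂ] HAux L}
    (hT : ∀ S, CommutesWithRegion G R S → Commute T S) : T ∈ algHolFlux G R := by
  refine mem_closure_of_bicommutant _ fun S hS => hT S (commutesWithRegion_iff.2 fun a ha => ?_)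
  exact (hS a (StarAlgebra.subset_adjoin ℂ _ ha)).symm

end Region

end LQG

end

noncomputable section

namespace LQG

/-! ### Matrix entries of the operators which commute with the algebra of a region -/

/-- Expand `ξ` in the basis and apply both functionals term by term: outside `S` the coefficients
vanish. This permits comparing functionals that differ on the rest of the space. -/
theorem eq_of_eq_on_support {H P : Type*} [NormedAddCommGroup H] [InnerProductSpace ℂ H]
    [CompleteSpace H] {e : P → H} (he : Orthonormal ℂ e) (he' : IsTotal e) {S : Set P} {ξ : H}
    (hξ : ∀ p ∉ S, inner ℂ (e p) ξ = 0) {f g : H →L[ℂ] ℂ} (h : ∀ p ∈ S, f (e p) = g (e p)) :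
    f ξ = g ξ := by
  have hd : ⊤ ≤ (Submodule.span ℂ (Set.range e)).topologicalClosure :=
    (Submodule.dense_iff_topologicalClosure_eq_top.1 he'.dense_span).ge
  have h1 := (HilbertBasis.mk he hd).hasSum_repr ξ
  have hf := h1.mapL f
  have hg := h1.mapL g
  refine hf.unique ?_
  convert hg using 2 with p
  by_cases hp : p ∈ S
  · simp [h p hp]
  · simp [HilbertBasis.repr_apply_apply, hξ p hp]

theorem continuous_halfLinkRep {L : Type*} (k : L → ℕ) (x : HalfLink L) (m m' : ℕ) :
    Continuous fun g => halfLinkRep k x g m m' := by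
  unfold halfLinkRep
  split_ifs
  · exact (continuous_wignerD _ _ _).comp continuous_inv
  · exact continuous_wignerD _ _ _

theorem integral_conj_halfLinkRep_mul {L : Type*} {k k' : L → ℕ} {x : HalfLink L} {n m n' m' : ℕ}
    (hn : n ≤ k x.1) (hm : m ≤ k x.1) (hn' : n' ≤ k' x.1) (hm' : m' ≤ k' x.1) :
    ∫ g, conj (halfLinkRep k x g n m) * halfLinkRep k' x g n' m' ∂haarSU2 =
      if k x.1 = k' x.1 ∧ n = n' ∧ m = m' then ((k x.1 : ℂ) + 1)⁻¹ else 0 := by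
  unfold halfLinkRep
  by_cases hx : x.2
  · simp only [hx, if_true, wignerD_inv hm hn, wignerD_inv hm' hn', Complex.conj_conj]
    exact integral_wignerD_mul_conj hn hm hn' hm'
  · simp only [hx, Bool.false_eq_true, if_false, mul_comm (conj _)]
    rw [integral_wignerD_mul_conj hn' hm' hn hm]
    by_cases h : k x.1 = k' x.1 ∧ n = n' ∧ m = m'
    · rw [if_pos h, if_pos ⟨h.1.symm, h.2.1.symm, h.2.2.symm⟩, h.1]
    · rw [if_neg h, if_neg fun h' => h ⟨h'.1.symm, h'.2.1.symm, h'.2.2.symm⟩]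

theorem halfLinkRep_one {L : Type*} {k : L → ℕ} {x : HalfLink L} {n m : ℕ}
    (hn : n ≤ k x.1) (hm : m ≤ k x.1) :
    halfLinkRep k x 1 n m = if n = m then 1 else 0 := by
  unfold halfLinkRep
  by_cases h1 : x.2 = true
  · rw [if_pos h1, inv_one, wignerD_one hn]
    simp only [eq_comm]
  · rw [if_neg h1, wignerD_one hm]

section Entries

variable {N L : Type*} [DecidableEq N] [Fintype L] [DecidableEq L] {G : OrientedGraph N L}
  {R : Finset N} {T : HAux L →L[ℂ] HAux L}

/-- The averages over `SU(2)` of the products of entries of the representations at a half-link. -/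
def averageWeight (G : OrientedGraph N L) (R : Finset N) (k k' : L → ℕ) (x : HalfLink L)
    (n n' m m' : ℕ) : ℂ :=
  if G.node x ∈ R then (if k x.1 = k' x.1 ∧ n = n' ∧ m = m' then ((k x.1 : ℂ) + 1)⁻¹ else 0)
  else (if n = m then 1 else 0) * (if n' = m' then 1 else 0)

theorem integral_prod_halfLinkRep {k k' : L → ℕ} {n m n' m' : HalfLink L → ℕ}
    (hn : Admissible k n) (hm : Admissible k m) (hn' : Admissible k' n') (hm' : Admissible k' m') :
    ∫ g, conj (∏ x, halfLinkRep k x (if G.node x ∈ R then g x else 1) (n x) (m x)) *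
      ∏ x, halfLinkRep k' x (if G.node x ∈ R then g x else 1) (n' x) (m' x)
        ∂haarPi (HalfLink L) = ∏ x, averageWeight G R k k' x (n x) (n' x) (m x) (m' x) := by
  simp only [map_prod, ← Finset.prod_mul_distrib]
  rw [haarPi, integral_fintype_prod_eq_prod (f := fun x g =>
    conj (halfLinkRep k x (if G.node x ∈ R then g else 1) (n x) (m x)) *
      halfLinkRep k' x (if G.node x ∈ R then g else 1) (n' x) (m' x))]
  refine Finset.prod_congr rfl fun x _ => ?_
  unfold averageWeight
  split_ifs with hx h h
  · rw [integral_conj_halfLinkRep_mul (hn x) (hm x) (hn' x) (hm' x), if_pos h]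
  · rw [integral_conj_halfLinkRep_mul (hn x) (hm x) (hn' x) (hm' x), if_neg h]
  all_goals
    rw [integral_const, halfLinkRep_one (hn x) (hm x), halfLinkRep_one (hn' x) (hm' x)]
    simp_all

/-- Translating both vectors by the same `g` supported on `R` does not change the matrix entry,
because translations are unitary and commute with `T`. Averaging over `g` at all half-links of `R`
brings in Schur's relations. All label selection rules for `T` are read off from the resulting
weights. -/
theorem inner_netVec_eq_average (hT : ∀ g, SupportedOn G R g → Commute T (translation g))
    {k k' : L → ℕ} {m m' : HalfLink L → ℕ} (hm : Admissible k m) (hm' : Admissible k' m') :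
    inner ℂ (netVec k m) (T (netVec k' m')) =
      ∑ n ∈ admissibleIndices k, ∑ n' ∈ admissibleIndices k',
        (∏ x, averageWeight G R k k' x (n x) (n' x) (m x) (m' x)) *
          inner ℂ (netVec k n) (T (netVec k' n')) := by
  have h1 : ∀ g : HalfLink L → SU2, inner ℂ (netVec k m) (T (netVec k' m')) =
      ∑ n ∈ admissibleIndices k, ∑ n' ∈ admissibleIndices k',
        (conj (∏ x, halfLinkRep k x (if G.node x ∈ R then g x else 1) (n x) (m x)) *
        ∏ x, halfLinkRep k' x (if G.node x ∈ R then g x else 1) (n' x) (m' x)) *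
          inner ℂ (netVec k n) (T (netVec k' n')) := by
    intro g
    have hc := hT (fun x => if G.node x ∈ R then g x else 1) fun x hx => if_neg hx
    have hc' := DFunLike.congr_fun hc (netVec k' m')
    rw [← inner_translation (fun x => if G.node x ∈ R then g x else 1)]
    rw [ContinuousLinearMap.mul_def, ContinuousLinearMap.mul_def, ContinuousLinearMap.comp_apply,
      ContinuousLinearMap.comp_apply] at hc'
    rw [← hc', translation_netVec hm, translation_netVec hm', map_sum, sum_inner]
    refine Finset.sum_congr rfl fun n _ => ?_
    rw [inner_sum]
    refine Finset.sum_congr rfl fun n' _ => ?_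
    rw [map_smul, inner_smul_left, inner_smul_right, mul_assoc]
  have hcont : ∀ n n' : HalfLink L → ℕ, Integrable (fun g : HalfLink L → SU2 =>
      (conj (∏ x, halfLinkRep k x (if G.node x ∈ R then g x else 1) (n x) (m x)) *
        ∏ x, halfLinkRep k' x (if G.node x ∈ R then g x else 1) (n' x) (m' x)) *
          inner ℂ (netVec k n) (T (netVec k' n'))) (haarPi (HalfLink L)) := by
    intro n n'
    have hcg : ∀ x : HalfLink L, Continuous fun g : HalfLink L → SU2 =>
        if G.node x ∈ R then g x else 1 := fun x => by
      split_ifs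
      · exact continuous_apply x
      · exact continuous_const
    have hc : Continuous (fun g : HalfLink L → SU2 =>
      (conj (∏ x, halfLinkRep k x (if G.node x ∈ R then g x else 1) (n x) (m x)) *
        ∏ x, halfLinkRep k' x (if G.node x ∈ R then g x else 1) (n' x) (m' x)) *
          inner ℂ (netVec k n) (T (netVec k' n'))) := by
      refine Continuous.mul (Continuous.mul ?_ ?_) continuous_const
      · exact Complex.continuous_conj.comp (continuous_finsetProd _ fun x _ =>
          (continuous_halfLinkRep _ _ _ _).comp (hcg x))
      · exact continuous_finsetProd _ fun x _ => (continuous_halfLinkRep _ _ _ _).comp (hcg x)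
    exact hc.integrable_of_hasCompactSupport (HasCompactSupport.of_compactSpace _)
  calc inner ℂ (netVec k m) (T (netVec k' m'))
      = ∫ _ : HalfLink L → SU2, inner ℂ (netVec k m) (T (netVec k' m'))
          ∂haarPi (HalfLink L) := by
        rw [integral_const]; simp
    _ = _ := by
        rw [integral_congr_ae (Filter.Eventually.of_forall h1), integral_finsetSum]
        · refine Finset.sum_congr rfl fun n hn => ?_
          rw [integral_finsetSum _ fun n' _ => hcont n n']
          refine Finset.sum_congr rfl fun n' hn' => ?_
          rw [integral_mul_const, integral_prod_halfLinkRep (mem_admissibleIndices.1 hn) hm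
            (mem_admissibleIndices.1 hn') hm']
        · exact fun n _ => integrable_finsetSum _ fun n' _ => hcont n n'

/-- The quantum numbers in `R` are preserved. -/
theorem inner_netVec_eq_zero (hT : ∀ g, SupportedOn G R g → Commute T (translation g))
    {k k' : L → ℕ} {m m' : HalfLink L → ℕ} (hm : Admissible k m) (hm' : Admissible k' m')
    (h : ∃ x, G.node x ∈ R ∧ (k x.1 ≠ k' x.1 ∨ m x ≠ m' x)) :
    inner ℂ (netVec k m) (T (netVec k' m')) = 0 := by
  rw [inner_netVec_eq_average hT hm hm']
  obtain ⟨x, hx, h⟩ := h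
  refine Finset.sum_eq_zero fun n _ => Finset.sum_eq_zero fun n' _ => ?_
  rw [Finset.prod_eq_zero (Finset.mem_univ x), zero_mul]
  rw [averageWeight, if_pos hx, if_neg]
  rintro ⟨h1, -, h2⟩
  exact h.elim (fun h => h h1) fun h => h h2

/-- The matrix entries do not depend on the magnetic indices in `R`. -/
theorem inner_netVec_congr_index (hT : ∀ g, SupportedOn G R g → Commute T (translation g))
    {k k' : L → ℕ} {m m' m₁ m₁' : HalfLink L → ℕ} (hm : Admissible k m) (hm' : Admissible k' m')
    (hm₁ : Admissible k m₁) (hm₁' : Admissible k' m₁')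
    (h : ∀ x, G.node x ∈ R → m x = m' x) (h₁ : ∀ x, G.node x ∈ R → m₁ x = m₁' x)
    (hmm : ∀ x, G.node x ∉ R → m₁ x = m x) (hmm' : ∀ x, G.node x ∉ R → m₁' x = m' x) :
    inner ℂ (netVec k m) (T (netVec k' m')) = inner ℂ (netVec k m₁) (T (netVec k' m₁')) := by
  rw [inner_netVec_eq_average hT hm hm', inner_netVec_eq_average hT hm₁ hm₁']
  refine Finset.sum_congr rfl fun n _ => Finset.sum_congr rfl fun n' _ => ?_
  congr 1
  refine Finset.prod_congr rfl fun x _ => ?_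
  unfold averageWeight
  by_cases hx : G.node x ∈ R
  · simp [hx, h x hx, h₁ x hx]
  · simp [hx, hmm x hx, hmm' x hx]

/-- The spins `k` on the links inside `R` and the spins `k'` on the other links. -/
def glueSpins (G : OrientedGraph N L) (R : Finset N) (k k' : L → ℕ) (l : L) : ℕ :=
  if G.IsInner R l then k l else k' l

/-- The magnetic indices `m` at the ends of the links inside `R` and the indices `m'` at the ends of
the other links. -/
def glueIndices (G : OrientedGraph N L) (R : Finset N) (m m' : HalfLink L → ℕ) (x : HalfLink L) :
    ℕ :=
  if G.IsInner R x.1 then m x else m' x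

theorem glueSpins_pos {l : L} (h : G.IsInner R l) (k k' : L → ℕ) : glueSpins G R k k' l = k l :=
  if_pos h

theorem glueSpins_neg {l : L} (h : ¬ G.IsInner R l) (k k' : L → ℕ) :
    glueSpins G R k k' l = k' l :=
  if_neg h

theorem glueIndices_pos {x : HalfLink L} (h : G.IsInner R x.1) (m m' : HalfLink L → ℕ) :
    glueIndices G R m m' x = m x :=
  if_pos h

theorem glueIndices_neg {x : HalfLink L} (h : ¬ G.IsInner R x.1) (m m' : HalfLink L → ℕ) :
    glueIndices G R m m' x = m' x :=
  if_neg h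

theorem Admissible.glue {k k' : L → ℕ} {m m' : HalfLink L → ℕ} (hm : Admissible k m)
    (hm' : Admissible k' m') : Admissible (glueSpins G R k k') (glueIndices G R m m') := by
  intro x
  unfold glueSpins glueIndices
  split_ifs
  · exact hm x
  · exact hm' x

theorem admissible_zero : Admissible (0 : L → ℕ) 0 := fun _ => le_rfl

theorem wignerD_zero (g : SU2) : wignerD 0 0 0 g = 1 := by simp [wignerD]

/-- With spin `0` on the links not inside `R`, the corresponding factors are `1`, so the spin
network depends on the inner holonomies only and is a legitimate holonomy observable. -/
theorem exists_innerC (k : L → ℕ) (m : HalfLink L → ℕ) :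
    ∃ f, innerC G R f = netC (glueSpins G R k 0) (glueIndices G R m 0) := by
  refine ⟨⟨fun h => netFun (glueSpins G R k 0) (glueIndices G R m 0)
    fun l => if hl : G.IsInner R l then h ⟨l, hl⟩ else 1, ?_⟩, ?_⟩
  · refine (continuous_netFun _ _).comp (continuous_pi fun l => ?_)
    split_ifs
    · exact continuous_apply _
    · exact continuous_const
  · ext h
    simp only [innerC, ContinuousMap.comp_apply, ContinuousMap.coe_mk, netC, netFun]
    refine Finset.prod_congr rfl fun l _ => ?_
    by_cases hl : G.IsInner R l
    · rw [dif_pos hl]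
    · rw [glueSpins_neg hl, glueIndices_neg (x := (l, true)) hl,
        glueIndices_neg (x := (l, false)) hl]
      simp [wignerD_zero]

theorem netC_mul_netC (k k' : L → ℕ) (m m' : HalfLink L → ℕ)
    (hk : ∀ l, G.IsInner R l → k' l = 0) (hm : ∀ x, G.IsInner R x.1 → m' x = 0) :
    netC (glueSpins G R k 0) (glueIndices G R m 0) * netC k' m' =
      netC (glueSpins G R k k') (glueIndices G R m m') := by
  ext h
  simp only [ContinuousMap.mul_apply, netC, ContinuousMap.coe_mk, netFun]
  rw [← Finset.prod_mul_distrib]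
  refine Finset.prod_congr rfl fun l _ => ?_
  by_cases hl : G.IsInner R l
  · simp [glueSpins_pos hl, glueIndices_pos (x := (l, true)) hl,
      glueIndices_pos (x := (l, false)) hl, hk l hl, hm (l, true) hl, hm (l, false) hl,
      wignerD_zero]
  · simp [glueSpins_neg hl, glueIndices_neg (x := (l, true)) hl,
      glueIndices_neg (x := (l, false)) hl, wignerD_zero]

theorem node_mem_of_isInner {x : HalfLink L} (h : G.IsInner R x.1) : G.node x ∈ R := by
  unfold OrientedGraph.node
  split_ifs
  · exact h.2
  · exact h.1

theorem orthonormal_netVec :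
    Orthonormal ℂ fun p : {p : (L → ℕ) × (HalfLink L → ℕ) // Admissible p.1 p.2} =>
      netVec p.1.1 p.1.2 := by
  classical
  rw [orthonormal_iff_ite]
  rintro ⟨⟨k, m⟩, h⟩ ⟨⟨k', m'⟩, h'⟩
  rw [inner_netVec h h']
  simp

/-- The matrix entries do not depend on the spins of the links inside `R`. -/
theorem inner_netVec_eq_glue (hT : CommutesWithRegion G R T) {k k' : L → ℕ}
    {m m' : HalfLink L → ℕ} (hm : Admissible k m) (hm' : Admissible k' m')
    (hk : ∀ l, G.IsInner R l → k l = k' l) (h : ∀ x, G.IsInner R x.1 → m x = m' x) :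
    inner ℂ (netVec k m) (T (netVec k' m')) =
      inner ℂ (netVec (glueSpins G R 0 k) (glueIndices G R 0 m))
        (T (netVec (glueSpins G R 0 k') (glueIndices G R 0 m'))) := by
  classical
  obtain ⟨f, hf⟩ := exists_innerC (G := G) (R := R) k m
  have hmul : ∀ k₁ m₁, (∀ l, G.IsInner R l → k₁ l = 0) → (∀ x, G.IsInner R x.1 → m₁ x = 0) →
      holonomyOp G R f (netVec k₁ m₁) =
        netVec (glueSpins G R k k₁) (glueIndices G R m m₁) := by
    intro k₁ m₁ h1 h2
    rw [holonomyOp_eq, hf, netVec, mulOp_toLp, netC_mul_netC _ _ _ _ h1 h2, netVec]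
  have h0 : ∀ (k' : L → ℕ) l, G.IsInner R l → glueSpins G R 0 k' l = 0 := fun k' l hl =>
    glueSpins_pos hl _ _
  have h0' : ∀ (m' : HalfLink L → ℕ) x, G.IsInner R x.1 → glueIndices G R 0 m' x = 0 :=
    fun m' x hx => glueIndices_pos hx _ _
  have h1 : netVec k' m' =
      holonomyOp G R f (netVec (glueSpins G R 0 k') (glueIndices G R 0 m')) := by
    rw [hmul _ _ (h0 k') (h0' m')]
    congr 1
    · funext l
      by_cases hl : G.IsInner R l
      · rw [glueSpins_pos hl, hk l hl]
      · rw [glueSpins_neg hl, glueSpins_neg hl]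
    · funext x
      by_cases hx : G.IsInner R x.1
      · rw [glueIndices_pos hx, h x hx]
      · rw [glueIndices_neg hx, glueIndices_neg hx]
  have hc := DFunLike.congr_fun (hT.1 f) (netVec (glueSpins G R 0 k') (glueIndices G R 0 m'))
  change T (holonomyOp G R f _) = holonomyOp G R f (T _) at hc
  rw [h1, hc]
  -- `T` preserves the labels at the half-links of `R`, so its value on the stripped vector involves
  -- only basis vectors with all labels zero on the links inside `R`. On those, multiplication by
  -- `f` just inserts the inner labels of `(k, m)`, so pairing with `(k, m)` equals pairing with its
  -- stripped version.
  refine eq_of_eq_on_support orthonormal_netVec isTotal_netVec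
    (S := {p | ∀ x, G.node x ∈ R → p.1.1 x.1 = glueSpins G R 0 k' x.1 ∧
      p.1.2 x = glueIndices G R 0 m' x})
    (f := innerSL ℂ (netVec k m) ∘L holonomyOp G R f)
    (g := innerSL ℂ (netVec (glueSpins G R 0 k) (glueIndices G R 0 m))) ?_ ?_
  · intro p hp
    refine inner_netVec_eq_zero hT.2 p.2 (admissible_zero.glue hm') ?_
    simp only [Set.mem_ofPred_eq, not_forall] at hp
    obtain ⟨x, hx, hp⟩ := hp
    exact ⟨x, hx, by tauto⟩
  · rintro ⟨⟨k₁, m₁⟩, hadm⟩ hp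
    have hp' : ∀ x, G.node x ∈ R → k₁ x.1 = glueSpins G R 0 k' x.1 ∧
      m₁ x = glueIndices G R 0 m' x := hp
    have hk₁ : ∀ l, G.IsInner R l → k₁ l = 0 := fun l hl => by
      rw [(hp' (l, true) (node_mem_of_isInner hl)).1, h0 _ _ hl]
    have hm₁ : ∀ x, G.IsInner R x.1 → m₁ x = 0 := fun x hx => by
      rw [(hp' x (node_mem_of_isInner hx)).2, h0' _ _ hx]
    simp only [ContinuousLinearMap.comp_apply, innerSL_apply_apply]
    rw [hmul k₁ m₁ hk₁ hm₁, inner_netVec hm (hm.glue hadm),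
      inner_netVec (admissible_zero.glue hm) hadm]
    refine if_congr (and_congr ?_ ?_) rfl rfl
    · simp only [funext_iff]
      refine forall_congr' fun l => ?_
      by_cases hl : G.IsInner R l
      · simp [glueSpins_pos hl, hk₁ l hl]
      · simp [glueSpins_neg hl]
    · simp only [funext_iff]
      refine forall_congr' fun x => ?_
      by_cases hx : G.IsInner R x.1
      · simp [glueIndices_pos hx, hm₁ x hx]
      · simp [glueIndices_neg hx]

/-- The matrix entries depend only on the quantum numbers outside `R`. -/
theorem inner_netVec_congr (hT : CommutesWithRegion G R T) {k k' k₁ k₁' : L → ℕ}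
    {m m' m₁ m₁' : HalfLink L → ℕ} (hm : Admissible k m) (hm' : Admissible k' m')
    (hm₁ : Admissible k₁ m₁) (hm₁' : Admissible k₁' m₁')
    (h : ∀ x, G.node x ∈ R → k x.1 = k' x.1 ∧ m x = m' x)
    (h₁ : ∀ x, G.node x ∈ R → k₁ x.1 = k₁' x.1 ∧ m₁ x = m₁' x)
    (hk : ∀ l, ¬ G.IsInner R l → k₁ l = k l) (hk' : ∀ l, ¬ G.IsInner R l → k₁' l = k' l)
    (hmm : ∀ x, G.node x ∉ R → m₁ x = m x) (hmm' : ∀ x, G.node x ∉ R → m₁' x = m' x) :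
    inner ℂ (netVec k m) (T (netVec k' m')) = inner ℂ (netVec k₁ m₁) (T (netVec k₁' m₁')) := by
  rw [inner_netVec_eq_glue hT hm hm' (fun l hl => (h (l, true) (node_mem_of_isInner hl)).1)
      fun x hx => (h x (node_mem_of_isInner hx)).2,
    inner_netVec_eq_glue hT hm₁ hm₁' (fun l hl => (h₁ (l, true) (node_mem_of_isInner hl)).1)
      fun x hx => (h₁ x (node_mem_of_isInner hx)).2]
  have e : glueSpins G R 0 k₁ = glueSpins G R 0 k := by
    funext l
    by_cases hl : G.IsInner R l
    · rw [glueSpins_pos hl, glueSpins_pos hl]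
    · rw [glueSpins_neg hl, glueSpins_neg hl, hk l hl]
  have e' : glueSpins G R 0 k₁' = glueSpins G R 0 k' := by
    funext l
    by_cases hl : G.IsInner R l
    · rw [glueSpins_pos hl, glueSpins_pos hl]
    · rw [glueSpins_neg hl, glueSpins_neg hl, hk' l hl]
  have a₁ := admissible_zero.glue (G := G) (R := R) hm₁
  have a₁' := admissible_zero.glue (G := G) (R := R) hm₁'
  rw [e] at a₁ ⊢
  rw [e'] at a₁' ⊢
  -- With the inner labels set to zero, the spins agree on both sides; what may still differ is the
  -- magnetic indices at the half-links of `R` on links that are not inside `R`.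
  refine inner_netVec_congr_index hT.2 (admissible_zero.glue hm) (admissible_zero.glue hm') a₁ a₁'
    ?_ ?_ ?_ ?_
  · intro x hx
    simp [glueIndices, h x hx]
  · intro x hx
    simp [glueIndices, h₁ x hx]
  · intro x hx
    simp [glueIndices, hmm x hx]
  · intro x hx
    simp [glueIndices, hmm' x hx]

end Entries

end LQG

end

noncomputable section

namespace LQG

/-! ### Invariant vectors of a region -/

section RegionAction

variable {N L : Type*} [DecidableEq N] [Fintype L] [DecidableEq L]
  (G : OrientedGraph N L) (R : Finset N) (k : L → ℕ)

/-- The action on the space of a region of a family of elements of `SU(2)` at the half-links. -/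
def regionAction (g : HalfLink L → SU2) : RegionSpace G R k →ₗ[ℂ] RegionSpace G R k :=
  Matrix.toLpLin 2 2 (Matrix.of fun m m' => ∏ x, halfLinkRep k x.1 (g x.1) (m x) (m' x))

/-- The magnetic indices of a region, sorted by the nodes. -/
def indexEquiv : (∀ x : {x : HalfLink L // G.node x ∈ R}, Fin (k x.1.1 + 1)) ≃
    ∀ n : R, ∀ x : {x : HalfLink L // G.node x = n}, Fin (k x.1.1 + 1) where
  toFun m n x := m ⟨x.1, x.2.symm ▸ n.2⟩
  invFun p x := p ⟨G.node x.1, x.2⟩ ⟨x.1, rfl⟩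
  left_inv m := rfl
  right_inv p := by
    have h : ∀ (n : N) (hn : n ∈ R) (x : HalfLink L) (hx : G.node x = n),
        p ⟨G.node x, hx.symm ▸ hn⟩ ⟨x, rfl⟩ = p ⟨n, hn⟩ ⟨x, hx⟩ := by
      rintro _ _ x rfl
      rfl
    funext n x
    exact h n.1 n.2 x.1 x.2

/-- The half-links of a region, sorted by the nodes. -/
def halfLinkEquiv : (Σ n : R, {x : HalfLink L // G.node x = n}) ≃ {x : HalfLink L // G.node x ∈ R} where
  toFun s := ⟨s.2.1, s.2.2.symm ▸ s.1.2⟩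
  invFun x := ⟨⟨G.node x.1, x.2⟩, ⟨x.1, rfl⟩⟩
  left_inv := by
    have h : ∀ (n : N) (hn : n ∈ R) (x : HalfLink L) (hx : G.node x = n),
        (⟨⟨G.node x, hx.symm ▸ hn⟩, ⟨x, rfl⟩⟩ : Σ n : R, {x : HalfLink L // G.node x = n}) =
          ⟨⟨n, hn⟩, ⟨x, hx⟩⟩ := by
      rintro _ _ x rfl
      rfl
    exact fun s => h s.1.1 s.1.2 s.2.1 s.2.2
  right_inv x := rfl

variable {G R k}

theorem regionAction_apply (g : HalfLink L → SU2) (v : RegionSpace G R k)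
    (m : ∀ x : {x : HalfLink L // G.node x ∈ R}, Fin (k x.1.1 + 1)) :
    regionAction G R k g v m =
      ∑ m' : (∀ x : {x : HalfLink L // G.node x ∈ R}, Fin (k x.1.1 + 1)),
        (∏ x, halfLinkRep k x.1 (g x.1) (m x) (m' x)) * v m' := by
  simp [regionAction, Matrix.toLpLin_apply, Matrix.mulVec, dotProduct]

theorem nodeAction_apply {n : N} (g : SU2) (v : NodeSpace G k n)
    (m : ∀ x : {x : HalfLink L // G.node x = n}, Fin (k x.1.1 + 1)) :
    nodeAction G k n g v m = ∑ m' : (∀ x : {x : HalfLink L // G.node x = n}, Fin (k x.1.1 + 1)),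
        (∏ x, halfLinkRep k x.1 g (m x) (m' x)) * v m' := by
  simp [nodeAction, Matrix.toLpLin_apply, Matrix.mulVec, dotProduct]

theorem productVector_apply (u : ∀ n : R, NodeSpace G k n)
    (m : ∀ x : {x : HalfLink L // G.node x ∈ R}, Fin (k x.1.1 + 1)) :
    productVector G R k u m = ∏ n, u n (indexEquiv G R k m n) := rfl

theorem regionAction_productVector (g : N → SU2) (u : ∀ n : R, NodeSpace G k n) :
    regionAction G R k (g ∘ G.node) (productVector G R k u) =
      productVector G R k fun n => nodeAction G k n (g n) (u n) := by
  ext m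
  rw [regionAction_apply, productVector_apply]
  simp only [nodeAction_apply]
  rw [Finset.prod_univ_sum, Fintype.piFinset_univ]
  refine Fintype.sum_equiv (indexEquiv G R k) _ _ fun m' => ?_
  rw [productVector_apply, Finset.prod_mul_distrib]
  congr 1
  rw [← Fintype.prod_equiv (halfLinkEquiv G R) _ _ fun _ => rfl, Fintype.prod_sigma]
  refine Finset.prod_congr rfl fun n _ => Finset.prod_congr rfl fun x _ => ?_
  change halfLinkRep k x.1 (g (G.node x.1)) _ _ = _
  rw [x.2]
  rfl

theorem prod_ite_eq_of_forall {ι : Type*} [Fintype ι] {κ : ι → Type*} [∀ i, DecidableEq (κ i)]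
    (p q : ∀ i, κ i) : ∏ i, (if p i = q i then (1 : ℂ) else 0) = if p = q then 1 else 0 := by
  rw [Finset.prod_ite_zero]
  simp [funext_iff]

theorem halfLinkRep_one_fin (x : HalfLink L) (m m' : Fin (k x.1 + 1)) :
    halfLinkRep k x 1 m m' = if m = m' then 1 else 0 := by
  rw [halfLinkRep_one (Nat.lt_succ_iff.1 m.2) (Nat.lt_succ_iff.1 m'.2)]
  simp only [Fin.ext_iff]

theorem regionAction_eq_self {g : HalfLink L → SU2} (hg : ∀ x, G.node x ∈ R → g x = 1)
    (v : RegionSpace G R k) : regionAction G R k g v = v := by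
  ext m
  rw [regionAction_apply]
  have h : ∀ m' : (∀ x : {x : HalfLink L // G.node x ∈ R}, Fin (k x.1.1 + 1)),
      ∏ x, halfLinkRep k x.1 (g x.1) (m x) (m' x) = if m = m' then 1 else 0 := by
    intro m'
    rw [← prod_ite_eq_of_forall]
    refine Finset.prod_congr rfl fun x _ => ?_
    rw [hg x.1 x.2, halfLinkRep_one_fin]
  simp [h]

theorem regionAction_congr {g g' : HalfLink L → SU2} (hg : ∀ x, G.node x ∈ R → g x = g' x) :
    regionAction G R k g = regionAction G R k g' := by
  ext v m
  rw [regionAction_apply, regionAction_apply]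
  exact Finset.sum_congr rfl fun m' _ => by
    rw [Finset.prod_congr rfl fun x _ => by rw [hg x.1 x.2]]

theorem nodeAction_one (n : N) (v : NodeSpace G k n) : nodeAction G k n 1 v = v := by
  ext m
  rw [nodeAction_apply]
  have h : ∀ m' : (∀ x : {x : HalfLink L // G.node x = n}, Fin (k x.1.1 + 1)),
      ∏ x, halfLinkRep k x.1 1 (m x) (m' x) = if m = m' then 1 else 0 := by
    intro m'
    rw [← prod_ite_eq_of_forall]
    exact Finset.prod_congr rfl fun x _ => halfLinkRep_one_fin _ _ _
  simp [h]

theorem mem_intertwiners {n : N} {v : NodeSpace G k n} :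
    v ∈ intertwiners G k n ↔ ∀ g, nodeAction G k n g v = v := by
  simp [intertwiners, sub_eq_zero]

theorem conj_halfLinkRep {x : HalfLink L} {m m' : ℕ} (hm : m ≤ k x.1) (hm' : m' ≤ k x.1)
    (g : SU2) : conj (halfLinkRep k x g m m') = halfLinkRep k x g⁻¹ m' m := by
  unfold halfLinkRep
  split_ifs
  · rw [wignerD_inv hm' hm, Complex.conj_conj, inv_inv]
  · rw [wignerD_inv hm' hm]

theorem inner_nodeAction (n : N) (g : SU2) (v w : NodeSpace G k n) :
    inner ℂ (nodeAction G k n g v) w = inner ℂ v (nodeAction G k n g⁻¹ w) := by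
  simp only [PiLp.inner_apply, nodeAction_apply, RCLike.inner_apply, map_sum, map_mul, map_prod,
    Finset.mul_sum, Finset.sum_mul]
  rw [Finset.sum_comm]
  refine Finset.sum_congr rfl fun m _ => Finset.sum_congr rfl fun m' _ => ?_
  rw [Finset.prod_congr rfl fun x _ => conj_halfLinkRep (Nat.lt_succ_iff.1 (m' x).2)
    (Nat.lt_succ_iff.1 (m x).2) g]
  ring

/-- By unitarity, the Riesz vector of an invariant functional is itself invariant. The functional
then vanishes on its own Riesz vector, which must be zero. No decomposition into irreducibles is
needed. -/
theorem node_functional_eq_zero {n : N} (f : NodeSpace G k n →ₗ[ℂ] ℂ)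
    (hf : ∀ g v, f (nodeAction G k n g v) = f v) (h0 : ∀ v ∈ intertwiners G k n, f v = 0) :
    f = 0 := by
  set z := (InnerProductSpace.toDual ℂ (NodeSpace G k n)).symm f.toContinuousLinearMap with hz
  have h1 : ∀ v, inner ℂ z v = f v := fun v => by
    rw [hz, InnerProductSpace.toDual_symm_apply]
    rfl
  have h2 : z ∈ intertwiners G k n := mem_intertwiners.2 fun g => by
    refine ext_inner_right ℂ fun v => ?_
    rw [inner_nodeAction, h1, hf, h1]
  have h3 : z = 0 := inner_self_eq_zero.1 (by rw [h1, h0 z h2])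
  ext1 v
  rw [← h1, h3, inner_zero_left, LinearMap.zero_apply]

variable (G R k) in
/-- The tensor product of vectors at the nodes of a region as a multilinear map. -/
def productMulti :
    MultilinearMap ℂ (fun n : R => NodeSpace G k n) (RegionSpace G R k) :=
  (WithLp.linearEquiv 2 ℂ _).symm.toLinearMap.compMultilinearMap
    (MultilinearMap.pi fun m => (MultilinearMap.mkPiAlgebra ℂ R ℂ).compLinearMap
      fun n => (EuclideanSpace.proj (𝕜 := ℂ) (indexEquiv G R k m n)).toLinearMap)

theorem productMulti_apply (u : ∀ n : R, NodeSpace G k n) :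
    productMulti G R k u = productVector G R k u := by
  ext m
  simp [productMulti, productVector_apply]

theorem single_eq_productVector
    (m : ∀ x : {x : HalfLink L // G.node x ∈ R}, Fin (k x.1.1 + 1)) :
    EuclideanSpace.single m (1 : ℂ) =
      productVector G R k fun n => EuclideanSpace.single (indexEquiv G R k m n) 1 := by
  ext m'
  rw [productVector_apply]
  simp only [PiLp.single_apply]
  rw [prod_ite_eq_of_forall]
  simp [(indexEquiv G R k).injective.eq_iff]

theorem productVector_mem_regionIntertwiners {u : ∀ n : R, NodeSpace G k n}
    (hu : ∀ n : R, u n ∈ intertwiners G k n.1) :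
    productVector G R k u ∈ regionIntertwiners G R k :=
  Submodule.subset_span ⟨u, hu, rfl⟩

theorem regionAction_of_mem {v : RegionSpace G R k} (hv : v ∈ regionIntertwiners G R k)
    (g : N → SU2) : regionAction G R k (g ∘ G.node) v = v := by
  induction hv using Submodule.span_induction with
  | mem v hv =>
    obtain ⟨u, hu, rfl⟩ := hv
    rw [regionAction_productVector]
    congr 1
    funext n
    exact mem_intertwiners.1 (hu n) (g n)
  | zero => exact map_zero _
  | add v w _ _ hv hw => rw [map_add, hv, hw]
  | smul c v _ hv => rw [map_smul, hv]

/-- An invariant functional which vanishes on the tensor products of intertwiners vanishes. -/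
theorem region_functional_eq_zero (f : RegionSpace G R k →ₗ[ℂ] ℂ)
    (hf : ∀ (g : N → SU2) v, f (regionAction G R k (g ∘ G.node) v) = f v)
    (h0 : ∀ v ∈ regionIntertwiners G R k, f v = 0) : f = 0 := by
  -- `s` is the set of nodes where the tensor factor is arbitrary rather than invariant. As a
  -- function of the factor at one node, `f` is invariant under gauge transformations at that node
  -- alone.
  have key : ∀ s : Finset R, ∀ u : (∀ n : R, NodeSpace G k n),
      (∀ n, n ∉ s → u n ∈ intertwiners G k n.1) → f (productVector G R k u) = 0 := by
    intro s
    induction s using Finset.induction_on with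
    | empty =>
      exact fun u hu => h0 _ (productVector_mem_regionIntertwiners fun n => hu n (by simp))
    | insert n s hn ih =>
      intro u hu
      have h1 : ∀ y, (f ∘ₗ (productMulti G R k).toLinearMap u n) y =
          f (productVector G R k (Function.update u n y)) := fun y => by
        rw [← productMulti_apply]
        rfl
      have h2 : f ∘ₗ (productMulti G R k).toLinearMap u n = 0 := by
        refine node_functional_eq_zero _ (fun g y => ?_) fun y hy => ?_
        · rw [h1, h1, ← hf (Function.update 1 n.1 g) (productVector G R k (Function.update u n y)),
            regionAction_productVector]
          congr 2
          funext n'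
          by_cases h : n' = n
          · subst h
            simp
          · have h' : n'.1 ≠ n.1 := fun h' => h (Subtype.ext h')
            rw [Function.update_of_ne h, Function.update_of_ne h, Function.update_of_ne h',
              Pi.one_apply, nodeAction_one]
        · rw [h1]
          refine ih _ fun n' hn' => ?_
          by_cases h : n' = n
          · subst h
            rwa [Function.update_self]
          · rw [Function.update_of_ne h]
            exact hu n' (by simp [h, hn'])
      have h3 := h1 (u n)
      rw [h2, Function.update_eq_self] at h3
      exact h3.symm
  refine (EuclideanSpace.basisFun _ ℂ).toBasis.ext fun m => ?_
  rw [OrthonormalBasis.coe_toBasis, EuclideanSpace.basisFun_apply, single_eq_productVector]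
  exact key Finset.univ _ fun n hn => absurd (Finset.mem_univ n) hn

instance : CompleteSpace (regionIntertwiners G R k) := FiniteDimensional.complete ℂ _

end RegionAction

end LQG

end

noncomputable section

namespace LQG

/-! ### The decomposition of the auxiliary Hilbert space by the spin networks -/

section SpinNetworks

variable {N L : Type*} [Fintype N] [DecidableEq N] [Fintype L] [DecidableEq L]
  (G : OrientedGraph N L) (A : Finset N)

/-- The magnetic indices at the half-links of a region. -/
abbrev MagneticIndex (R : Finset N) (k : L → ℕ) : Type _ :=
  ∀ x : {x : HalfLink L // G.node x ∈ R}, Fin (k x.1.1 + 1)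

/-- The quantum numbers inside the region `R`, given the boundary spins `α`. -/
abbrev RegionIndex (R : Finset N) (α : BoundarySpins G A) : Type _ :=
  Σ j : InnerSpins G R, MagneticIndex G R (regionSpins G A R α j)

variable {G A}

theorem isCut_of_mem {x : HalfLink L} (hx : G.node x ∈ A) (h : ¬ G.IsInner A x.1) :
    G.IsCut A x.1 := by
  obtain ⟨l, _ | _⟩ := x <;> simp_all [OrientedGraph.node, OrientedGraph.IsCut]

theorem isCut_of_not_mem {x : HalfLink L} (hx : G.node x ∉ A) (h : ¬ G.IsInner Aᶜ x.1) :
    G.IsCut A x.1 := by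
  obtain ⟨l, _ | _⟩ := x <;> simp_all [OrientedGraph.node, OrientedGraph.IsCut]

theorem not_isInner_of_isCut {l : L} (h : G.IsCut A l) : ¬ G.IsInner A l := by
  rintro ⟨h1, h2⟩
  rcases h with h | h
  · exact h.2 h2
  · exact h.1 h1

theorem not_isInner_compl_of_isCut {l : L} (h : G.IsCut A l) : ¬ G.IsInner Aᶜ l := by
  rintro ⟨h1, h2⟩
  rw [Finset.mem_compl] at h1 h2
  rcases h with h | h
  · exact h1 h.1
  · exact h2 h.2

theorem exists_halfLink_of_isCut {l : L} (h : G.IsCut A l) :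
    ∃ b, G.node (l, b) ∈ A := by
  rcases h with h | h
  · exact ⟨false, by simpa [OrientedGraph.node] using h.1⟩
  · exact ⟨true, by simpa [OrientedGraph.node] using h.2⟩

theorem exists_halfLink_compl_of_isCut {l : L} (h : G.IsCut A l) :
    ∃ b, G.node (l, b) ∈ Aᶜ := by
  rcases h with h | h
  · exact ⟨true, by simpa [OrientedGraph.node] using h.2⟩
  · exact ⟨false, by simpa [OrientedGraph.node] using h.1⟩

theorem regionSpins_inner {R : Finset N} {l : L} (h : G.IsInner R l) (α : BoundarySpins G A)
    (j : InnerSpins G R) : regionSpins G A R α j l = j ⟨l, h⟩ :=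
  dif_pos h

theorem regionSpins_cut {R : Finset N} {l : L} (h : ¬ G.IsInner R l) (h' : G.IsCut A l)
    (α : BoundarySpins G A) (j : InnerSpins G R) : regionSpins G A R α j l = α ⟨l, h'⟩ := by
  rw [regionSpins, dif_neg h, dif_pos h']

theorem allSpins_of_mem {x : HalfLink L} (hx : G.node x ∈ A) (α : BoundarySpins G A)
    (jA : InnerSpins G A) (jB : InnerSpins G Aᶜ) :
    allSpins G A α jA jB x.1 = regionSpins G A A α jA x.1 := by
  unfold allSpins
  split_ifs with h
  · rfl
  · have hc := isCut_of_mem hx h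
    rw [regionSpins_cut h hc, regionSpins_cut (not_isInner_compl_of_isCut hc) hc]

theorem allSpins_of_not_mem {x : HalfLink L} (hx : G.node x ∉ A) (α : BoundarySpins G A)
    (jA : InnerSpins G A) (jB : InnerSpins G Aᶜ) :
    allSpins G A α jA jB x.1 = regionSpins G A Aᶜ α jB x.1 := by
  unfold allSpins
  rw [if_neg fun h => hx (node_mem_of_isInner h)]

theorem allIndices_of_mem {kA kB : L → ℕ} {x : HalfLink L} (hx : G.node x ∈ A)
    (mA : MagneticIndex G A kA) (mB : MagneticIndex G Aᶜ kB) :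
    allIndices G A mA mB x = mA ⟨x, hx⟩ :=
  dif_pos hx

theorem allIndices_of_not_mem {kA kB : L → ℕ} {x : HalfLink L} (hx : G.node x ∉ A)
    (mA : MagneticIndex G A kA) (mB : MagneticIndex G Aᶜ kB) :
    allIndices G A mA mB x = mB ⟨x, Finset.mem_compl.2 hx⟩ :=
  dif_neg hx

theorem admissible_allIndices {α : BoundarySpins G A} {jA : InnerSpins G A}
    {jB : InnerSpins G Aᶜ} (mA : MagneticIndex G A (regionSpins G A A α jA))
    (mB : MagneticIndex G Aᶜ (regionSpins G A Aᶜ α jB)) :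
    Admissible (allSpins G A α jA jB) (allIndices G A mA mB) := by
  intro x
  by_cases hx : G.node x ∈ A
  · rw [allSpins_of_mem hx, allIndices_of_mem hx]
    exact Nat.lt_succ_iff.1 (mA ⟨x, hx⟩).2
  · rw [allSpins_of_not_mem hx, allIndices_of_not_mem hx]
    exact Nat.lt_succ_iff.1 (mB ⟨x, Finset.mem_compl.2 hx⟩).2

/-- The labels at the half-links of `R` determine all of the index, the boundary spins included,
since every cut link has an end in `R`. -/
theorem regionIndex_ext {R : Finset N} (hR : ∀ l, G.IsCut A l → ¬ G.IsInner R l)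
    (hR' : ∀ l, G.IsCut A l → ∃ b, G.node (l, b) ∈ R) {α α' : BoundarySpins G A}
    {p : RegionIndex G A R α} {p' : RegionIndex G A R α'}
    (h : ∀ x (hx : G.node x ∈ R), regionSpins G A R α p.1 x.1 = regionSpins G A R α' p'.1 x.1 ∧
      (p.2 ⟨x, hx⟩ : ℕ) = p'.2 ⟨x, hx⟩) :
    (⟨α, p⟩ : Σ α, RegionIndex G A R α) = ⟨α', p'⟩ := by
  have h1 : α = α' := funext fun ⟨l, hl⟩ => by
    obtain ⟨b, hb⟩ := hR' l hl
    have := (h (l, b) hb).1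
    rwa [regionSpins_cut (hR l hl) hl, regionSpins_cut (hR l hl) hl] at this
  subst h1
  obtain ⟨j, m⟩ := p
  obtain ⟨j', m'⟩ := p'
  have h2 : j = j' := funext fun ⟨l, hl⟩ => by
    have := (h (l, true) (node_mem_of_isInner hl)).1
    rwa [regionSpins_inner hl, regionSpins_inner hl] at this
  subst h2
  have h3 : m = m' := funext fun x => Fin.ext (h x.1 x.2).2
  rw [h3]

theorem regionIndex_ext_left {α α' : BoundarySpins G A}
    {p : RegionIndex G A A α} {p' : RegionIndex G A A α'}
    (h : ∀ x (hx : G.node x ∈ A), regionSpins G A A α p.1 x.1 = regionSpins G A A α' p'.1 x.1 ∧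
      (p.2 ⟨x, hx⟩ : ℕ) = p'.2 ⟨x, hx⟩) :
    (⟨α, p⟩ : Σ α, RegionIndex G A A α) = ⟨α', p'⟩ :=
  regionIndex_ext (fun _ => not_isInner_of_isCut) (fun _ => exists_halfLink_of_isCut) h

theorem regionIndex_ext_right {α α' : BoundarySpins G A}
    {p : RegionIndex G A Aᶜ α} {p' : RegionIndex G A Aᶜ α'}
    (h : ∀ x (hx : G.node x ∈ Aᶜ), regionSpins G A Aᶜ α p.1 x.1 =
      regionSpins G A Aᶜ α' p'.1 x.1 ∧ (p.2 ⟨x, hx⟩ : ℕ) = p'.2 ⟨x, hx⟩) :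
    (⟨α, p⟩ : Σ α, RegionIndex G A Aᶜ α) = ⟨α', p'⟩ :=
  regionIndex_ext (fun _ => not_isInner_compl_of_isCut) (fun _ => exists_halfLink_compl_of_isCut) h

variable (G A) in
/-- The quantum numbers of a spin network function. -/
def netIndex (s : Σ α, RegionIndex G A A α × RegionIndex G A Aᶜ α) :
    {p : (L → ℕ) × (HalfLink L → ℕ) // Admissible p.1 p.2} :=
  ⟨(allSpins G A s.1 s.2.1.1 s.2.2.1, allIndices G A s.2.1.2 s.2.2.2),
    admissible_allIndices s.2.1.2 s.2.2.2⟩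

/-- Together with surjectivity this is the combinatorial source of the sectors: the spin of a cut
link is seen from both sides but recorded once, in `α`. Thus the basis is indexed by a fibred
product over `α` rather than by a product. -/
theorem netIndex_injective : Function.Injective (netIndex G A) := by
  rintro ⟨α, p, q⟩ ⟨α', p', q'⟩ h
  have h1 : allSpins G A α p.1 q.1 = allSpins G A α' p'.1 q'.1 := congrArg (fun t => t.1.1) h
  have h2 : allIndices G A p.2 q.2 = allIndices G A p'.2 q'.2 := congrArg (fun t => t.1.2) h
  have hp : (⟨α, p⟩ : Σ α, RegionIndex G A A α) = ⟨α', p'⟩ := regionIndex_ext_left fun x hx => by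
    constructor
    · rw [← allSpins_of_mem hx α p.1 q.1, ← allSpins_of_mem hx α' p'.1 q'.1, h1]
    · rw [← allIndices_of_mem hx p.2 q.2, ← allIndices_of_mem hx p'.2 q'.2, h2]
  have hq : (⟨α, q⟩ : Σ α, RegionIndex G A Aᶜ α) = ⟨α', q'⟩ := regionIndex_ext_right fun x hx' => by
    have hx := Finset.mem_compl.1 hx'
    constructor
    · rw [← allSpins_of_not_mem hx α p.1 q.1, ← allSpins_of_not_mem hx α' p'.1 q'.1, h1]
    · rw [← allIndices_of_not_mem hx p.2 q.2, ← allIndices_of_not_mem hx p'.2 q'.2, h2]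
  cases hp
  cases hq
  rfl

theorem netIndex_surjective : Function.Surjective (netIndex G A) := by
  rintro ⟨⟨k, m⟩, hm⟩
  have hm' : Admissible k m := hm
  have hk : ∀ l, allSpins G A (fun l => k l.1) (fun l => k l.1) (fun l => k l.1) l = k l := by
    intro l
    by_cases h : G.node (l, true) ∈ A
    · rw [allSpins_of_mem (x := (l, true)) h]
      by_cases h1 : G.IsInner A l
      · rw [regionSpins_inner h1]
      · rw [regionSpins_cut h1 (isCut_of_mem (x := (l, true)) h h1)]
    · rw [allSpins_of_not_mem (x := (l, true)) h]
      by_cases h1 : G.IsInner Aᶜ l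
      · rw [regionSpins_inner h1]
      · rw [regionSpins_cut h1 (isCut_of_not_mem (x := (l, true)) h h1)]
  refine ⟨⟨fun l => k l.1, ⟨fun l => k l.1, fun x => ⟨m x.1, ?_⟩⟩,
    ⟨fun l => k l.1, fun x => ⟨m x.1, ?_⟩⟩⟩, ?_⟩
  · rw [← allSpins_of_mem x.2 _ _ fun l => k l.1, hk]
    exact Nat.lt_succ_iff.2 (hm' x.1)
  · rw [← allSpins_of_not_mem (Finset.mem_compl.1 x.2) _ fun l => k l.1, hk]
    exact Nat.lt_succ_iff.2 (hm' x.1)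
  · refine Subtype.ext (Prod.ext (funext hk) (funext fun x => ?_))
    by_cases hx : G.node x ∈ A
    · exact allIndices_of_mem hx _ _
    · exact allIndices_of_not_mem hx _ _

variable (G A) in
/-- The orthonormal basis of spin network functions. -/
def netBasis (s : Σ α, RegionIndex G A A α × RegionIndex G A Aᶜ α) : HAux L :=
  netVec (netIndex G A s).1.1 (netIndex G A s).1.2

theorem orthonormal_netBasis : Orthonormal ℂ (netBasis G A) :=
  orthonormal_netVec.comp _ netIndex_injective

theorem isTotal_netBasis : IsTotal (netBasis G A) := by
  intro x hx
  refine isTotal_netVec x fun p => ?_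
  obtain ⟨s, rfl⟩ := netIndex_surjective (G := G) (A := A) p
  exact hx s

theorem inner_sum_mul {H P Q : Type*} [NormedAddCommGroup H] [InnerProductSpace ℂ H] [Fintype P]
    [Fintype Q] {e : P × Q → H} (he : Orthonormal ℂ e) (v v' : EuclideanSpace ℂ P)
    (w w' : EuclideanSpace ℂ Q) :
    inner ℂ (∑ m, (v m.1 * w m.2) • e m) (∑ m, (v' m.1 * w' m.2) • e m) =
      inner ℂ v v' * inner ℂ w w' := by
  rw [he.inner_sum, Fintype.sum_prod_type, PiLp.inner_apply, PiLp.inner_apply,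
    Finset.sum_mul_sum]
  refine Finset.sum_congr rfl fun p _ => Finset.sum_congr rfl fun q _ => ?_
  simp only [map_mul, RCLike.inner_apply]
  ring

variable (α : BoundarySpins G A) (jA : InnerSpins G A) (jB : InnerSpins G Aᶜ)

/-- The spin network state of tensors at the nodes of the two regions. -/
def spinNetworkVec (v : RegionSpace G A (regionSpins G A A α jA))
    (w : RegionSpace G Aᶜ (regionSpins G A Aᶜ α jB)) : HAux L :=
  ∑ m : MagneticIndex G A (regionSpins G A A α jA) ×
    MagneticIndex G Aᶜ (regionSpins G A Aᶜ α jB),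
    (v m.1 * w m.2) • netBasis G A ⟨α, ⟨jA, m.1⟩, ⟨jB, m.2⟩⟩

theorem coeFn_spinNetworkVec (v : RegionSpace G A (regionSpins G A A α jA))
    (w : RegionSpace G Aᶜ (regionSpins G A Aᶜ α jB)) :
    spinNetworkVec α jA jB v w =ᵐ[haarPi L] spinNetworkFun G A α jA jB v w := by
  have h1 : spinNetworkVec α jA jB v w = ContinuousMap.toLp 2 (haarPi L) ℂ
      (∑ m : MagneticIndex G A (regionSpins G A A α jA) ×
        MagneticIndex G Aᶜ (regionSpins G A Aᶜ α jB), (v m.1 * w m.2) •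
          netC (allSpins G A α jA jB) (allIndices G A m.1 m.2)) := by
    simp only [map_sum, map_smul]
    rfl
  rw [h1]
  refine (ContinuousMap.coeFn_toLp _ _).trans (Filter.Eventually.of_forall fun h => ?_)
  simp only [ContinuousMap.sum_apply, Fintype.sum_prod_type]
  rfl

theorem inner_spinNetworkVec (v v' : RegionSpace G A (regionSpins G A A α jA))
    (w w' : RegionSpace G Aᶜ (regionSpins G A Aᶜ α jB)) :
    inner ℂ (spinNetworkVec α jA jB v w) (spinNetworkVec α jA jB v' w') =
      inner ℂ v v' * inner ℂ w w' :=
  inner_sum_mul (orthonormal_netBasis.comp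
    (fun m : MagneticIndex G A (regionSpins G A A α jA) ×
      MagneticIndex G Aᶜ (regionSpins G A Aᶜ α jB) =>
      (⟨α, ⟨jA, m.1⟩, ⟨jB, m.2⟩⟩ : Σ α, RegionIndex G A A α × RegionIndex G A Aᶜ α)) (by
        rintro ⟨a, b⟩ ⟨a', b'⟩ h
        simpa using h)) v v' w w'

variable {α jA jB}

theorem inner_spinNetworkVec_ne {α' : BoundarySpins G A} {jA' : InnerSpins G A}
    {jB' : InnerSpins G Aᶜ}
    (h : (⟨α, jA, jB⟩ : Σ _ : BoundarySpins G A, InnerSpins G A × InnerSpins G Aᶜ) ≠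
      ⟨α', jA', jB'⟩)
    (v : RegionSpace G A (regionSpins G A A α jA))
    (w : RegionSpace G Aᶜ (regionSpins G A Aᶜ α jB))
    (v' : RegionSpace G A (regionSpins G A A α' jA'))
    (w' : RegionSpace G Aᶜ (regionSpins G A Aᶜ α' jB')) :
    inner ℂ (spinNetworkVec α jA jB v w) (spinNetworkVec α' jA' jB' v' w') = 0 := by
  rw [spinNetworkVec, spinNetworkVec, sum_inner]
  refine Finset.sum_eq_zero fun m _ => ?_
  rw [inner_sum]
  refine Finset.sum_eq_zero fun m' _ => ?_
  rw [inner_smul_left, inner_smul_right, orthonormal_netBasis.2, mul_zero, mul_zero]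
  intro h'
  exact h (congrArg (fun s : Σ α, RegionIndex G A A α × RegionIndex G A Aᶜ α =>
    (⟨s.1, s.2.1.1, s.2.2.1⟩ : Σ _ : BoundarySpins G A, InnerSpins G A × InnerSpins G Aᶜ)) h')

variable (α jA jB)

theorem spinNetworkVec_single (mA : MagneticIndex G A (regionSpins G A A α jA))
    (mB : MagneticIndex G Aᶜ (regionSpins G A Aᶜ α jB)) :
    spinNetworkVec α jA jB (EuclideanSpace.single mA 1) (EuclideanSpace.single mB 1) =
      netBasis G A ⟨α, ⟨jA, mA⟩, ⟨jB, mB⟩⟩ := by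
  rw [spinNetworkVec, Finset.sum_eq_single (mA, mB)]
  · simp
  · rintro ⟨a, b⟩ _ h
    simp only [PiLp.single_apply]
    by_cases ha : a = mA
    · have hb : b ≠ mB := fun hb => h (by rw [ha, hb])
      simp [hb]
    · simp [ha]
  · simp

theorem sum_admissibleIndices_allSpins {M : Type*} [AddCommMonoid M]
    (F : (HalfLink L → ℕ) → M) :
    ∑ m ∈ admissibleIndices (allSpins G A α jA jB), F m =
      ∑ m : MagneticIndex G A (regionSpins G A A α jA) ×
        MagneticIndex G Aᶜ (regionSpins G A Aᶜ α jB), F (allIndices G A m.1 m.2) := by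
  symm
  refine Finset.sum_bij (fun m _ => allIndices G A m.1 m.2) ?_ ?_ ?_ ?_
  · exact fun m _ => mem_admissibleIndices.2 (admissible_allIndices m.1 m.2)
  · rintro ⟨a, b⟩ _ ⟨a', b'⟩ _ h
    have := @netIndex_injective _ _ _ _ _ _ G A ⟨α, ⟨jA, a⟩, ⟨jB, b⟩⟩ ⟨α, ⟨jA, a'⟩, ⟨jB, b'⟩⟩
      (Subtype.ext (Prod.ext rfl h))
    simpa using this
  · intro m hm
    have hm' := mem_admissibleIndices.1 hm
    refine ⟨(fun x => ⟨m x.1, ?_⟩, fun x => ⟨m x.1, ?_⟩), Finset.mem_univ _, funext fun x => ?_⟩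
    · rw [← allSpins_of_mem x.2 _ _ jB]
      exact Nat.lt_succ_iff.2 (hm' x.1)
    · rw [← allSpins_of_not_mem (Finset.mem_compl.1 x.2) _ jA]
      exact Nat.lt_succ_iff.2 (hm' x.1)
    · by_cases hx : G.node x ∈ A
      · exact allIndices_of_mem hx _ _
      · exact allIndices_of_not_mem hx _ _
  · exact fun _ _ => rfl

theorem prod_halfLinkRep_allSpins (g : HalfLink L → SU2)
    (a a' : MagneticIndex G A (regionSpins G A A α jA))
    (b b' : MagneticIndex G Aᶜ (regionSpins G A Aᶜ α jB)) :
    ∏ x, halfLinkRep (allSpins G A α jA jB) x (g x) (allIndices G A a b x)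
      (allIndices G A a' b' x) =
      (∏ x, halfLinkRep (regionSpins G A A α jA) x.1 (g x.1) (a x) (a' x)) *
        ∏ x, halfLinkRep (regionSpins G A Aᶜ α jB) x.1 (g x.1) (b x) (b' x) := by
  rw [← Fintype.prod_subtype_mul_prod_subtype (fun x => G.node x ∈ A)]
  congr 1
  · refine Finset.prod_congr rfl fun x _ => ?_
    rw [allIndices_of_mem x.2, allIndices_of_mem x.2, halfLinkRep, halfLinkRep,
      allSpins_of_mem x.2]
  · refine Fintype.prod_equiv (Equiv.subtypeEquivRight fun x => Finset.mem_compl.symm) _ _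
      fun x => ?_
    rw [allIndices_of_not_mem x.2, allIndices_of_not_mem x.2, halfLinkRep, halfLinkRep,
      allSpins_of_not_mem x.2]
    rfl

theorem translation_spinNetworkVec (g : HalfLink L → SU2)
    (v : RegionSpace G A (regionSpins G A A α jA))
    (w : RegionSpace G Aᶜ (regionSpins G A Aᶜ α jB)) :
    translation g (spinNetworkVec α jA jB v w) =
      spinNetworkVec α jA jB (regionAction G A _ g v) (regionAction G Aᶜ _ g w) := by
  have h1 : ∀ m : MagneticIndex G A (regionSpins G A A α jA) ×
      MagneticIndex G Aᶜ (regionSpins G A Aᶜ α jB),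
      translation g (netBasis G A ⟨α, ⟨jA, m.1⟩, ⟨jB, m.2⟩⟩) =
        ∑ m' : MagneticIndex G A (regionSpins G A A α jA) ×
          MagneticIndex G Aᶜ (regionSpins G A Aᶜ α jB),
          ((∏ x, halfLinkRep (regionSpins G A A α jA) x.1 (g x.1) (m'.1 x) (m.1 x)) *
          ∏ x, halfLinkRep (regionSpins G A Aᶜ α jB) x.1 (g x.1) (m'.2 x) (m.2 x)) •
          netBasis G A ⟨α, ⟨jA, m'.1⟩, ⟨jB, m'.2⟩⟩ := by
    intro m
    refine (translation_netVec (admissible_allIndices m.1 m.2) g).trans ?_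
    rw [sum_admissibleIndices_allSpins]
    refine Finset.sum_congr rfl fun m' _ => ?_
    rw [prod_halfLinkRep_allSpins]
    rfl
  rw [spinNetworkVec, map_sum]
  simp only [map_smul, h1, Finset.smul_sum, smul_smul]
  rw [Finset.sum_comm, spinNetworkVec]
  refine Finset.sum_congr rfl fun m' _ => ?_
  rw [← Finset.sum_smul, regionAction_apply, regionAction_apply, Finset.sum_mul_sum,
    Fintype.sum_prod_type]
  congr 1
  exact Finset.sum_congr rfl fun a _ => Finset.sum_congr rfl fun b _ => by ring

theorem mem_HInv {ψ : HAux L} :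
    ψ ∈ HInv G ↔ ∀ g : N → SU2, translation (g ∘ G.node) ψ = ψ := by
  simp [HInv, sub_eq_zero]

theorem spinNetworkVec_mem_HInv {v : RegionSpace G A (regionSpins G A A α jA)}
    {w : RegionSpace G Aᶜ (regionSpins G A Aᶜ α jB)} (hv : v ∈ regionIntertwiners G A _)
    (hw : w ∈ regionIntertwiners G Aᶜ _) : spinNetworkVec α jA jB v w ∈ HInv G :=
  mem_HInv.2 fun g => by
    rw [translation_spinNetworkVec, regionAction_of_mem hv, regionAction_of_mem hw]

theorem spinNetworkVec_add_left (v v' : RegionSpace G A (regionSpins G A A α jA))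
    (w : RegionSpace G Aᶜ (regionSpins G A Aᶜ α jB)) :
    spinNetworkVec α jA jB (v + v') w =
      spinNetworkVec α jA jB v w + spinNetworkVec α jA jB v' w := by
  simp [spinNetworkVec, add_mul, add_smul, Finset.sum_add_distrib]

theorem spinNetworkVec_smul_left (c : ℂ) (v : RegionSpace G A (regionSpins G A A α jA))
    (w : RegionSpace G Aᶜ (regionSpins G A Aᶜ α jB)) :
    spinNetworkVec α jA jB (c • v) w = c • spinNetworkVec α jA jB v w := by
  simp [spinNetworkVec, Finset.smul_sum, smul_smul, mul_assoc]

theorem spinNetworkVec_add_right (v : RegionSpace G A (regionSpins G A A α jA))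
    (w w' : RegionSpace G Aᶜ (regionSpins G A Aᶜ α jB)) :
    spinNetworkVec α jA jB v (w + w') =
      spinNetworkVec α jA jB v w + spinNetworkVec α jA jB v w' := by
  simp [spinNetworkVec, mul_add, add_smul, Finset.sum_add_distrib]

theorem spinNetworkVec_smul_right (c : ℂ) (v : RegionSpace G A (regionSpins G A A α jA))
    (w : RegionSpace G Aᶜ (regionSpins G A Aᶜ α jB)) :
    spinNetworkVec α jA jB v (c • w) = c • spinNetworkVec α jA jB v w := by
  simp [spinNetworkVec, Finset.smul_sum, smul_smul, mul_left_comm]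

variable (G A) in
theorem isTotal_spinNetworkVec :
    IsTotal fun s : Σ t : (Σ _ : BoundarySpins G A, InnerSpins G A × InnerSpins G Aᶜ),
      RegionSpace G A (regionSpins G A A t.1 t.2.1) ×
        RegionSpace G Aᶜ (regionSpins G A Aᶜ t.1 t.2.2) =>
      spinNetworkVec s.1.1 s.1.2.1 s.1.2.2 s.2.1 s.2.2 := by
  intro x hx
  refine isTotal_netBasis (G := G) (A := A) x ?_
  rintro ⟨α, ⟨jA, mA⟩, ⟨jB, mB⟩⟩
  rw [← spinNetworkVec_single]
  exact hx ⟨⟨α, jA, jB⟩, _, _⟩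

-- For a gauge invariant `x`, the functional `v ↦ ⟨x, spinNetworkVec v w⟩` is invariant when `w` is,
-- so `region_functional_eq_zero` extends orthogonality from intertwiners to all `v`. The same
-- argument in the other factor makes `x` orthogonal to every spin network.
variable (G A) in
theorem isTotal_spinNetworkVec_intertwiners :
    IsTotal fun s : Σ t : (Σ _ : BoundarySpins G A, InnerSpins G A × InnerSpins G Aᶜ),
      regionIntertwiners G A (regionSpins G A A t.1 t.2.1) ×
        regionIntertwiners G Aᶜ (regionSpins G A Aᶜ t.1 t.2.2) =>
      (⟨spinNetworkVec s.1.1 s.1.2.1 s.1.2.2 s.2.1.1 s.2.2.1,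
        spinNetworkVec_mem_HInv _ _ _ s.2.1.2 s.2.2.2⟩ : HInv G) := by
  rintro ⟨x, hx⟩ h0
  have hinv : ∀ (g : N → SU2) ψ, inner ℂ x (translation (g ∘ G.node) ψ) = inner ℂ x ψ := by
    intro g ψ
    rw [← inner_translation (g ∘ G.node) x ψ, mem_HInv.1 hx g]
  refine Subtype.ext (isTotal_spinNetworkVec G A x ?_)
  rintro ⟨⟨α, jA, jB⟩, v, w⟩
  have h0' : ∀ v ∈ regionIntertwiners G A (regionSpins G A A α jA),
      ∀ w ∈ regionIntertwiners G Aᶜ (regionSpins G A Aᶜ α jB),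
      inner ℂ x (spinNetworkVec α jA jB v w) = 0 := fun v hv w hw =>
    inner_eq_zero_symm.1 (h0 ⟨⟨α, jA, jB⟩, ⟨v, hv⟩, ⟨w, hw⟩⟩)
  have h1 : ∀ v, ∀ w ∈ regionIntertwiners G Aᶜ (regionSpins G A Aᶜ α jB),
      inner ℂ x (spinNetworkVec α jA jB v w) = 0 := by
    intro v w hw
    let f : RegionSpace G A (regionSpins G A A α jA) →ₗ[ℂ] ℂ :=
      { toFun v := inner ℂ x (spinNetworkVec α jA jB v w)
        map_add' v v' := by rw [spinNetworkVec_add_left, inner_add_right]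
        map_smul' c v := by rw [spinNetworkVec_smul_left, inner_smul_right]; rfl }
    have hf : f = 0 := by
      refine region_functional_eq_zero f (fun g v => ?_) fun v hv => h0' v hv w hw
      change inner ℂ x _ = inner ℂ x _
      rw [← hinv g (spinNetworkVec α jA jB v w), translation_spinNetworkVec,
        regionAction_of_mem hw]
    exact DFunLike.congr_fun hf v
  let f : RegionSpace G Aᶜ (regionSpins G A Aᶜ α jB) →ₗ[ℂ] ℂ :=
    { toFun w := inner ℂ x (spinNetworkVec α jA jB v w)
      map_add' w w' := by rw [spinNetworkVec_add_right, inner_add_right]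
      map_smul' c w := by rw [spinNetworkVec_smul_right, inner_smul_right]; rfl }
  have hf : f = 0 := by
    refine region_functional_eq_zero f (fun g w => ?_) fun w hw => h1 v w hw
    change inner ℂ x _ = inner ℂ x _
    -- The gauge transformation is made trivial on `A`, because `v` is no longer assumed invariant
    -- at this point.
    let g' : N → SU2 := fun n => if n ∈ A then 1 else g n
    rw [← hinv g' (spinNetworkVec α jA jB v w), translation_spinNetworkVec,
      regionAction_eq_self (g := g' ∘ G.node) fun x hx => if_pos hx,
      regionAction_congr (g := g' ∘ G.node) (g' := g ∘ G.node)
        fun x hx => if_neg (Finset.mem_compl.1 hx)]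
  exact inner_eq_zero_symm.1 (DFunLike.congr_fun hf w)

end SpinNetworks

end LQG

end

noncomputable section

namespace LQG

/-! ### The algebra of holonomies and fluxes as an algebra of block operators -/

theorem exists_unitary_sectors_symm {ι : Type*} [DecidableEq ι] {P Q : ι → Type*}
    [∀ i, DecidableEq (P i)] [∀ i, DecidableEq (Q i)] {E : ∀ i, P i → Type*}
    {F : ∀ i, Q i → Type*} [∀ i p, NormedAddCommGroup (E i p)]
    [∀ i p, InnerProductSpace ℂ (E i p)] [∀ i q, NormedAddCommGroup (F i q)]
    [∀ i q, InnerProductSpace ℂ (F i q)] {H : Type*} [NormedAddCommGroup H]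
    [InnerProductSpace ℂ H] [CompleteSpace H] [∀ i p, CompleteSpace (E i p)]
    [∀ i q, CompleteSpace (F i q)] (y : ∀ i p q, E i p → F i q → H)
    (h_same : ∀ i p q v w v' w', inner ℂ (y i p q v w) (y i p q v' w') =
      inner ℂ v v' * inner ℂ w w')
    (h_ne : ∀ i p q i' p' q' v w v' w',
      (⟨i, p, q⟩ : Σ i, P i × Q i) ≠ ⟨i', p', q'⟩ →
      inner ℂ (y i p q v w) (y i' p' q' v' w') = 0)
    (h_total : IsTotal fun s : Σ t : (Σ i, P i × Q i), E t.1 t.2.1 × F t.1 t.2.2 =>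
      y s.1.1 s.1.2.1 s.1.2.2 s.2.1 s.2.2) :
    ∃ U : H ≃ₗᵢ[ℂ] lp (fun i => HilbertTensor (lp (E i) 2) (lp (F i) 2)) 2, ∀ i p q v w,
      U.symm (lp.single 2 i (pureTensor (lp.single 2 p v) (lp.single 2 q w))) = y i p q v w := by
  obtain ⟨U, hU⟩ := exists_unitary_sectors y h_same h_ne h_total
  refine ⟨U, fun i p q v w => ?_⟩
  rw [← hU, U.symm_apply_apply]

theorem exists_tensorDecomp {ι : Type*} [DecidableEq ι] {P Q : ι → Type*}
    [∀ i, DecidableEq (P i)] [∀ i, DecidableEq (Q i)] {E : ∀ i, P i → Type*}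
    {F : ∀ i, Q i → Type*} [∀ i p, NormedAddCommGroup (E i p)]
    [∀ i p, InnerProductSpace ℂ (E i p)] [∀ i q, NormedAddCommGroup (F i q)]
    [∀ i q, InnerProductSpace ℂ (F i q)] {H : Type*} [NormedAddCommGroup H]
    [InnerProductSpace ℂ H] [CompleteSpace H] [∀ i p, CompleteSpace (E i p)]
    [∀ i q, CompleteSpace (F i q)] (y : ∀ i p q, E i p → F i q → H)
    (h_same : ∀ i p q v w v' w', inner ℂ (y i p q v w) (y i p q v' w') =
      inner ℂ v v' * inner ℂ w w')
    (h_ne : ∀ i p q i' p' q' v w v' w',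
      (⟨i, p, q⟩ : Σ i, P i × Q i) ≠ ⟨i', p', q'⟩ →
      inner ℂ (y i p q v w) (y i' p' q' v' w') = 0)
    (h_total : IsTotal fun s : Σ t : (Σ i, P i × Q i), E t.1 t.2.1 × F t.1 t.2.2 =>
      y s.1.1 s.1.2.1 s.1.2.2 s.2.1 s.2.2) :
    ∃ τ : TensorDecomp (fun i => lp (E i) 2) (fun i => lp (F i) 2) H, ∀ i p q v w,
      τ.tmul i (lp.single 2 p v) (lp.single 2 q w) = y i p q v w := by
  obtain ⟨U, hU⟩ := exists_unitary_sectors_symm y h_same h_ne h_total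
  exact ⟨(sectorDecomp _ _).map U.symm, hU⟩

section Full

variable {N L : Type*} [Fintype N] [DecidableEq N] [Fintype L] [DecidableEq L]
  (G : OrientedGraph N L) (A : Finset N)

/-- The Hilbert space direct sum over the spins on the links inside `R` of the tensors at the nodes
in `R`. -/
abbrev HRegionAux (R : Finset N) (α : BoundarySpins G A) : Type _ :=
  lp (fun j : InnerSpins G R => RegionSpace G R (regionSpins G A R α j)) 2

/-- The standard orthonormal basis of the space of a region. -/
def regionBasis (R : Finset N) (α : BoundarySpins G A) (p : RegionIndex G A R α) :
    HRegionAux G A R α :=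
  lp.single 2 p.1 (EuclideanSpace.single p.2 (1 : ℂ))

theorem isTotal_regionBasis (R : Finset N) (α : BoundarySpins G A) :
    IsTotal (regionBasis G A R α) := by
  have h := isTotal_lp_single
    (E := fun j : InnerSpins G R => RegionSpace G R (regionSpins G A R α j))
    (a := fun j (m : MagneticIndex G R (regionSpins G A R α j)) => EuclideanSpace.single m (1 : ℂ))
    fun j x hx => by
      ext m
      have h := hx m
      rw [EuclideanSpace.inner_single_left] at h
      simpa using h
  exact h

theorem orthonormal_regionBasis (R : Finset N) (α : BoundarySpins G A) :
    Orthonormal ℂ (regionBasis G A R α) := by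
  classical
  rw [orthonormal_iff_ite]
  rintro ⟨j, m⟩ ⟨j', m'⟩
  rw [regionBasis, regionBasis, lp.inner_single_left]
  by_cases h : j = j'
  · subst h
    rw [lp.single_apply_self, EuclideanSpace.inner_single_left, PiLp.single_apply]
    simp
  · rw [lp.single_apply_ne _ _ _ h, inner_zero_right, if_neg]
    intro h'
    exact h (congrArg Sigma.fst h')

variable {G A} in
/-- The presentation `τ` of the auxiliary Hilbert space is the one given by the spin networks. -/
def IsSpinNetworkDecomp (τ : TensorDecomp (HRegionAux G A A) (HRegionAux G A Aᶜ) (HAux L)) : Prop :=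
  ∀ (α : BoundarySpins G A) (jA : InnerSpins G A) (jB : InnerSpins G Aᶜ)
    (v : RegionSpace G A (regionSpins G A A α jA))
    (w : RegionSpace G Aᶜ (regionSpins G A Aᶜ α jB)),
    τ.tmul α (lp.single 2 jA v) (lp.single 2 jB w) = spinNetworkVec α jA jB v w

theorem exists_isSpinNetworkDecomp :
    ∃ τ : TensorDecomp (HRegionAux G A A) (HRegionAux G A Aᶜ) (HAux L), IsSpinNetworkDecomp τ :=
  exists_tensorDecomp
    (E := fun (α : BoundarySpins G A) (j : InnerSpins G A) =>
      RegionSpace G A (regionSpins G A A α j))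
    (F := fun (α : BoundarySpins G A) (j : InnerSpins G Aᶜ) =>
      RegionSpace G Aᶜ (regionSpins G A Aᶜ α j))
    (fun α jA jB v w => spinNetworkVec α jA jB v w)
    (fun α jA jB v w v' w' => inner_spinNetworkVec α jA jB v v' w w')
    (fun _ _ _ _ _ _ v w v' w' h => inner_spinNetworkVec_ne h v w v' w')
    (isTotal_spinNetworkVec G A)

variable {G A} in
/-- The unitary map `U` is the one given by the spin networks. -/
def IsSpinNetworkUnitary (U : HInv G ≃ₗᵢ[ℂ] HSectors G A) : Prop :=
  ∀ (α : BoundarySpins G A) (jA : InnerSpins G A) (jB : InnerSpins G Aᶜ)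
    (v : regionIntertwiners G A (regionSpins G A A α jA))
    (w : regionIntertwiners G Aᶜ (regionSpins G A Aᶜ α jB)),
    U.symm (sectorTensor G A α (lp.single 2 jA v) (lp.single 2 jB w)) =
      ⟨spinNetworkVec α jA jB v.1 w.1, spinNetworkVec_mem_HInv _ _ _ v.2 w.2⟩

theorem exists_isSpinNetworkUnitary :
    ∃ U : HInv G ≃ₗᵢ[ℂ] HSectors G A, IsSpinNetworkUnitary U :=
  exists_unitary_sectors_symm
    (E := fun (α : BoundarySpins G A) (j : InnerSpins G A) =>
      regionIntertwiners G A (regionSpins G A A α j))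
    (F := fun (α : BoundarySpins G A) (j : InnerSpins G Aᶜ) =>
      regionIntertwiners G Aᶜ (regionSpins G A Aᶜ α j))
    (fun α jA jB v w => (⟨spinNetworkVec α jA jB v.1 w.1,
      spinNetworkVec_mem_HInv _ _ _ v.2 w.2⟩ : HInv G))
    (fun α jA jB v w v' w' => inner_spinNetworkVec α jA jB v.1 v'.1 w.1 w'.1)
    (fun _ _ _ _ _ _ v w v' w' h => inner_spinNetworkVec_ne h v.1 w.1 v'.1 w'.1)
    (isTotal_spinNetworkVec_intertwiners G A)

variable {G A}

/-- The half-links of the complement include one end of each cut link, so preserving the labels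
there also means preserving the boundary spins `α`. -/
theorem inner_netBasis_eq_zero_right {T : HAux L →L[ℂ] HAux L} (hT : CommutesWithRegion G Aᶜ T)
    {α α' : BoundarySpins G A} (p : RegionIndex G A A α) (p' : RegionIndex G A A α')
    (q : RegionIndex G A Aᶜ α) (q' : RegionIndex G A Aᶜ α')
    (h : (⟨α, q⟩ : Σ α, RegionIndex G A Aᶜ α) ≠ ⟨α', q'⟩) :
    inner ℂ (netBasis G A ⟨α, p, q⟩) (T (netBasis G A ⟨α', p', q'⟩)) = 0 := by
  refine inner_netVec_eq_zero hT.2 (netIndex G A _).2 (netIndex G A _).2 ?_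
  by_contra! hcon
  refine h (regionIndex_ext_right fun x hx => ?_)
  have hx' := Finset.mem_compl.1 hx
  obtain ⟨h1, h2⟩ := hcon x hx
  constructor
  · rw [← allSpins_of_not_mem hx' α p.1 q.1, ← allSpins_of_not_mem hx' α' p'.1 q'.1]
    exact h1
  · rw [← allIndices_of_not_mem hx' p.2 q.2, ← allIndices_of_not_mem hx' p'.2 q'.2]
    exact h2

theorem inner_netBasis_eq_zero_left {T : HAux L →L[ℂ] HAux L} (hT : CommutesWithRegion G A T)
    {α α' : BoundarySpins G A} (p : RegionIndex G A A α) (p' : RegionIndex G A A α')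
    (q : RegionIndex G A Aᶜ α) (q' : RegionIndex G A Aᶜ α')
    (h : (⟨α, p⟩ : Σ α, RegionIndex G A A α) ≠ ⟨α', p'⟩) :
    inner ℂ (netBasis G A ⟨α, p, q⟩) (T (netBasis G A ⟨α', p', q'⟩)) = 0 := by
  refine inner_netVec_eq_zero hT.2 (netIndex G A _).2 (netIndex G A _).2 ?_
  by_contra! hcon
  refine h (regionIndex_ext_left fun x hx => ?_)
  obtain ⟨h1, h2⟩ := hcon x hx
  constructor
  · rw [← allSpins_of_mem hx α p.1 q.1, ← allSpins_of_mem hx α' p'.1 q'.1]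
    exact h1
  · rw [← allIndices_of_mem hx p.2 q.2, ← allIndices_of_mem hx p'.2 q'.2]
    exact h2

theorem allSpins_congr_right {α : BoundarySpins G A} {jA : InnerSpins G A}
    (jB jB' : InnerSpins G Aᶜ) {l : L} (hl : ¬ G.IsInner Aᶜ l) :
    allSpins G A α jA jB l = allSpins G A α jA jB' l := by
  unfold allSpins
  split_ifs
  · rfl
  · unfold regionSpins
    rw [dif_neg hl, dif_neg hl]

theorem allSpins_congr_left {α : BoundarySpins G A} (jA jA' : InnerSpins G A)
    {jB : InnerSpins G Aᶜ} {l : L} (hl : ¬ G.IsInner A l) :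
    allSpins G A α jA jB l = allSpins G A α jA' jB l := by
  unfold allSpins
  rw [if_neg hl, if_neg hl]

theorem inner_netBasis_congr_right {T : HAux L →L[ℂ] HAux L} (hT : CommutesWithRegion G Aᶜ T)
    {α : BoundarySpins G A} (p p' : RegionIndex G A A α) (q q' : RegionIndex G A Aᶜ α) :
    inner ℂ (netBasis G A ⟨α, p, q⟩) (T (netBasis G A ⟨α, p', q⟩)) =
      inner ℂ (netBasis G A ⟨α, p, q'⟩) (T (netBasis G A ⟨α, p', q'⟩)) := by
  have key : ∀ q : RegionIndex G A Aᶜ α, ∀ x, G.node x ∈ Aᶜ →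
      allSpins G A α p.1 q.1 x.1 = allSpins G A α p'.1 q.1 x.1 ∧
      allIndices G A p.2 q.2 x = allIndices G A p'.2 q.2 x := fun q x hx => by
    have hx' := Finset.mem_compl.1 hx
    rw [allSpins_of_not_mem hx', allSpins_of_not_mem hx', allIndices_of_not_mem hx',
      allIndices_of_not_mem hx']
    exact ⟨rfl, rfl⟩
  refine inner_netVec_congr hT (netIndex G A _).2 (netIndex G A _).2 (netIndex G A _).2
    (netIndex G A _).2 (key q) (key q') ?_ ?_ ?_ ?_
  · exact fun l hl => allSpins_congr_right _ _ hl
  · exact fun l hl => allSpins_congr_right _ _ hl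
  · intro x hx
    have hx' := not_not.1 (fun h => hx (Finset.mem_compl.2 h))
    exact (allIndices_of_mem hx' _ _).trans (allIndices_of_mem hx' _ _).symm
  · intro x hx
    have hx' := not_not.1 (fun h => hx (Finset.mem_compl.2 h))
    exact (allIndices_of_mem hx' _ _).trans (allIndices_of_mem hx' _ _).symm

theorem inner_netBasis_congr_left {T : HAux L →L[ℂ] HAux L} (hT : CommutesWithRegion G A T)
    {α : BoundarySpins G A} (p p' : RegionIndex G A A α) (q q' : RegionIndex G A Aᶜ α) :
    inner ℂ (netBasis G A ⟨α, p, q⟩) (T (netBasis G A ⟨α, p, q'⟩)) =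
      inner ℂ (netBasis G A ⟨α, p', q⟩) (T (netBasis G A ⟨α, p', q'⟩)) := by
  have key : ∀ p : RegionIndex G A A α, ∀ x, G.node x ∈ A →
      allSpins G A α p.1 q.1 x.1 = allSpins G A α p.1 q'.1 x.1 ∧
      allIndices G A p.2 q.2 x = allIndices G A p.2 q'.2 x := fun p x hx => by
    rw [allSpins_of_mem hx, allSpins_of_mem hx, allIndices_of_mem hx, allIndices_of_mem hx]
    exact ⟨rfl, rfl⟩
  refine inner_netVec_congr hT (netIndex G A _).2 (netIndex G A _).2 (netIndex G A _).2
    (netIndex G A _).2 (key p) (key p') ?_ ?_ ?_ ?_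
  · exact fun l hl => allSpins_congr_left _ _ hl
  · exact fun l hl => allSpins_congr_left _ _ hl
  · exact fun x hx => (allIndices_of_not_mem hx _ _).trans (allIndices_of_not_mem hx _ _).symm
  · exact fun x hx => (allIndices_of_not_mem hx _ _).trans (allIndices_of_not_mem hx _ _).symm

variable {τ : TensorDecomp (HRegionAux G A A) (HRegionAux G A Aᶜ) (HAux L)}

theorem tmul_regionBasis (hτ : IsSpinNetworkDecomp τ)
    (α : BoundarySpins G A) (p : RegionIndex G A A α) (q : RegionIndex G A Aᶜ α) :
    τ.tmul α (regionBasis G A A α p) (regionBasis G A Aᶜ α q) = netBasis G A ⟨α, p, q⟩ := by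
  rw [regionBasis, regionBasis, hτ, spinNetworkVec_single]

/-- The criterion `isBlock_of_entries` asks for exactly what commutation gives: `α` and the labels
of the complement are preserved, and the entries do not depend on the latter within a sector. -/
theorem isBlock_of_commutesWithRegion (hτ : IsSpinNetworkDecomp τ)
    {T : HAux L →L[ℂ] HAux L} (hT : CommutesWithRegion G Aᶜ T) : τ.IsBlock T := by
  refine τ.isBlock_of_entries (regionBasis G A A) (isTotal_regionBasis G A A)
    (regionBasis G A Aᶜ) (isTotal_regionBasis G A Aᶜ) (orthonormal_regionBasis G A Aᶜ) ?_ ?_ ?_ ?_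
  · simp only [tmul_regionBasis hτ]
    exact isTotal_netBasis
  · intro α α' p p' q q' h
    rw [tmul_regionBasis hτ, tmul_regionBasis hτ]
    exact inner_netBasis_eq_zero_right hT _ _ _ _ fun h' => h (congrArg Sigma.fst h')
  · intro α p p' q q' h
    rw [tmul_regionBasis hτ, tmul_regionBasis hτ]
    exact inner_netBasis_eq_zero_right hT _ _ _ _ fun h' => h (by simpa using h')
  · intro α p p' q q'
    rw [tmul_regionBasis hτ, tmul_regionBasis hτ, tmul_regionBasis hτ, tmul_regionBasis hτ]
    exact inner_netBasis_congr_right hT _ _ _ _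

theorem isBlock_flip_of_commutesWithRegion (hτ : IsSpinNetworkDecomp τ)
    {T : HAux L →L[ℂ] HAux L} (hT : CommutesWithRegion G A T) : τ.flip.IsBlock T := by
  refine τ.flip.isBlock_of_entries (regionBasis G A Aᶜ) (isTotal_regionBasis G A Aᶜ)
    (regionBasis G A A) (isTotal_regionBasis G A A) (orthonormal_regionBasis G A A) ?_ ?_ ?_ ?_
  · simp only [TensorDecomp.flip_tmul, tmul_regionBasis hτ]
    intro x hx
    exact isTotal_netBasis (G := G) (A := A) x fun ⟨α, p, q⟩ => hx ⟨α, q, p⟩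
  · intro α α' p p' q q' h
    rw [TensorDecomp.flip_tmul, TensorDecomp.flip_tmul, tmul_regionBasis hτ, tmul_regionBasis hτ]
    exact inner_netBasis_eq_zero_left hT _ _ _ _ fun h' => h (congrArg Sigma.fst h')
  · intro α p p' q q' h
    rw [TensorDecomp.flip_tmul, TensorDecomp.flip_tmul, tmul_regionBasis hτ, tmul_regionBasis hτ]
    exact inner_netBasis_eq_zero_left hT _ _ _ _ fun h' => h (by simpa using h')
  · intro α p p' q q'
    simp only [TensorDecomp.flip_tmul, tmul_regionBasis hτ]
    exact inner_netBasis_congr_left hT _ _ _ _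

/-- The weak closure of the algebra of holonomies and fluxes in `A` consists of the operators
`⨁ O_α ⊗ 1`. -/
theorem mem_algHolFlux_iff (hτ : IsSpinNetworkDecomp τ)
    {T : HAux L →L[ℂ] HAux L} : T ∈ algHolFlux G A ↔ τ.IsBlock T := by
  constructor
  · intro hT
    exact isBlock_of_commutesWithRegion hτ
      (commutesWithRegion_of_mem_algHolFlux disjoint_compl_right hT)
  · intro hT
    -- Whatever commutes with the generators of `A` is of the form `⨁ 1 ⊗ P_α`, so a block operator
    -- lies in the bicommutant.
    exact mem_algHolFlux_of_commute fun S hS =>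
      τ.commute_of_isBlock hT (isBlock_flip_of_commutesWithRegion hτ hS)

end Full

end LQG

end

noncomputable section

namespace LQG

/-! ### Compression of block operators to a subspace -/

/-- The compressions of the operators `⨁ O_i ⊗ 1` to a subspace which is a direct sum of tensor
products of subspaces. -/
theorem TensorDecomp.isBlock_iff_exists_compression {ι : Type*} {K J K' J' : ι → Type*}
    [∀ i, NormedAddCommGroup (K i)] [∀ i, InnerProductSpace ℂ (K i)]
    [∀ i, NormedAddCommGroup (J i)] [∀ i, InnerProductSpace ℂ (J i)]
    [∀ i, NormedAddCommGroup (K' i)] [∀ i, InnerProductSpace ℂ (K' i)]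
    [∀ i, NormedAddCommGroup (J' i)] [∀ i, InnerProductSpace ℂ (J' i)]
    [∀ i, CompleteSpace (K i)] [∀ i, CompleteSpace (K' i)] {H : Type*} [NormedAddCommGroup H]
    [InnerProductSpace ℂ H] [CompleteSpace H] {V : Submodule ℂ H} [CompleteSpace V]
    (τ : TensorDecomp K J H) (τ' : TensorDecomp K' J' V) (κ : ∀ i, K' i →ₗᵢ[ℂ] K i)
    (η : ∀ i, J' i →ₗᵢ[ℂ] J i) (h : ∀ i v w, τ.tmul i (κ i v) (η i w) = τ'.tmul i v w)
    (S : V →L[ℂ] V) :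
    τ'.IsBlock S ↔ ∃ T, τ.IsBlock T ∧ S = V.orthogonalProjectionOnto ∘L T ∘L V.subtypeL := by
  have hκ : ∀ i v, ContinuousLinearMap.adjoint (κ i).toContinuousLinearMap (κ i v) = v := by
    intro i v
    refine ext_inner_left ℂ fun x => ?_
    rw [ContinuousLinearMap.adjoint_inner_right]
    exact (κ i).inner_map_map x v
  constructor
  · rintro ⟨O, hO⟩
    classical
    -- If `J' i` is zero, `S` says nothing about `O i`, and these norms may be unbounded in `i`.
    -- Such `O i` are replaced by `0` below, which leaves `S` unchanged.
    have hle : ∀ i, (∃ w : J' i, w ≠ 0) → ‖O i‖ ≤ ‖S‖ := by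
      rintro i ⟨w, hw⟩
      refine ContinuousLinearMap.opNorm_le_bound _ S.opNorm_nonneg fun v => ?_
      have h1 := S.le_opNorm (τ'.tmul i v w)
      rw [hO, τ'.norm_tmul, τ'.norm_tmul, ← mul_assoc] at h1
      exact le_of_mul_le_mul_right h1 (norm_pos_iff.2 hw)
    obtain ⟨T, hT⟩ := τ.exists_block (fun i => if ∃ w : J' i, w ≠ 0 then
      (κ i).toContinuousLinearMap ∘L O i ∘L
        ContinuousLinearMap.adjoint (κ i).toContinuousLinearMap else 0) ‖S‖ (fun i => by
          split_ifs with hw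
          · refine (ContinuousLinearMap.opNorm_comp_le _ _).trans ?_
            have h1 : ‖(κ i).toContinuousLinearMap‖ ≤ 1 :=
              (κ i).norm_toContinuousLinearMap_le
            have h2 : ‖ContinuousLinearMap.adjoint (κ i).toContinuousLinearMap‖ ≤ 1 := by
              rwa [LinearIsometryEquiv.norm_map]
            have h3 := ContinuousLinearMap.opNorm_comp_le (O i)
              (ContinuousLinearMap.adjoint (κ i).toContinuousLinearMap)
            calc _ ≤ 1 * (‖O i‖ * 1) := mul_le_mul h1
                  (h3.trans (mul_le_mul_of_nonneg_left h2 (norm_nonneg _))) (norm_nonneg _)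
                  zero_le_one
              _ ≤ ‖S‖ := by rw [one_mul, mul_one]; exact hle i hw
          · rw [norm_zero]
            exact S.opNorm_nonneg) S.opNorm_nonneg
    refine ⟨T, ⟨_, hT⟩, τ'.total.clm_ext fun ⟨i, v, w⟩ => ?_⟩
    simp only [ContinuousLinearMap.comp_apply, Submodule.subtypeL_apply]
    rw [← h, hT]
    by_cases hw : w = 0
    · simp [hw]
    · rw [if_pos ⟨w, hw⟩]
      simp only [ContinuousLinearMap.comp_apply, LinearIsometry.coe_toContinuousLinearMap, hκ]
      rw [h, hO, Submodule.orthogonalProjectionOnto_mem_subspace_eq_self]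
  · rintro ⟨T, ⟨O, hO⟩, rfl⟩
    -- The compression of `O ⊗ 1` to a product of subspaces is `κ* O κ ⊗ 1`, because the inclusion
    -- `η` of the second factor is isometric.
    refine ⟨fun i => ContinuousLinearMap.adjoint (κ i).toContinuousLinearMap ∘L O i ∘L
      (κ i).toContinuousLinearMap, fun i v w => ?_⟩
    refine τ'.total.eq_of_inner fun ⟨i', v', w'⟩ => ?_
    simp only [ContinuousLinearMap.comp_apply, Submodule.subtypeL_apply,
      LinearIsometry.coe_toContinuousLinearMap]
    rw [Submodule.inner_orthogonalProjectionOnto_eq_of_mem_left, ← h, ← h, hO]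
    by_cases hi : i' = i
    · subst hi
      rw [τ.inner_tmul_same, τ'.inner_tmul_same, ContinuousLinearMap.adjoint_inner_right,
        LinearIsometry.inner_map_map]
      rfl
    · rw [τ.inner_tmul_ne _ _ hi, τ'.inner_tmul_ne _ _ hi]

/-! ### The inclusion of the spaces of intertwiners -/

section Inclusion

variable {P : Type*} {E : P → Type*} [∀ p, NormedAddCommGroup (E p)]
  [∀ p, InnerProductSpace ℂ (E p)]

/-- The inclusion of the direct sum of subspaces. -/
def lpInclusion (V : ∀ p, Submodule ℂ (E p)) : lp (fun p => V p) 2 →ₗᵢ[ℂ] lp E 2 where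
  toFun f := ⟨fun p => (f p : E p), by
    have h := lp.memℓp f
    change Memℓp (fun p => (f p : E p)) 2
    rw [memℓp_gen_iff (by norm_num)] at h ⊢
    exact h⟩
  map_add' _ _ := rfl
  map_smul' _ _ := rfl
  norm_map' f := by
    rw [lp.norm_eq_tsum_rpow (by norm_num), lp.norm_eq_tsum_rpow (by norm_num)]
    rfl

theorem lpInclusion_single [DecidableEq P] (V : ∀ p, Submodule ℂ (E p)) (p : P) (v : V p) :
    lpInclusion V (lp.single 2 p v) = lp.single 2 p v.1 := by
  ext q
  change ((lp.single 2 p v : lp (fun p => V p) 2) q : E q) = _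
  by_cases h : q = p
  · subst h
    rw [lp.single_apply_self, lp.single_apply_self]
  · rw [lp.single_apply_ne _ _ _ h, lp.single_apply_ne _ _ _ h]
    rfl

/-- The projection to a component of a direct sum. -/
def lpEval (p : P) : lp E 2 →L[ℂ] E p :=
  LinearMap.mkContinuous
    { toFun := fun f => f p
      map_add' := fun _ _ => rfl
      map_smul' := fun _ _ => rfl } 1 fun f => by
    rw [one_mul]
    exact lp.norm_apply_le_norm (by norm_num) f p

end Inclusion

/-! ### Block and scalar operators seen through a unitary map -/

section Sectors

variable {ι : Type*} [DecidableEq ι] {K J : ι → Type*} [∀ i, NormedAddCommGroup (K i)]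
  [∀ i, InnerProductSpace ℂ (K i)] [∀ i, NormedAddCommGroup (J i)]
  [∀ i, InnerProductSpace ℂ (J i)] [∀ i, CompleteSpace (K i)] [∀ i, CompleteSpace (J i)]
  {H : Type*} [NormedAddCommGroup H] [InnerProductSpace ℂ H] [CompleteSpace H]
  (U : H ≃ₗᵢ[ℂ] lp (fun i => HilbertTensor (K i) (J i)) 2) (T : H →L[ℂ] H)

theorem isBlock_map_symm_iff :
    ((sectorDecomp K J).map U.symm).IsBlock T ↔ ∃ O : ∀ i, K i →L[ℂ] K i, ∀ i v w,
      U (T (U.symm (lp.single 2 i (pureTensor v w)))) =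
        lp.single 2 i (pureTensor (O i v) w) := by
  refine exists_congr fun O => forall_congr' fun i => forall_congr' fun v => forall_congr' fun w => ?_
  rw [TensorDecomp.map_tmul, TensorDecomp.map_tmul, LinearIsometryEquiv.eq_symm_apply,
    sectorDecomp_tmul, sectorDecomp_tmul]

theorem isScalar_map_symm_iff :
    (∃ c : ι → ℂ, ∀ i v w, T (((sectorDecomp K J).map U.symm).tmul i v w) =
      c i • ((sectorDecomp K J).map U.symm).tmul i v w) ↔
    ∃ c : ι → ℂ, ∀ ψ i, U (T (U.symm ψ)) i = c i • ψ i := by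
  refine exists_congr fun c => ?_
  have h : ∀ i v w, T (((sectorDecomp K J).map U.symm).tmul i v w) =
      c i • ((sectorDecomp K J).map U.symm).tmul i v w ↔
      U (T (U.symm (lp.single 2 i (pureTensor v w)))) =
        c i • lp.single 2 i (pureTensor v w) := by
    intro i v w
    rw [TensorDecomp.map_tmul, ← map_smul, LinearIsometryEquiv.eq_symm_apply, sectorDecomp_tmul]
  simp only [h]
  constructor
  · intro hX ψ i
    have h1 : lpEval i ∘L (U.toContinuousLinearEquiv : H →L[ℂ]
          lp (fun i => HilbertTensor (K i) (J i)) 2) ∘L T ∘L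
        (U.symm.toContinuousLinearEquiv :
          lp (fun i => HilbertTensor (K i) (J i)) 2 →L[ℂ] H) = c i • lpEval i := by
      refine (sectorDecomp K J).total.clm_ext fun ⟨i', v, w⟩ => ?_
      change U (T (U.symm (lp.single 2 i' (pureTensor v w)))) i =
        c i • (lp.single 2 i' (pureTensor v w) : lp (fun i => HilbertTensor (K i) (J i)) 2) i
      rw [hX, lp.coeFn_smul, Pi.smul_apply]
      by_cases hi : i = i'
      · rw [hi]
      · rw [lp.single_apply_ne _ _ _ hi, smul_zero, smul_zero]
    exact DFunLike.congr_fun h1 ψ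
  · intro hX i v w
    ext1
    funext i'
    rw [hX, lp.coeFn_smul, Pi.smul_apply]
    by_cases hi : i' = i
    · rw [hi]
    · rw [lp.single_apply_ne _ _ _ hi, smul_zero, smul_zero]

theorem isTotal_self {H : Type*} [NormedAddCommGroup H] [InnerProductSpace ℂ H] :
    IsTotal fun v : H => v := fun x hx => inner_self_eq_zero.1 (hx x)

end Sectors

/-! ### The gauge invariant algebra as an algebra of block operators -/

section Compression

variable {N L : Type*} [Fintype N] [DecidableEq N] [Fintype L] [DecidableEq L]
  {G : OrientedGraph N L} {A : Finset N}

/-- The presentation of the space of gauge invariant states given by a unitary map to the direct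
sum over the boundary spins. -/
def sectorDecompOf (U : HInv G ≃ₗᵢ[ℂ] HSectors G A) :
    TensorDecomp (HRegion G A A) (HRegion G A Aᶜ) (HInv G) :=
  (sectorDecomp (HRegion G A A) (HRegion G A Aᶜ)).map U.symm

theorem sectorDecompOf_tmul (U : HInv G ≃ₗᵢ[ℂ] HSectors G A) (α : BoundarySpins G A)
    (v : HRegion G A A α) (w : HRegion G A Aᶜ α) :
    (sectorDecompOf U).tmul α v w = U.symm (sectorTensor G A α v w) := rfl

theorem isBlockOperator_conjBy_iff (U : HInv G ≃ₗᵢ[ℂ] HSectors G A) (T : HInv G →L[ℂ] HInv G) :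
    IsBlockOperator G A (conjBy G A U T) ↔ (sectorDecompOf U).IsBlock T :=
  (isBlock_map_symm_iff U T).symm

theorem isSectorScalar_conjBy_iff (U : HInv G ≃ₗᵢ[ℂ] HSectors G A) (T : HInv G →L[ℂ] HInv G) :
    IsSectorScalar G A (conjBy G A U T) ↔ ∃ c : BoundarySpins G A → ℂ, ∀ α v w,
      T ((sectorDecompOf U).tmul α v w) = c α • (sectorDecompOf U).tmul α v w :=
  (isScalar_map_symm_iff U T).symm

theorem IsSpinNetworkUnitary.isPeterWeyl {U : HInv G ≃ₗᵢ[ℂ] HSectors G A}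
    (hU : IsSpinNetworkUnitary U) : IsPeterWeyl G A U := fun α jA jB v w => by
  rw [hU]
  exact coeFn_spinNetworkVec α jA jB v.1 w.1

/-- The inclusion of the direct sum of intertwiner spaces of a region. -/
def regionInclusion (R : Finset N) (α : BoundarySpins G A) :
    HRegion G A R α →ₗᵢ[ℂ] HRegionAux G A R α :=
  lpInclusion fun j : InnerSpins G R => regionIntertwiners G R (regionSpins G A R α j)

theorem isTotal_single_intertwiners (R : Finset N) (α : BoundarySpins G A) :
    IsTotal fun p : Σ j : InnerSpins G R, regionIntertwiners G R (regionSpins G A R α j) =>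
      (lp.single 2 p.1 p.2 : HRegion G A R α) :=
  isTotal_lp_single (E := fun j : InnerSpins G R => regionIntertwiners G R (regionSpins G A R α j))
    (a := fun _ v => v) fun _ => isTotal_self

/-- Both sides are the same spin network when `v` and `w` are single intertwiners; totality and
continuity extend this to each argument in turn. -/
theorem tmul_regionInclusion {U : HInv G ≃ₗᵢ[ℂ] HSectors G A} (hU : IsSpinNetworkUnitary U)
    {τ : TensorDecomp (HRegionAux G A A) (HRegionAux G A Aᶜ) (HAux L)}
    (hτ : IsSpinNetworkDecomp τ) (α : BoundarySpins G A) (v : HRegion G A A α)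
    (w : HRegion G A Aᶜ α) :
    τ.tmul α (regionInclusion A α v) (regionInclusion Aᶜ α w) =
      (sectorDecompOf U).tmul α v w := by
  have h1 : ∀ (jA : InnerSpins G A) (v : regionIntertwiners G A (regionSpins G A A α jA)),
      τ.tmul α (regionInclusion A α (lp.single 2 jA v)) ∘L
        (regionInclusion Aᶜ α).toContinuousLinearMap =
      (HInv G).subtypeL ∘L (sectorDecompOf U).tmul α (lp.single 2 jA v) := by
    intro jA v
    refine (isTotal_single_intertwiners Aᶜ α).clm_ext fun ⟨jB, w⟩ => ?_
    simp only [ContinuousLinearMap.comp_apply, LinearIsometry.coe_toContinuousLinearMap,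
      Submodule.subtypeL_apply]
    rw [sectorDecompOf_tmul, hU, regionInclusion, regionInclusion, lpInclusion_single,
      lpInclusion_single, hτ]
  have h2 : (τ.tmul α).flip (regionInclusion Aᶜ α w) ∘L
        (regionInclusion A α).toContinuousLinearMap =
      (HInv G).subtypeL ∘L ((sectorDecompOf U).tmul α).flip w :=
    (isTotal_single_intertwiners A α).clm_ext fun ⟨jA, v⟩ => DFunLike.congr_fun (h1 jA v) w
  exact DFunLike.congr_fun h2 v

/-- The algebra of gauge invariant operators is the algebra of the block operators. -/
theorem mem_gaugeInvAlg_iff {U : HInv G ≃ₗᵢ[ℂ] HSectors G A} (hU : IsSpinNetworkUnitary U)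
    (S : HInv G →L[ℂ] HInv G) : S ∈ gaugeInvAlg G A ↔ (sectorDecompOf U).IsBlock S := by
  obtain ⟨τ, hτ⟩ := exists_isSpinNetworkDecomp G A
  rw [TensorDecomp.isBlock_iff_exists_compression τ (sectorDecompOf U) (regionInclusion A)
    (regionInclusion Aᶜ) (tmul_regionInclusion hU hτ)]
  simp only [← mem_algHolFlux_iff hτ]
  rfl

end Compression

end LQG

end

noncomputable section

namespace LQG

/-! ### Nonzero intertwiners -/

theorem conj_entry_zero_zero (g : SU2) : conj (g.1 0 0) = g.1 1 1 := by
  have h1 : g.1.conjTranspose = g.1.adjugate := by rw [← coe_inv_SU2, coe_inv_SU2_eq_adjugate]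
  simpa [Matrix.adjugate_fin_two] using congrFun (congrFun h1 0) 0

theorem wignerD_two_zero_zero (g : SU2) : wignerD 2 0 0 g = g.1 0 0 ^ 2 := by
  simp [wignerD, Polynomial.coeff_zero_eq_eval_zero]

theorem wignerD_two_two_two (g : SU2) : wignerD 2 2 2 g = g.1 1 1 ^ 2 := by
  have h : ((Polynomial.C (g.1 0 1) + Polynomial.C (g.1 1 1) * Polynomial.X) ^ 2).coeff 2 =
      g.1 1 1 ^ 2 := by
    rw [coeff_linear_pow]
    simp
  simp [wignerD, h]

theorem wignerD_two_one_one (g : SU2) :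
    wignerD 2 1 1 g = ((2 * Complex.normSq (g.1 0 0) - 1 : ℝ) : ℂ) := by
  have hdet := (Matrix.mem_specialUnitaryGroup_iff.1 g.2).2
  rw [Matrix.det_fin_two, ← conj_entry_zero_zero, Complex.mul_conj] at hdet
  have h : ((Polynomial.C (g.1 0 0) + Polynomial.C (g.1 1 0) * Polynomial.X) *
      (Polynomial.C (g.1 0 1) + Polynomial.C (g.1 1 1) * Polynomial.X)).coeff 1 =
      g.1 0 0 * g.1 1 1 + g.1 1 0 * g.1 0 1 := by
    rw [show (Polynomial.C (g.1 0 0) + Polynomial.C (g.1 1 0) * Polynomial.X) *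
      (Polynomial.C (g.1 0 1) + Polynomial.C (g.1 1 1) * Polynomial.X) =
      Polynomial.C (g.1 0 0 * g.1 0 1) +
        Polynomial.C (g.1 0 0 * g.1 1 1 + g.1 1 0 * g.1 0 1) * Polynomial.X +
        Polynomial.C (g.1 1 0 * g.1 1 1) * Polynomial.X ^ 2 by
      simp only [map_add, map_mul]; ring]
    simp only [Polynomial.coeff_add, Polynomial.coeff_C_mul, Polynomial.coeff_C,
      Polynomial.coeff_X, Polynomial.coeff_X_pow]
    norm_num
  simp only [wignerD, Nat.choose_one_right, Nat.reduceSub, pow_one, h]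
  rw [← conj_entry_zero_zero, Complex.mul_conj]
  simp
  linear_combination -hdet

/-- Right multiplication by `J` moves the second column of `g` to the first place, and the first row
of `g` is a unit vector. -/
theorem normSq_entry_mul_rotation (g : SU2) (J : SU2) (hJ : J.1 = !![0, -1; 1, 0]) :
    Complex.normSq ((g * J).1 0 0) = 1 - Complex.normSq (g.1 0 0) := by
  have h1 : (g * J).1 0 0 = g.1 0 1 := by
    change (g.1 * J.1) 0 0 = _
    rw [hJ]
    simp [Matrix.mul_apply, Fin.sum_univ_two]
  have h2 : (g.1 * g.1.conjTranspose) 0 0 = 1 := by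
    have h : g.1 * (g⁻¹).1 = 1 := congrArg Subtype.val (mul_inv_cancel g)
    rw [coe_inv_SU2] at h
    rw [h]
    rfl
  simp only [Matrix.mul_apply, Fin.sum_univ_two, Matrix.conjTranspose_apply, RCLike.star_def,
    Complex.mul_conj] at h2
  have h3 : Complex.normSq (g.1 0 0) + Complex.normSq (g.1 0 1) = 1 := by exact_mod_cast h2
  rw [h1]
  linarith

/-- Write `t = |g₀₀|²` and `x = 2t - 1`. For even `p` the integrand is nonnegative. For odd `p`,
right translation by a quarter rotation replaces `t` by `1 - t`, which turns `t² x^p` into `x^(p+1)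
- t² x^p`; so twice the integral is that of the even power `x^(p+1)`. -/
theorem integral_sq_mul_pow_pos (p : ℕ) :
    0 < ∫ g : SU2, Complex.normSq (g.1 0 0) ^ 2 * (2 * Complex.normSq (g.1 0 0) - 1) ^ p
      ∂haarSU2 := by
  have hc : Continuous fun g : SU2 => Complex.normSq (g.1 0 0) :=
    Complex.continuous_normSq.comp (continuous_SU2_entry 0 0)
  have hint : ∀ f : SU2 → ℝ, Continuous f → Integrable f haarSU2 := fun f hf =>
    hf.integrable_of_hasCompactSupport (HasCompactSupport.of_compactSpace _)
  have hpos : ∀ f : SU2 → ℝ, Continuous f → (∀ g, 0 ≤ f g) → f 1 ≠ 0 →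
      0 < ∫ g, f g ∂haarSU2 := fun f hf h0 h1 =>
    hf.integral_pos_of_hasCompactSupport_nonneg_nonzero (HasCompactSupport.of_compactSpace _) h0 h1
  rcases Nat.even_or_odd p with hp | hp
  · refine hpos _ (by fun_prop) (fun g => mul_nonneg (sq_nonneg _) (hp.pow_nonneg _)) ?_
    simp
    norm_num
  · obtain ⟨J, hJ⟩ : ∃ J : SU2, J.1 = !![0, -1; 1, 0] :=
      ⟨su2Mk 0 1 (by simp), by simp [su2Mk]⟩
    have h1 := integral_mul_right_eq_self (μ := haarSU2)
      (fun g : SU2 => Complex.normSq (g.1 0 0) ^ 2 * (2 * Complex.normSq (g.1 0 0) - 1) ^ p) J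
    simp only [normSq_entry_mul_rotation _ J hJ] at h1
    have h2 : ∀ g : SU2, (1 - Complex.normSq (g.1 0 0)) ^ 2 *
        (2 * (1 - Complex.normSq (g.1 0 0)) - 1) ^ p =
        (2 * Complex.normSq (g.1 0 0) - 1) ^ (p + 1) -
        Complex.normSq (g.1 0 0) ^ 2 * (2 * Complex.normSq (g.1 0 0) - 1) ^ p := by
      intro g
      rw [show 2 * (1 - Complex.normSq (g.1 0 0)) - 1 = -(2 * Complex.normSq (g.1 0 0) - 1) by ring,
        hp.neg_pow]
      ring
    simp only [h2] at h1
    rw [integral_sub (hint _ (by fun_prop)) (hint _ (by fun_prop))] at h1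
    have h3 : 0 < ∫ g : SU2, (2 * Complex.normSq (g.1 0 0) - 1) ^ (p + 1) ∂haarSU2 := by
      refine hpos _ (by fun_prop) (fun g => hp.add_one.pow_nonneg _) ?_
      simp
      norm_num
    linarith

section Intertwiners

variable {N L : Type*} [DecidableEq N] [Fintype L] [DecidableEq L] {G : OrientedGraph N L}
  {k : L → ℕ} {n : N}

theorem halfLinkRep_mul (x : HalfLink L) (g h : SU2) (a b : Fin (k x.1 + 1)) :
    halfLinkRep k x (g * h) a b =
      ∑ c : Fin (k x.1 + 1), halfLinkRep k x g a c * halfLinkRep k x h c b := by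
  have ha := Nat.lt_succ_iff.1 a.2
  have hb := Nat.lt_succ_iff.1 b.2
  unfold halfLinkRep
  split_ifs
  · rw [mul_inv_rev, wignerD_mul hb ha]
    exact Finset.sum_congr rfl fun c _ => mul_comm _ _
  · exact wignerD_mul ha hb g h

theorem continuous_prod_halfLinkRep
    (a b : ∀ x : {x : HalfLink L // G.node x = n}, Fin (k x.1.1 + 1)) :
    Continuous fun g => ∏ x, halfLinkRep k x.1 g (a x) (b x) :=
  continuous_finsetProd _ fun _ _ => continuous_halfLinkRep _ _ _ _

/-- The average over `SU(2)` of a basis vector is an intertwiner. -/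
theorem exists_intertwiner_ne_zero
    (m : ∀ x : {x : HalfLink L // G.node x = n}, Fin (k x.1.1 + 1))
    (hm : ∫ g, ∏ x, halfLinkRep k x.1 g (m x) (m x) ∂haarSU2 ≠ 0) :
    ∃ w ∈ intertwiners G k n, w ≠ 0 := by
  refine ⟨WithLp.toLp 2 fun a => ∫ g, ∏ x, halfLinkRep k x.1 g (a x) (m x) ∂haarSU2, ?_, ?_⟩
  · refine mem_intertwiners.2 fun h => ?_
    ext a
    rw [nodeAction_apply]
    simp only [← integral_const_mul]
    have hint : ∀ c : (∀ x : {x : HalfLink L // G.node x = n}, Fin (k x.1.1 + 1)),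
        Integrable (fun g => (∏ x, halfLinkRep k x.1 h (a x) (c x)) *
          ∏ x, halfLinkRep k x.1 g (c x) (m x)) haarSU2 := fun c =>
      integrable_of_continuous (continuous_const.mul (continuous_prod_halfLinkRep c m))
    refine (integral_finsetSum _ fun c _ => hint c).symm.trans ?_
    refine Eq.trans ?_ (integral_mul_left_eq_self (μ := haarSU2)
      (fun g => ∏ x, halfLinkRep k x.1 g (a x) (m x)) h)
    refine integral_congr_ae (Filter.Eventually.of_forall fun g => ?_)
    simp only [halfLinkRep_mul]
    rw [Finset.prod_univ_sum, Fintype.piFinset_univ]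
    exact Finset.sum_congr rfl fun c _ => Finset.prod_mul_distrib.symm
  · intro h
    exact hm (congrFun (congrArg WithLp.ofLp h) m)

theorem exists_intertwiner_zero (hk : ∀ x, G.node x = n → k x.1 = 0) :
    ∃ w ∈ intertwiners G k n, w ≠ 0 := by
  refine exists_intertwiner_ne_zero (fun x => 0) ?_
  have h : ∀ (x : {x : HalfLink L // G.node x = n}) g,
      halfLinkRep k x.1 g ((0 : Fin (k x.1.1 + 1)) : ℕ) ((0 : Fin (k x.1.1 + 1)) : ℕ) = 1 := by
    intro x g
    rw [Fin.val_zero, halfLinkRep, hk x.1 x.2]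
    split_ifs <;> exact wignerD_zero _
  rw [integral_congr_ae (Filter.Eventually.of_forall fun g => Finset.prod_eq_one fun x _ => h x g)]
  simp

theorem halfLinkRep_two_one {x : HalfLink L} (hx : k x.1 = 2) (g : SU2) :
    halfLinkRep k x g 1 1 = ((2 * Complex.normSq (g.1 0 0) - 1 : ℝ) : ℂ) := by
  rw [halfLinkRep, hx]
  split_ifs
  · rw [wignerD_inv (by norm_num) (by norm_num), wignerD_two_one_one, Complex.conj_ofReal]
  · exact wignerD_two_one_one g

theorem halfLinkRep_two_highest {x : HalfLink L} (hx : k x.1 = 2) (g : SU2) :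
    halfLinkRep k x g (if x.2 then 2 else 0) (if x.2 then 2 else 0) = g.1 0 0 ^ 2 := by
  rw [halfLinkRep, hx]
  split_ifs
  · rw [wignerD_inv le_rfl le_rfl, wignerD_two_two_two, ← conj_entry_zero_zero, map_pow,
      Complex.conj_conj]
  · exact wignerD_two_zero_zero g

theorem halfLinkRep_two_lowest {x : HalfLink L} (hx : k x.1 = 2) (g : SU2) :
    halfLinkRep k x g (if x.2 then 0 else 2) (if x.2 then 0 else 2) = conj (g.1 0 0) ^ 2 := by
  rw [halfLinkRep, hx]
  split_ifs
  · rw [wignerD_inv (Nat.zero_le _) (Nat.zero_le _), wignerD_two_zero_zero, map_pow]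
  · rw [wignerD_two_two_two, conj_entry_zero_zero]

/-- Averaging the basis vector with highest weight at one half-link, lowest weight at a second one
and weight zero at all others gives an invariant vector. Its coefficient along that same basis
vector is the integral shown positive in `integral_sq_mul_pow_pos`. -/
theorem exists_intertwiner_two (hn : 2 < G.valence n) (hk : ∀ x, G.node x = n → k x.1 = 2) :
    ∃ w ∈ intertwiners G k n, w ≠ 0 := by
  obtain ⟨x₀, x₁, hne⟩ := Fintype.one_lt_card_iff.1 (lt_trans one_lt_two hn)
  -- At a target the representation is the dual one, so the indices `0` and `2` change roles there.
  let μ : {x : HalfLink L // G.node x = n} → ℕ := fun x =>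
    if x = x₀ then (if x.1.2 then 2 else 0) else if x = x₁ then (if x.1.2 then 0 else 2) else 1
  have hμ : ∀ x, μ x < k x.1.1 + 1 := fun x => by
    rw [hk x.1 x.2]
    simp only [μ]
    split_ifs <;> norm_num
  refine exists_intertwiner_ne_zero (fun x => ⟨μ x, hμ x⟩) ?_
  have h : ∀ g, ∏ x : {x : HalfLink L // G.node x = n}, halfLinkRep k x.1 g (μ x) (μ x) =
      ((Complex.normSq (g.1 0 0) ^ 2 * (2 * Complex.normSq (g.1 0 0) - 1) ^
        ((Finset.univ.erase x₀).erase x₁).card : ℝ) : ℂ) := by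
    intro g
    rw [← Finset.mul_prod_erase _ _ (Finset.mem_univ x₀),
      ← Finset.mul_prod_erase _ _ (Finset.mem_erase.2 ⟨hne.symm, Finset.mem_univ x₁⟩),
      Finset.prod_congr rfl fun x hx => ?_, Finset.prod_const]
    rotate_left
    · exact ((2 * Complex.normSq (g.1 0 0) - 1 : ℝ) : ℂ)
    · have h1 : x ≠ x₁ := (Finset.mem_erase.1 hx).1
      have h0 : x ≠ x₀ := (Finset.mem_erase.1 (Finset.mem_erase.1 hx).2).1
      simp only [μ, if_neg h0, if_neg h1]
      exact halfLinkRep_two_one (hk x.1 x.2) g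
    · have e0 : μ x₀ = if x₀.1.2 then 2 else 0 := if_pos rfl
      have e1 : μ x₁ = if x₁.1.2 then 0 else 2 := (if_neg hne.symm).trans (if_pos rfl)
      rw [e0, e1, halfLinkRep_two_highest (hk x₀.1 x₀.2), halfLinkRep_two_lowest (hk x₁.1 x₁.2),
        ← mul_assoc, ← mul_pow, Complex.mul_conj]
      push_cast
      rfl
  simp only [h]
  rw [integral_complex_ofReal]
  exact_mod_cast (integral_sq_mul_pow_pos _).ne'

theorem exists_regionIntertwiner_ne_zero {R : Finset N}
    (h : ∀ n ∈ R, ∃ w ∈ intertwiners G k n, w ≠ 0) :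
    ∃ v : regionIntertwiners G R k, v ≠ 0 := by
  choose w hw hw0 using fun n : R => h n.1 n.2
  refine ⟨⟨productVector G R k w, productVector_mem_regionIntertwiners hw⟩, fun h0 => ?_⟩
  have h1 : ∀ n : R, ∃ m, w n m ≠ 0 := fun n => by
    by_contra! hcon
    exact hw0 n (by ext m; exact hcon m)
  choose m hm using h1
  have h2 : productVector G R k w ((indexEquiv G R k).symm m) ≠ 0 := by
    rw [productVector_apply, Equiv.apply_symm_apply]
    exact Finset.prod_ne_zero_iff.2 fun n _ => hm n
  refine h2 ?_
  rw [show productVector G R k w = 0 from congrArg Subtype.val h0]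
  rfl

end Intertwiners

/-! ### Two nonzero sectors -/

section NotFactor

variable {N L : Type*} [Fintype N] [DecidableEq N] [Fintype L] [DecidableEq L]
  {G : OrientedGraph N L} {A : Finset N}

theorem lp_single_ne_zero {P : Type*} [DecidableEq P] {E : P → Type*}
    [∀ p, NormedAddCommGroup (E p)] {p : P} {v : E p} (hv : v ≠ 0) :
    (lp.single 2 p v : lp E 2) ≠ 0 := by
  intro h
  refine hv ?_
  rw [← lp.single_apply_self (E := E) 2 p v, h]
  rfl

/-- With constant spins inside and on the boundary, every half-link at a node of `R` carries the
same `c`. Here `c` is twice the spin, so the two values are spin 0 and spin 1. -/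
theorem exists_hRegion_ne_zero {R : Finset N}
    (hR : ∀ x, G.node x ∈ R → G.IsInner R x.1 ∨ (¬ G.IsInner R x.1 ∧ G.IsCut A x.1))
    (hG : ∀ n, 2 < G.valence n) {c : ℕ} (hc : c = 0 ∨ c = 2) :
    ∃ v : HRegion G A R fun _ => c, v ≠ 0 := by
  have hk : ∀ x, G.node x ∈ R → regionSpins G A R (fun _ => c) (fun _ => c) x.1 = c := by
    intro x hx
    rcases hR x hx with h | ⟨h, h'⟩
    · exact regionSpins_inner h _ _
    · exact regionSpins_cut h h' _ _
  obtain ⟨v, hv⟩ := exists_regionIntertwiner_ne_zero (G := G) (R := R)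
    (k := regionSpins G A R (fun _ => c) (fun _ => c)) (by
      intro n hn
      rcases hc with rfl | rfl
      · exact exists_intertwiner_zero fun x hx => hk x (hx ▸ hn)
      · exact exists_intertwiner_two (hG n) fun x hx => hk x (hx ▸ hn))
  exact ⟨lp.single 2 (fun _ => c) v, lp_single_ne_zero hv⟩

theorem exists_hRegion_left_ne_zero (hG : ∀ n, 2 < G.valence n) {c : ℕ} (hc : c = 0 ∨ c = 2) :
    ∃ v : HRegion G A A fun _ => c, v ≠ 0 :=
  exists_hRegion_ne_zero (fun x hx => (em (G.IsInner A x.1)).imp_right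
    fun h => ⟨h, isCut_of_mem hx h⟩) hG hc

theorem exists_hRegion_right_ne_zero (hG : ∀ n, 2 < G.valence n) {c : ℕ} (hc : c = 0 ∨ c = 2) :
    ∃ v : HRegion G A Aᶜ fun _ => c, v ≠ 0 :=
  exists_hRegion_ne_zero (fun x hx => (em (G.IsInner Aᶜ x.1)).imp_right
    fun h => ⟨h, isCut_of_not_mem (Finset.mem_compl.1 hx) h⟩) hG hc

/-- The boundary assignments with constant values `0` and `2` are different because a cut link
exists, and both of their summands are nonzero. -/
theorem not_isFactor_sectorDecompOf (hG : ∀ n, 2 < G.valence n) (hA : ∃ l, G.IsCut A l)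
    (U : HInv G ≃ₗᵢ[ℂ] HSectors G A) : ¬ IsFactor (sectorDecompOf U).vonNeumann := by
  obtain ⟨l, hl⟩ := hA
  obtain ⟨v, hv⟩ := exists_hRegion_left_ne_zero (A := A) hG (Or.inl rfl)
  obtain ⟨w, hw⟩ := exists_hRegion_right_ne_zero (A := A) hG (Or.inl rfl)
  obtain ⟨v', hv'⟩ := exists_hRegion_left_ne_zero (A := A) hG (Or.inr rfl)
  obtain ⟨w', hw'⟩ := exists_hRegion_right_ne_zero (A := A) hG (Or.inr rfl)
  refine (sectorDecompOf U).not_isFactor_vonNeumann ?_ hv hw hv' hw'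
  intro h
  have := congrFun h ⟨l, hl⟩
  norm_num at this

end NotFactor

end LQG

end

theorem mainTheorem1 {N L : Type*} [Fintype N] [DecidableEq N] [Fintype L] [DecidableEq L]
    (G : LQG.OrientedGraph N L) (hG : ∀ n, 2 < G.valence n)
    (A : Finset N) (hA : ∃ l, G.IsCut A l) :
    ∃ M : VonNeumannAlgebra (LQG.HInv G),
      (M : Set (LQG.HInv G →L[ℂ] LQG.HInv G)) = LQG.gaugeInvAlg G A ∧
      LQG.IsTypeI M ∧ ¬ LQG.IsFactor M ∧
      ∃ U : LQG.HInv G ≃ₗᵢ[ℂ] LQG.HSectors G A,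
        LQG.IsPeterWeyl G A U ∧
        (∀ T : LQG.HInv G →L[ℂ] LQG.HInv G,
          T ∈ M ↔ LQG.IsBlockOperator G A (LQG.conjBy G A U T)) ∧
        (∀ T : LQG.HInv G →L[ℂ] LQG.HInv G,
          T ∈ LQG.centre M ↔ LQG.IsSectorScalar G A (LQG.conjBy G A U T)) := by
  obtain ⟨U, hU⟩ := LQG.exists_isSpinNetworkUnitary G A
  refine ⟨(LQG.sectorDecompOf U).vonNeumann, Set.ext fun T => ?_,
    (LQG.sectorDecompOf U).isTypeI_vonNeumann, LQG.not_isFactor_sectorDecompOf hG hA U, U,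
    hU.isPeterWeyl, fun T => ?_, fun T => ?_⟩
  · exact (LQG.sectorDecompOf U).mem_vonNeumann.trans (LQG.mem_gaugeInvAlg_iff hU T).symm
  · exact (LQG.sectorDecompOf U).mem_vonNeumann.trans (LQG.isBlockOperator_conjBy_iff U T).symm
  · exact (LQG.sectorDecompOf U).mem_centre_vonNeumann.trans
      (LQG.isSectorScalar_conjBy_iff U T).symm
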